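/- Let $(M,g)$ be a closed (compact, without boundary) oriented smooth Riemannian surface, $\pi:SM\to M$ its unit tangent bundle, and $J$ the rotation by $+\pi/2$ in the tangent planes. Let $V$ be the infinitesimal generator of the $\mathrm{SO}(2)$-action on $SM$, and define 1-forms on $SM$ by $$(\omega_1)_{(x,v)}(\xi)=g(d\pi(\xi),v),\quad (\omega_2)_{(x,v)}(\xi)=g(d\pi(\xi),Jv),\quad \psi_{(x,v)}(\xi)=g\Big(\tfrac{DZ}{dt}(0),Jv\Big),$$ where $Z$ is any curve in $SM$ with $Z(0)=(x,v)$, $\dot Z(0)=\xi$, and $D/dt$ is the Levi-Civita covariant derivative along $\pi\circ Z$. Let $X$ (the geodesic vector field) and $H$ be the vector fields on $SM$ such that $(X,H,V)$ is dual to $(\omega_1,\omega_2,\psi)$. Let $K_g$ be the Gauss curvature. Let $\lambda:SM\to\mathbb R$ be any smooth function, let $F=X+\lambda V$, and let $\phi$ be the flow of $F$ on $SM$ (the thermostat flow). Put $\kappa:=K_g\circ\pi-H\lambda+\lambda^2$. Let $p:SM\to\mathbb R$ be a smooth function such that $$\kappa_p:=\kappa+Fp+p(p-V\lambda)<0\quad\text{on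 } SM .$$ (1) Then $\phi$ has a dominated splitting, in the following sense. Let $E=TSM/\mathbb RF$, identified with $SM\times\mathbb R^2$ by means of the basis $([H],[V])$, and let $\Psi_t(x,v)\in GL(2,\mathbb R)$ be the matrix of the map $E_{(x,v)}\to E_{\phi_t(x,v)}$ induced by $d\phi_t$. There are continuous $\Psi$-invariant line subbundles $E^u,E^s$ of $E$ with $E=E^u\oplus E^s$, and constants $C>0$, $0<\tau<1$, such that for all $(x,v)\in SM$ and $t>0$ $$\|\Psi_t|_{E^s(x,v)}\|\,\|\Psi_{-t}|_{E^u(\phi_t(x,v))}\|\le C\tau^t .$$ (2) If in addition $\kappa_p+\frac{(V\lambda)^2}{4}<0$ on $SM$, then $\phi$ is Anosov: there is a continuous $d\phi_t$-invariant splitting $TSM=\mathbb RF\oplus E^u\oplus E^s$ into line bundles and constants $C>0$, $0<\zeta<1<\eta$ such that for all $t>0$ $$\|d\phi_{-t}|_{E^u}\|\le C\eta^{-t},\qquad \|d\phi_t|_{E^s}\|\le C\zeta^t ,$$ the norm being that of the Riemannian metric $\omega_1^2+\omega_2^2+\psi^2$ on $SM$. -/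

import Mathlib

open Bundle Manifold Set Filter Topology
open scoped ContDiff

set_option linter.unusedSectionVars false

noncomputable section

/-- The Euclidean plane, the model space of surfaces. -/
abbrev Plane : Type := EuclideanSpace ℝ (Fin 2)

/-- The rotation of the model plane by a right angle. -/
def rotPlane (w : Plane) : Plane := !₂[-(w 1), w 0]

/-- The slope of `w` with respect to the axis `w₀`: the coordinate `s` such that `w` is
proportional to `w₀ + s • rotPlane w₀`. -/
def slopeAlong (w₀ w : Plane) : ℝ := inner ℝ w (rotPlane w₀) / inner ℝ w w₀

lemma plane_inner (v w : Plane) : inner ℝ v w = v 0 * w 0 + v 1 * w 1 := by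
  simp [PiLp.inner_apply, Fin.sum_univ_two]; ring

lemma slopeAlong_smul (w₀ w : Plane) {c : ℝ} (hc : c ≠ 0) :
    slopeAlong w₀ (c • w) = slopeAlong w₀ w := by
  simp only [slopeAlong, inner_smul_left, RCLike.conj_to_real]
  exact mul_div_mul_left _ _ hc

lemma inner_add_smul_rotPlane (w₀ : Plane) (s : ℝ) :
    inner ℝ (w₀ + s • rotPlane w₀) w₀ = inner ℝ w₀ w₀ := by
  simp only [plane_inner, rotPlane]; simp; ring

lemma slopeAlong_add_smul {w₀ : Plane} (hw : w₀ ≠ 0) (s : ℝ) :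
    slopeAlong w₀ (w₀ + s • rotPlane w₀) = s := by
  have h := (real_inner_self_pos.2 hw).ne'
  rw [slopeAlong, inner_add_smul_rotPlane, div_eq_iff h]
  simp only [plane_inner, rotPlane]; simp; ring

lemma eq_smul_add_slopeAlong {w₀ w : Plane} (h : 0 < inner ℝ w w₀) :
    w = (inner ℝ w w₀ / inner ℝ w₀ w₀) • (w₀ + slopeAlong w₀ w • rotPlane w₀) := by
  have hw : w₀ ≠ 0 := by rintro rfl; simp at h
  have h0 := (real_inner_self_pos.2 hw).ne'
  have h1 := h.ne'
  have key : (inner ℝ w₀ w₀ : ℝ) • w =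
      (inner ℝ w w₀ : ℝ) • w₀ + (inner ℝ w (rotPlane w₀) : ℝ) • rotPlane w₀ := by
    ext i
    fin_cases i <;> simp only [plane_inner, rotPlane] <;> simp <;> ring
  have h2 : w = (inner ℝ w₀ w₀ : ℝ)⁻¹ • ((inner ℝ w₀ w₀ : ℝ) • w) := by
    rw [smul_smul, inv_mul_cancel₀ h0, one_smul]
  rw [key] at h2
  refine h2.trans ?_
  rw [slopeAlong, smul_add, smul_add, smul_smul, smul_smul, smul_smul]
  congr 2
  · field_simp
  · field_simp

lemma add_smul_rotPlane_ne_zero {w₀ : Plane} (hw : w₀ ≠ 0) (s : ℝ) :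
    w₀ + s • rotPlane w₀ ≠ 0 := by
  intro h
  have h2 := inner_add_smul_rotPlane w₀ s
  rw [h, inner_zero_left] at h2
  exact hw (inner_self_eq_zero.1 h2.symm)

lemma contDiff_rotPlane_line (w₀ : Plane) :
    ContDiff ℝ ∞ (fun s : ℝ => w₀ + s • rotPlane w₀) := by fun_prop

lemma contDiffAt_slopeAlong {w₀ w : Plane} (h : inner ℝ w w₀ ≠ (0 : ℝ)) :
    ContDiffAt ℝ ∞ (slopeAlong w₀) w :=
  ContDiffAt.div (contDiffAt_id.inner ℝ contDiffAt_const)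
    (contDiffAt_id.inner ℝ contDiffAt_const) h

section UnitTangent

variable (M : Type*) [TopologicalSpace M] [ChartedSpace Plane M] [IsManifold (𝓡 2) ∞ M]
  [RiemannianBundle (fun x : M => TangentSpace (𝓡 2) x)]

/-- The unit tangent bundle `SM` of a Riemannian surface `M`. -/
def UnitTangentBundle : Type _ := {q : TangentBundle (𝓡 2) M // ‖q.2‖ = 1}

instance : TopologicalSpace (UnitTangentBundle M) := instTopologicalSpaceSubtype

variable {M}

namespace UnitTangentBundle

/-- The inclusion `SM → TM`. -/
def incl (q : UnitTangentBundle M) : TangentBundle (𝓡 2) M := q.1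

/-- The foot point projection `π : SM → M`. -/
def base (q : UnitTangentBundle M) : M := q.incl.1

/-- The unit vector `v` of the point `(x, v)` of `SM`. -/
def vec (q : UnitTangentBundle M) : TangentSpace (𝓡 2) q.base := q.incl.2

lemma norm_vec (q : UnitTangentBundle M) : ‖q.vec‖ = 1 := q.2

lemma incl_ne_zero (q : UnitTangentBundle M) : q.incl.2 ≠ 0 := by
  intro h
  have h2 : ‖q.incl.2‖ = 1 := q.2
  rw [h] at h2; simp at h2

lemma continuous_incl : Continuous (incl : UnitTangentBundle M → TangentBundle (𝓡 2) M) :=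
  continuous_subtype_val

open Classical in
/-- Rescaling of a nonzero tangent vector to unit length (with the value `p` on zero vectors). -/
def normalize (p : UnitTangentBundle M) (q : TangentBundle (𝓡 2) M) : UnitTangentBundle M :=
  if h : q.2 = 0 then p else ⟨⟨q.1, ‖q.2‖⁻¹ • q.2⟩, by
    simp [norm_smul, h]⟩

lemma incl_normalize (p : UnitTangentBundle M) {q : TangentBundle (𝓡 2) M} (h : q.2 ≠ 0) :
    (normalize p q).incl = ⟨q.1, ‖q.2‖⁻¹ • q.2⟩ := by
  simp [normalize, h, incl]

lemma chart_smul (p : TangentBundle (𝓡 2) M) {q : TangentBundle (𝓡 2) M}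
    (hx : q.1 ∈ (chartAt Plane p.1).source) (c : ℝ) :
    chartAt (ModelProd Plane Plane) p ⟨q.1, c • q.2⟩ =
      ((chartAt (ModelProd Plane Plane) p q).1,
        c • (chartAt (ModelProd Plane Plane) p q).2) := by
  refine Prod.ext rfl ?_
  exact ((trivializationAt Plane (TangentSpace (𝓡 2)) p.1).linear ℝ
    (by simpa using hx)).map_smul c q.2

lemma chart_snd_ne_zero (p : TangentBundle (𝓡 2) M) {q : TangentBundle (𝓡 2) M}
    (hx : q.1 ∈ (chartAt Plane p.1).source) :
    (chartAt (ModelProd Plane Plane) p q).2 ≠ 0 ↔ q.2 ≠ 0 := by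
  have hx' : q.1 ∈ (trivializationAt Plane (TangentSpace (𝓡 2)) p.1).baseSet := by
    simpa using hx
  exact ((trivializationAt Plane (TangentSpace (𝓡 2)) p.1).continuousLinearEquivAt ℝ
    q.1 hx').map_ne_zero_iff

lemma chart_normalize (p : TangentBundle (𝓡 2) M) (p₀ : UnitTangentBundle M)
    {q : TangentBundle (𝓡 2) M}
    (hx : q.1 ∈ (chartAt Plane p.1).source) (hq : q.2 ≠ 0) :
    chartAt (ModelProd Plane Plane) p (normalize p₀ q).incl =
      ((chartAt (ModelProd Plane Plane) p q).1,
        ‖q.2‖⁻¹ • (chartAt (ModelProd Plane Plane) p q).2) := by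
  rw [incl_normalize p₀ hq, chart_smul p hx]

lemma normalize_incl (p₀ q : UnitTangentBundle M) {r : TangentBundle (𝓡 2) M} {c : ℝ}
    (hc : 0 < c) (hr : r = ⟨q.incl.1, c • q.incl.2⟩) : normalize p₀ r = q := by
  have hn : ‖q.incl.2‖ = 1 := q.2
  have h0 : r.2 ≠ 0 := by
    subst hr; exact smul_ne_zero hc.ne' q.incl_ne_zero
  apply Subtype.ext
  change (normalize p₀ r).incl = q.incl
  rw [incl_normalize p₀ h0]
  subst hr
  simp only [norm_smul, hn, Real.norm_of_nonneg hc.le, mul_one, smul_smul,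
    inv_mul_cancel₀ hc.ne', one_smul]

/-- The coordinates of the unit vector `p` in the preferred tangent chart at `p`. -/
def axis (p : UnitTangentBundle M) : Plane := (chartAt (ModelProd Plane Plane) p.incl p.incl).2

lemma axis_ne_zero (p : UnitTangentBundle M) : p.axis ≠ 0 :=
  (chart_snd_ne_zero p.incl (mem_chart_source Plane p.incl.1)).2 p.incl_ne_zero

/-- The point of `TM` with given base coordinates on the ray of given slope. -/
def rayPoint (p : UnitTangentBundle M) (z : Plane × ℝ) : TangentBundle (𝓡 2) M :=
  (chartAt (ModelProd Plane Plane) p.incl).symm (z.1, p.axis + z.2 • rotPlane p.axis)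

lemma rayPoint_chart (p : UnitTangentBundle M) {z : Plane × ℝ}
    (hz : z.1 ∈ (chartAt Plane p.incl.1).target) :
    chartAt (ModelProd Plane Plane) p.incl (p.rayPoint z) =
      (z.1, p.axis + z.2 • rotPlane p.axis) :=
  (chartAt (ModelProd Plane Plane) p.incl).right_inv
    ((TangentBundle.mem_chart_target_iff (I := 𝓡 2) _ _).2 hz)

lemma rayPoint_base_mem (p : UnitTangentBundle M) {z : Plane × ℝ}
    (hz : z.1 ∈ (chartAt Plane p.incl.1).target) :
    (p.rayPoint z).1 ∈ (chartAt Plane p.incl.1).source :=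
  (chartAt Plane p.incl.1).map_target hz

lemma rayPoint_ne_zero (p : UnitTangentBundle M) {z : Plane × ℝ}
    (hz : z.1 ∈ (chartAt Plane p.incl.1).target) : (p.rayPoint z).2 ≠ 0 := by
  rw [← chart_snd_ne_zero p.incl (p.rayPoint_base_mem hz), p.rayPoint_chart hz]
  exact add_smul_rotPlane_ne_zero p.axis_ne_zero _

lemma continuousOn_normalize
    [IsContMDiffRiemannianBundle (𝓡 2) ∞ Plane (fun x : M => TangentSpace (𝓡 2) x)]
    (p : UnitTangentBundle M) :
    ContinuousOn (normalize p) {q : TangentBundle (𝓡 2) M | q.2 ≠ 0} := by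
  have : IsContinuousRiemannianBundle Plane (fun x : M => TangentSpace (𝓡 2) x) := by
    obtain ⟨g, hg, hg'⟩ := IsContMDiffRiemannianBundle.exists_contMDiff (IB := 𝓡 2) (n := ∞)
      (F := Plane) (E := fun x : M => TangentSpace (𝓡 2) x)
    exact ⟨g, hg.continuous, hg'⟩
  have hin : Continuous (fun q : TangentBundle (𝓡 2) M => inner ℝ q.2 q.2) :=
    Continuous.inner_bundle (F := Plane) (E := fun x : M => TangentSpace (𝓡 2) x)
      (b := fun q : TangentBundle (𝓡 2) M => q.1) (v := fun q => q.2) (w := fun q => q.2)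
      continuous_id continuous_id
  have hnorm : Continuous (fun q : TangentBundle (𝓡 2) M => ‖q.2‖) := by
    simpa only [real_inner_self_eq_norm_sq, Real.sqrt_sq (norm_nonneg _)] using hin.sqrt
  have hsmul : ContinuousOn (fun q : TangentBundle (𝓡 2) M =>
      (⟨q.1, ‖q.2‖⁻¹ • q.2⟩ : TangentBundle (𝓡 2) M)) {q | q.2 ≠ 0} := by
    intro q hq
    have hinv : ContinuousAt (fun q : TangentBundle (𝓡 2) M => ‖q.2‖⁻¹) q :=
      hnorm.continuousAt.inv₀ (by simpa using hq)
    apply ContinuousAt.continuousWithinAt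
    rw [FiberBundle.continuousAt_totalSpace]
    refine ⟨(FiberBundle.continuous_proj Plane _).continuousAt, ?_⟩
    have h1 : ContinuousAt (fun r : TangentBundle (𝓡 2) M =>
        (trivializationAt Plane (TangentSpace (𝓡 2)) q.1 r).2) q :=
      ((FiberBundle.continuousAt_totalSpace Plane (E := fun x : M => TangentSpace (𝓡 2) x)
        (f := id) (x₀ := q)).1 continuousAt_id).2
    refine (hinv.smul h1).congr ?_
    have hs : (fun r : TangentBundle (𝓡 2) M => r.1) ⁻¹' (chartAt Plane q.1).source ∈ 𝓝 q :=
      (FiberBundle.continuous_proj Plane (fun x : M => TangentSpace (𝓡 2) x)).continuousAt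
        ((chartAt Plane q.1).open_source.mem_nhds (mem_chart_source _ _))
    filter_upwards [hs] with r hr
    exact (congrArg Prod.snd (chart_smul q hr ‖r.2‖⁻¹)).symm
  rw [continuousOn_iff_continuous_domRestrict] at hsmul ⊢
  refine continuous_induced_rng.2 (hsmul.congr ?_)
  rintro ⟨q, hq⟩
  exact (incl_normalize p hq).symm

section Charts

variable [IsContMDiffRiemannianBundle (𝓡 2) ∞ Plane (fun x : M => TangentSpace (𝓡 2) x)]

/-- The chart of `SM` around `p`: a unit vector is sent to the coordinates of its foot point in the
preferred chart of `M`, and to the slope of its coordinate vector with respect to that of `p`. -/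
def chart (p : UnitTangentBundle M) : OpenPartialHomeomorph (UnitTangentBundle M) (Plane × ℝ) where
  toFun q := ((chartAt (ModelProd Plane Plane) p.incl q.incl).1,
    slopeAlong p.axis (chartAt (ModelProd Plane Plane) p.incl q.incl).2)
  invFun z := normalize p (p.rayPoint z)
  source := {q | q.incl ∈ (chartAt (ModelProd Plane Plane) p.incl).source ∧
    0 < (inner ℝ (chartAt (ModelProd Plane Plane) p.incl q.incl).2 p.axis : ℝ)}
  target := (chartAt Plane p.incl.1).target ×ˢ univ
  map_source' := by
    rintro q ⟨hq, -⟩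
    refine ⟨?_, mem_univ _⟩
    exact (chartAt Plane p.incl.1).map_source ((TangentBundle.mem_chart_source_iff _ _).1 hq)
  map_target' := by
    rintro z ⟨hz, -⟩
    have hb := p.rayPoint_base_mem hz
    have h0 := p.rayPoint_ne_zero hz
    refine ⟨?_, ?_⟩
    · rw [incl_normalize p h0]
      exact (TangentBundle.mem_chart_source_iff _ _).2 hb
    · rw [chart_normalize p.incl p hb h0, p.rayPoint_chart hz, inner_smul_left,
        inner_add_smul_rotPlane]
      exact mul_pos (by simpa using h0) (real_inner_self_pos.2 p.axis_ne_zero)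
  left_inv' := by
    rintro q ⟨hq, hpos⟩
    have hb := (TangentBundle.mem_chart_source_iff (I := 𝓡 2) _ _).1 hq
    have hax := real_inner_self_pos.2 p.axis_ne_zero
    have hc : 0 < (inner ℝ (chartAt (ModelProd Plane Plane) p.incl q.incl).2 p.axis : ℝ) /
      inner ℝ p.axis p.axis := div_pos hpos hax
    refine normalize_incl p q (inv_pos.2 hc) ?_
    have hsrc : (⟨q.incl.1, ((inner ℝ (chartAt (ModelProd Plane Plane) p.incl q.incl).2 p.axis : ℝ)
        / inner ℝ p.axis p.axis)⁻¹ • q.incl.2⟩ : TangentBundle (𝓡 2) M) ∈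
        (chartAt (ModelProd Plane Plane) p.incl).source :=
      (TangentBundle.mem_chart_source_iff _ _).2 hb
    rw [← (chartAt (ModelProd Plane Plane) p.incl).left_inv hsrc, chart_smul p.incl hb]
    unfold rayPoint
    congr 1
    refine Prod.ext rfl ?_
    have h := eq_smul_add_slopeAlong hpos
    exact ((inv_smul_eq_iff₀ hc.ne').2 h).symm
  right_inv' := by
    rintro z ⟨hz, -⟩
    have hb := p.rayPoint_base_mem hz
    have h0 := p.rayPoint_ne_zero hz
    rw [chart_normalize p.incl p hb h0, p.rayPoint_chart hz]
    refine Prod.ext rfl ?_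
    change slopeAlong p.axis (_ • _) = _
    rw [slopeAlong_smul _ _ (by simpa using h0), slopeAlong_add_smul p.axis_ne_zero]
  open_source := by
    have hc := (chartAt (ModelProd Plane Plane) p.incl).continuousOn
    have ho := (chartAt (ModelProd Plane Plane) p.incl).open_source
    have hc2 : ContinuousOn (fun r : TangentBundle (𝓡 2) M =>
        (inner ℝ (chartAt (ModelProd Plane Plane) p.incl r).2 p.axis : ℝ))
        (chartAt (ModelProd Plane Plane) p.incl).source :=
      (continuous_snd.comp_continuousOn hc).inner continuousOn_const
    exact (hc2.isOpen_inter_preimage ho isOpen_Ioi).preimage continuous_incl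
  open_target := (chartAt Plane p.incl.1).open_target.prod isOpen_univ
  continuousOn_toFun := by
    have hc := (chartAt (ModelProd Plane Plane) p.incl).continuousOn.comp
      continuous_incl.continuousOn (s := {q : UnitTangentBundle M |
        q.incl ∈ (chartAt (ModelProd Plane Plane) p.incl).source ∧
        0 < (inner ℝ (chartAt (ModelProd Plane Plane) p.incl q.incl).2 p.axis : ℝ)})
      (fun q hq => hq.1)
    refine ContinuousOn.prodMk (continuous_fst.comp_continuousOn hc) ?_
    have h2 := continuous_snd.comp_continuousOn hc
    intro q hq
    exact ContinuousAt.comp_continuousWithinAt (g := slopeAlong p.axis)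
      (contDiffAt_slopeAlong hq.2.ne').continuousAt (h2 q hq)
  continuousOn_invFun := by
    have h1 : ContinuousOn p.rayPoint ((chartAt Plane p.incl.1).target ×ˢ univ) := by
      refine (chartAt (ModelProd Plane Plane) p.incl).continuousOn_symm.comp
        (Continuous.continuousOn ?_) ?_
      · exact continuous_fst.prodMk
          ((contDiff_rotPlane_line p.axis).continuous.comp continuous_snd)
      · rintro z ⟨hz, -⟩
        exact (TangentBundle.mem_chart_target_iff (I := 𝓡 2) _ _).2 hz
    exact (continuousOn_normalize p).comp h1 (fun z hz => p.rayPoint_ne_zero hz.1)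

lemma mem_chart_source_self (p : UnitTangentBundle M) : p ∈ p.chart.source :=
  ⟨mem_chart_source _ _, real_inner_self_pos.2 p.axis_ne_zero⟩

/-- `SM` as a three-dimensional manifold. -/
instance : ChartedSpace (Plane × ℝ) (UnitTangentBundle M) where
  atlas := range chart
  chartAt := chart
  mem_chart_source := mem_chart_source_self
  chart_mem_atlas p := mem_range_self p

instance : IsManifold 𝓘(ℝ, Plane × ℝ) ∞ (UnitTangentBundle M) := by
  refine isManifold_of_contDiffOn _ _ _ ?_
  rintro _ _ ⟨p, rfl⟩ ⟨p', rfl⟩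
  simp only [modelWithCornersSelf_coe, modelWithCornersSelf_coe_symm, range_id, inter_univ,
    Function.id_comp, Function.comp_id, preimage_id]
  intro z hz
  obtain ⟨⟨hz1, -⟩, hz2, hz3⟩ := hz
  have hb := p.rayPoint_base_mem hz1
  have h0 := p.rayPoint_ne_zero hz1
  have hb' : (p.rayPoint z).1 ∈ (chartAt Plane p'.incl.1).source := by
    have h := (TangentBundle.mem_chart_source_iff (I := 𝓡 2) _ _).1 hz2
    change (normalize p (p.rayPoint z)).incl.1 ∈ _ at h
    rwa [incl_normalize p h0] at h
  have hM : IsManifold ((𝓡 2).prod 𝓘(ℝ, Plane)) ∞ (TangentBundle (𝓡 2) M) :=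
    Bundle.TotalSpace.isManifold Plane (TangentSpace (𝓡 2))
  have hD : ContDiffAt ℝ ∞ (extChartAt ((𝓡 2).prod 𝓘(ℝ, Plane)) p'.incl ∘
      (extChartAt ((𝓡 2).prod 𝓘(ℝ, Plane)) p.incl).symm)
      (z.1, p.axis + z.2 • rotPlane p.axis) := by
    have h := contDiffWithinAt_ext_coord_change (I := (𝓡 2).prod 𝓘(ℝ, Plane)) (n := ∞)
      p'.incl p.incl (y := (z.1, p.axis + z.2 • rotPlane p.axis)) ?_
    · rwa [ModelWithCorners.Boundaryless.range_eq_univ, contDiffWithinAt_univ] at h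
    · rw [PartialEquiv.trans_source]
      refine ⟨?_, ?_⟩
      · rw [PartialEquiv.symm_source, extChartAt_target]
        exact ⟨(TangentBundle.mem_chart_target_iff (I := 𝓡 2) _ _).2 hz1, by
          rw [ModelWithCorners.Boundaryless.range_eq_univ]; trivial⟩
      · rw [mem_preimage, extChartAt_source]
        exact (TangentBundle.mem_chart_source_iff (I := 𝓡 2) _ _).2 hb'
  have hline : ContDiffAt ℝ ∞ (fun z : Plane × ℝ => (z.1, p.axis + z.2 • rotPlane p.axis)) z := by
    fun_prop
  have hcomp : ContDiffAt ℝ ∞ (F := Plane × Plane) (fun z : Plane × ℝ =>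
      chartAt (ModelProd Plane Plane) p'.incl (p.rayPoint z)) z :=
    ContDiffAt.comp (g := extChartAt ((𝓡 2).prod 𝓘(ℝ, Plane)) p'.incl ∘
      (extChartAt ((𝓡 2).prod 𝓘(ℝ, Plane)) p.incl).symm) z hD hline
  have hpos : (inner ℝ (chartAt (ModelProd Plane Plane) p'.incl (p.rayPoint z)).2 p'.axis : ℝ)
      ≠ 0 := by
    have h := hz3
    change 0 < (inner ℝ (chartAt (ModelProd Plane Plane) p'.incl
      (normalize p (p.rayPoint z)).incl).2 p'.axis : ℝ) at h
    rw [chart_normalize p'.incl p hb' h0, inner_smul_left] at h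
    exact fun h' => by simp [h'] at h
  have hmain : ContDiffAt ℝ ∞ (fun z : Plane × ℝ =>
      (((chartAt (ModelProd Plane Plane) p'.incl (p.rayPoint z)).1 : Plane),
        slopeAlong p'.axis (chartAt (ModelProd Plane Plane) p'.incl (p.rayPoint z)).2)) z :=
    hcomp.fst.prodMk (ContDiffAt.comp z (contDiffAt_slopeAlong hpos) hcomp.snd)
  refine hmain.contDiffWithinAt.congr_of_mem ?_ ⟨⟨hz1, trivial⟩, hz2, hz3⟩
  rintro y ⟨⟨hy1, -⟩, hy2, -⟩
  have hy0 := p.rayPoint_ne_zero hy1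
  have hyb : (p.rayPoint y).1 ∈ (chartAt Plane p'.incl.1).source := by
    have h := (TangentBundle.mem_chart_source_iff (I := 𝓡 2) _ _).1 hy2
    change (normalize p (p.rayPoint y)).incl.1 ∈ _ at h
    rwa [incl_normalize p hy0] at h
  change ((chartAt (ModelProd Plane Plane) p'.incl (normalize p (p.rayPoint y)).incl).1,
    slopeAlong p'.axis
      (chartAt (ModelProd Plane Plane) p'.incl (normalize p (p.rayPoint y)).incl).2) = _
  rw [chart_normalize p'.incl p hyb hy0]
  exact Prod.ext rfl (slopeAlong_smul _ _ (by simpa using hy0))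

end Charts

end UnitTangentBundle
end UnitTangent

/-! ### Christoffel symbols and Gauss curvature -/

section Riemannian

variable {M : Type*} [TopologicalSpace M] [ChartedSpace Plane M] [IsManifold (𝓡 2) ∞ M]
  [RiemannianBundle (fun x : M => TangentSpace (𝓡 2) x)]

/-- The coordinate vector field `∂ᵢ` of the preferred chart at `x`, at a point `y` of its domain. -/
def coordVec (x y : M) (i : Fin 2) : TangentSpace (𝓡 2) y :=
  (trivializationAt Plane (TangentSpace (𝓡 2)) x).symmL ℝ y (EuclideanSpace.single i 1)

/-- The matrix `g_{ij}(u)` of the metric in the preferred chart at `x`. -/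
def gram (x : M) (u : Plane) : Matrix (Fin 2) (Fin 2) ℝ :=
  Matrix.of fun i j => inner ℝ (coordVec x ((chartAt Plane x).symm u) i)
    (coordVec x ((chartAt Plane x).symm u) j)

/-- The partial derivative `∂ᵢ f` of a function on the coordinate plane. -/
def partialD (i : Fin 2) (f : Plane → ℝ) (u : Plane) : ℝ :=
  fderiv ℝ f u (EuclideanSpace.single i 1)

/-- The Christoffel symbol `Γ^k_{ij}(u)` of the Levi-Civita connection in the preferred chart
at `x`. -/
def christoffel (x : M) (k i j : Fin 2) (u : Plane) : ℝ :=
  (1 / 2) * ∑ l, (gram x u)⁻¹ k l *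
    (partialD i (fun u' => gram x u' j l) u + partialD j (fun u' => gram x u' i l) u
      - partialD l (fun u' => gram x u' i j) u)

/-- The coefficient `R^l_{ijk}` of the curvature tensor in the preferred chart at `x`:
`R(∂ᵢ, ∂ⱼ)∂ₖ = ∑ R^l_{ijk} ∂ₗ` with `R(Y, Z) = ∇_Y ∇_Z - ∇_Z ∇_Y - ∇_[Y, Z]`. -/
def curvatureCoeff (x : M) (l i j k : Fin 2) (u : Plane) : ℝ :=
  partialD i (christoffel x l j k) u - partialD j (christoffel x l i k) u
    + ∑ m, (christoffel x l i m u * christoffel x m j k u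
      - christoffel x l j m u * christoffel x m i k u)

/-- The Gauss curvature `K_g(x) = g(R(∂₀, ∂₁)∂₁, ∂₀) / (g₀₀ g₁₁ - g₀₁²)`. -/
def gaussCurvature (x : M) : ℝ :=
  (∑ l, gram x (chartAt Plane x x) 0 l * curvatureCoeff x l 0 1 1 (chartAt Plane x x))
    / (gram x (chartAt Plane x x)).det

instance factFinrankTangent (x : M) : Fact (Module.finrank ℝ (TangentSpace (𝓡 2) x) = 2) :=
  ⟨by change Module.finrank ℝ Plane = 2; simp⟩

end Riemannian

/-! ### Oriented surfaces -/

/-- An orientation of the surface `M`: an orientation of every tangent plane, locally constant in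
charts. -/
structure SurfaceOrientation (M : Type*) [TopologicalSpace M] [ChartedSpace Plane M]
    [IsManifold (𝓡 2) ∞ M] where
  /-- The orientation of the tangent plane at `x`. -/
  orient : ∀ x : M, Orientation ℝ (TangentSpace (𝓡 2) x) (Fin 2)
  locallyConstant : ∀ x₀ : M, ∀ᶠ x in 𝓝 x₀,
    ∃ L : TangentSpace (𝓡 2) x ≃ₗ[ℝ] TangentSpace (𝓡 2) x₀,
      (∀ v : TangentSpace (𝓡 2) x, L v = tangentCoordChange (𝓡 2) x x₀ x v) ∧
        Orientation.map (Fin 2) L (orient x) = orient x₀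

/-! ### The canonical coframe and frame of `SM` -/

namespace UnitTangentBundle

variable {M : Type*} [TopologicalSpace M] [ChartedSpace Plane M] [IsManifold (𝓡 2) ∞ M]
  [RiemannianBundle (fun x : M => TangentSpace (𝓡 2) x)]
  [IsContMDiffRiemannianBundle (𝓡 2) ∞ Plane (fun x : M => TangentSpace (𝓡 2) x)]

/-- The model with corners of the three-manifold `SM`. -/
abbrev model : ModelWithCorners ℝ (Plane × ℝ) (Plane × ℝ) := 𝓘(ℝ, Plane × ℝ)

/-- `Jv`: the unit vector such that `(v, Jv)` is a positive orthonormal basis. -/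
def jvec (o : SurfaceOrientation M) (q : UnitTangentBundle M) : TangentSpace (𝓡 2) q.base :=
  (o.orient q.base).rightAngleRotation q.vec

/-- The action of `SO(2)` on `SM`: rotation of the unit vector by the angle `θ`. -/
def rotate (o : SurfaceOrientation M) (θ : ℝ) (q : UnitTangentBundle M) : UnitTangentBundle M :=
  ⟨⟨q.base, (o.orient q.base).rotation (θ : Real.Angle) q.vec⟩,
    ((o.orient q.base).rotation (θ : Real.Angle)).norm_map q.vec |>.trans q.norm_vec⟩

/-- The differential `dπ : T SM → TM`. -/
def dbase (q : UnitTangentBundle M) (ξ : TangentSpace model q) : TangentSpace (𝓡 2) q.base :=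
  mfderiv model (𝓡 2) base q ξ

/-- The velocity of a curve `Z` in `SM` through `q = (x, v)` with `Z'(0) = ξ`, in the coordinates
`(x¹, x², v¹, v²)` of `TM` given by the preferred chart of `M` at `x`. -/
def coordVelocity (q : UnitTangentBundle M) (ξ : TangentSpace model q) : Plane × Plane :=
  mfderiv model ((𝓡 2).prod 𝓘(ℝ, Plane)) incl q ξ

/-- The covariant derivative `DZ/dt (0)` along `π ∘ Z` of a curve `Z` in `SM` with `Z(0) = q` and
`Z'(0) = ξ`; in coordinates `(DZ/dt)^k = dv^k/dt + ∑ Γ^k_{ij} (dx^i/dt) v^j`. -/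
def covDeriv (q : UnitTangentBundle M) (ξ : TangentSpace model q) : TangentSpace (𝓡 2) q.base :=
  ∑ k, ((coordVelocity q ξ).2 k + ∑ i, ∑ j,
    christoffel q.base k i j (chartAt Plane q.base q.base) * (coordVelocity q ξ).1 i * q.axis j) •
      coordVec q.base q.base k

/-- The contact form `ω₁`. -/
def omega1 (q : UnitTangentBundle M) (ξ : TangentSpace model q) : ℝ :=
  inner ℝ (dbase q ξ) q.vec

/-- The semibasic form `ω₂`. -/
def omega2 (o : SurfaceOrientation M) (q : UnitTangentBundle M) (ξ : TangentSpace model q) : ℝ :=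
  inner ℝ (dbase q ξ) (q.jvec o)

/-- The Levi-Civita connection form `ψ`. -/
def psi (o : SurfaceOrientation M) (q : UnitTangentBundle M) (ξ : TangentSpace model q) : ℝ :=
  inner ℝ (covDeriv q ξ) (q.jvec o)

/-- The geodesic vector field `X`: the vector with `ω₁ = 1`, `ω₂ = 0`, `ψ = 0`. -/
def vfX (o : SurfaceOrientation M) (q : UnitTangentBundle M) : TangentSpace model q :=
  Classical.epsilon fun ξ => omega1 q ξ = 1 ∧ omega2 o q ξ = 0 ∧ psi o q ξ = 0

/-- The horizontal vector field `H`: the vector with `ω₁ = 0`, `ω₂ = 1`, `ψ = 0`. -/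
def vfH (o : SurfaceOrientation M) (q : UnitTangentBundle M) : TangentSpace model q :=
  Classical.epsilon fun ξ => omega1 q ξ = 0 ∧ omega2 o q ξ = 1 ∧ psi o q ξ = 0

/-- The vertical vector field `V`: the infinitesimal generator of the `SO(2)` action. -/
def vfV (o : SurfaceOrientation M) (q : UnitTangentBundle M) : TangentSpace model q :=
  (mfderiv 𝓘(ℝ, ℝ) model (fun θ : ℝ => rotate o θ q) 0 (1 : ℝ) : Plane × ℝ)

/-- The derivative `Yf` of a function on `SM` along a vector field. -/
def deriv (Y : ∀ q : UnitTangentBundle M, TangentSpace model q) (f : UnitTangentBundle M → ℝ)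
    (q : UnitTangentBundle M) : ℝ :=
  mfderiv model 𝓘(ℝ, ℝ) f q (Y q)

/-- The generator `F = X + λV` of the thermostat. -/
def thermostat (o : SurfaceOrientation M) (lam : UnitTangentBundle M → ℝ)
    (q : UnitTangentBundle M) : TangentSpace model q :=
  vfX o q + lam q • vfV o q

/-- `κ = K_g - Hλ + λ²`. -/
def kappa (o : SurfaceOrientation M) (lam : UnitTangentBundle M → ℝ)
    (q : UnitTangentBundle M) : ℝ :=
  gaussCurvature q.base - deriv (vfH o) lam q + lam q ^ 2

/-- `κ_p = κ + Fp + p(p - Vλ)`. -/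
def kappaP (o : SurfaceOrientation M) (lam p : UnitTangentBundle M → ℝ)
    (q : UnitTangentBundle M) : ℝ :=
  kappa o lam q + deriv (thermostat o lam) p q + p q * (p q - deriv (vfV o) lam q)

/-- `φ` is the (smooth, complete) flow generated by the vector field `F`. -/
structure IsFlow (F : ∀ q : UnitTangentBundle M, TangentSpace model q)
    (φ : ℝ → UnitTangentBundle M → UnitTangentBundle M) : Prop where
  smooth : ContMDiff (𝓘(ℝ, ℝ).prod model) model ∞
    (fun z : ℝ × UnitTangentBundle M => φ z.1 z.2)
  zero : ∀ q, φ 0 q = q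
  integralCurve : ∀ q, IsMIntegralCurve (I := model) (fun t => φ t q) F

/-! ### Dominated splittings -/

/-- The coordinates `(y, u)` of the class of `ξ` in `T SM / ℝF` with respect to the basis
`[H], [V]`. Indeed `ξ = ω₁(ξ) F + ω₂(ξ) H + (ψ(ξ) - λ ω₁(ξ)) V`. -/
def quotientCoords (o : SurfaceOrientation M) (lam : UnitTangentBundle M → ℝ)
    (q : UnitTangentBundle M) (ξ : TangentSpace model q) : Plane :=
  !₂[omega2 o q ξ, psi o q ξ - lam q * omega1 q ξ]

/-- The quotient cocycle `Ψ_t(q)`: the map induced by `dφ_t` on `T SM / ℝF`, in the bases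
`[H], [V]` at `q` and at `φ_t(q)`. -/
def cocycle (o : SurfaceOrientation M) (lam : UnitTangentBundle M → ℝ)
    (φ : ℝ → UnitTangentBundle M → UnitTangentBundle M) (t : ℝ) (q : UnitTangentBundle M)
    (w : Plane) : Plane :=
  quotientCoords o lam (φ t q) (mfderiv model model (φ t) q (w 0 • vfH o q + w 1 • vfV o q))

/-- A continuous line subbundle of the trivial bundle `SM × ℝ²`: a line at every point, locally
spanned by a continuous nowhere vanishing section. -/
def IsContinuousLineField (L : UnitTangentBundle M → Submodule ℝ Plane) : Prop :=
  ∀ q₀, ∃ U ∈ 𝓝 q₀, ∃ w : UnitTangentBundle M → Plane, ContinuousOn w U ∧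
    ∀ q ∈ U, w q ≠ 0 ∧ L q = Submodule.span ℝ {w q}

/-- The flow `φ` of the thermostat `X + λV` has a dominated splitting. The last condition says
`‖Ψ_t|E^s(q)‖ ‖Ψ_{-t}|E^u(φ_t q)‖ ≤ C τ^t`. -/
def HasDominatedSplitting (o : SurfaceOrientation M) (lam : UnitTangentBundle M → ℝ)
    (φ : ℝ → UnitTangentBundle M → UnitTangentBundle M) : Prop :=
  ∃ Eu Es : UnitTangentBundle M → Submodule ℝ Plane,
    IsContinuousLineField Eu ∧ IsContinuousLineField Es ∧
    (∀ q, IsCompl (Eu q) (Es q)) ∧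
    (∀ t q, cocycle o lam φ t q '' (Eu q) = Eu (φ t q)) ∧
    (∀ t q, cocycle o lam φ t q '' (Es q) = Es (φ t q)) ∧
    ∃ C > (0 : ℝ), ∃ τ : ℝ, 0 < τ ∧ τ < 1 ∧ ∀ t > (0 : ℝ), ∀ q,
      ∀ w ∈ Es q, ∀ w' ∈ Eu (φ t q),
        ‖cocycle o lam φ t q w‖ * ‖cocycle o lam φ (-t) (φ t q) w'‖
          ≤ C * τ ^ t * (‖w‖ * ‖w'‖)

/-! ### Anosov flows -/

/-- The norm on `T SM` of the Riemannian metric `ω₁² + ω₂² + ψ²` (the Sasaki metric). -/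
def sasakiNorm (o : SurfaceOrientation M) (q : UnitTangentBundle M) (ξ : TangentSpace model q) :
    ℝ :=
  Real.sqrt (omega1 q ξ ^ 2 + omega2 o q ξ ^ 2 + psi o q ξ ^ 2)

/-- A continuous line subbundle of `T SM`. -/
def IsContinuousTangentLineField
    (L : ∀ q : UnitTangentBundle M, Submodule ℝ (TangentSpace model q)) : Prop :=
  ∀ q₀, ∃ U ∈ 𝓝 q₀, ∃ w : ∀ q : UnitTangentBundle M, TangentSpace model q,
    ContinuousOn (fun q => (⟨q, w q⟩ : TangentBundle model (UnitTangentBundle M))) U ∧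
    ∀ q ∈ U, w q ≠ 0 ∧ L q = Submodule.span ℝ {w q}

/-- The flow `φ` generated by `F` on the three-manifold `SM` is Anosov: there is a continuous
invariant splitting `T SM = ℝF ⊕ E^u ⊕ E^s` with `E^s` uniformly contracted in the future and `E^u`
uniformly contracted in the past. -/
def IsAnosov (o : SurfaceOrientation M) (F : ∀ q : UnitTangentBundle M, TangentSpace model q)
    (φ : ℝ → UnitTangentBundle M → UnitTangentBundle M) : Prop :=
  ∃ Eu Es : ∀ q : UnitTangentBundle M, Submodule ℝ (TangentSpace model q),
    IsContinuousTangentLineField Eu ∧ IsContinuousTangentLineField Es ∧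
    (∀ q, F q ≠ 0 ∧ DirectSum.IsInternal ![Submodule.span ℝ {F q}, Eu q, Es q]) ∧
    (∀ t q, (Eu q).map (mfderiv model model (φ t) q).toLinearMap = Eu (φ t q)) ∧
    (∀ t q, (Es q).map (mfderiv model model (φ t) q).toLinearMap = Es (φ t q)) ∧
    ∃ C > (0 : ℝ), ∃ ζ η : ℝ, 0 < ζ ∧ ζ < 1 ∧ 1 < η ∧ ∀ t > (0 : ℝ), ∀ q,
      (∀ ξ ∈ Eu q, sasakiNorm o (φ (-t) q) (mfderiv model model (φ (-t)) q ξ)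
        ≤ C * η ^ (-t) * sasakiNorm o q ξ) ∧
      (∀ ξ ∈ Es q, sasakiNorm o (φ t q) (mfderiv model model (φ t) q ξ)
        ≤ C * ζ ^ t * sasakiNorm o q ξ)

end UnitTangentBundle

end

/-!
In the frame `(F, H + pV, V)` of `T SM` the derivative of the thermostat flow becomes a linear
differential equation in which the curvature enters only through `κ_p`: if `(x, y, z)` are the
components of `dφ_t(ξ)`, then

  `x' = λ y`,  `y' = p y + z`,  `z' = -κ_p y + (Vλ - p) z`.

These Jacobi equations (`UnitTangentBundle.hasDerivAt_coframe` and, in this frame,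
`UnitTangentBundle.hasDerivAt_frameDeriv`) follow from the structure equations of the coframe
`(ω₁, ω₂, ψ)`. Instead of exterior derivatives on `SM`, the proof uses a family of curves
`x(t, η)` of prescribed geodesic curvature in a chart of `M`. Commuting the covariant derivatives in `t`
and `η` is the absence of torsion and the definition of the curvature
(`PlaneMetric.IsLeviCivita.jacobi`).

If `κ_p < 0`, then `Q = yz` satisfies `Q' = -κ_p y² + z² + (Vλ) Q`, so the cone `yz < 0` is
invariant in negative time. The logarithm `l = log |z / y|` of the slope solves the Riccati
equation `l' = e^l + κ_p e^{-l} + Vλ - 2p`, whose right hand side is uniformly increasing in `l`,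
so the backward flow contracts the space of continuous slope functions with values in the cone
(`JacobiCocycle.abs_logSlope_sub_le`). Its fixed point is the bundle `E^s`, of slope `-r < 0`
(`JacobiCocycle.exists_stable_slope`); reversing time and the sign of `z` preserves the form of
the equations and gives `E^u`, of slope `s > 0`. Along these bundles `y` grows at the rates
`p - r` and `p + s`, and the gap `r + s` is bounded below on the compact space `SM`, which is the
domination.

If moreover `κ_p + (Vλ)² / 4 < 0`, then `Q'` is a positive definite quadratic form in `(y, z)`,
hence `|Q|` decays exponentially along `E^s` in the future and along `E^u` in the past
(`JacobiCocycle.sq_component_le`). The bundles lift from `T SM / ℝF` to invariant line fields in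
`T SM`: their component along `F` is the fixed point of an affine contraction
(`JacobiCocycle.exists_lift`).
-/

section SplittingOfThermostats

-- Several instances on tangent bundles and on their fibres are found only by nested synthesis.
set_option maxSynthPendingDepth 3

/-! ### Riemannian metrics on open sets of the plane -/

namespace PlaneMetric

/-- The standard area form of the plane. -/
noncomputable def wedge (a b : Plane) : ℝ := a 0 * b 1 - a 1 * b 0

/-- The standard basis of the plane. -/
noncomputable abbrev e (i : Fin 2) : Plane := EuclideanSpace.single i 1

/-- A Riemannian metric `g` on an open set `U` of the plane, together with its Christoffel map `Γ`
(characterized by the Koszul formula) and the density `A` of an area form, `A² = det g`. -/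
structure IsLeviCivita (U : Set Plane) (g : Plane → Plane →L[ℝ] Plane →L[ℝ] ℝ)
    (Γ : Plane → Plane →L[ℝ] Plane →L[ℝ] Plane) (A : Plane → ℝ) : Prop where
  isOpen : IsOpen U
  smooth_g : ContDiffOn ℝ ∞ g U
  smooth_Γ : ContDiffOn ℝ ∞ Γ U
  smooth_A : ContDiffOn ℝ ∞ A U
  symm : ∀ u ∈ U, ∀ a b, g u a b = g u b a
  pos : ∀ u ∈ U, ∀ a, a ≠ 0 → 0 < g u a a
  koszul : ∀ u ∈ U, ∀ a b c, 2 * g u (Γ u a b) c =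
    fderiv ℝ g u a b c + fderiv ℝ g u b a c - fderiv ℝ g u c a b
  area : ∀ u ∈ U, A u ^ 2 = g u (e 0) (e 0) * g u (e 1) (e 1) - g u (e 0) (e 1) ^ 2

/-- The curvature tensor `R(a, b)c` of the connection with Christoffel map `Γ`. -/
noncomputable def curv (Γ : Plane → Plane →L[ℝ] Plane →L[ℝ] Plane) (u a b c : Plane) : Plane :=
  fderiv ℝ Γ u a b c - fderiv ℝ Γ u b a c + Γ u a (Γ u b c) - Γ u b (Γ u a c)

/-- The Gauss curvature in coordinates. -/
noncomputable def gauss (g : Plane → Plane →L[ℝ] Plane →L[ℝ] ℝ)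
    (Γ : Plane → Plane →L[ℝ] Plane →L[ℝ] Plane) (u : Plane) : ℝ :=
  g u (e 0) (curv Γ u (e 0) (e 1) (e 1)) /
    (g u (e 0) (e 0) * g u (e 1) (e 1) - g u (e 0) (e 1) ^ 2)

lemma two_le_smooth : (2 : ℕ∞ω) ≤ ∞ := WithTop.coe_le_coe.2 le_top

lemma eq_basis (a : Plane) : a = a 0 • e 0 + a 1 • e 1 := by
  ext i; fin_cases i <;> simp

lemma bilin_expand (B : Plane →L[ℝ] Plane →L[ℝ] ℝ) (a b : Plane) :
    B a b = a 0 * b 0 * B (e 0) (e 0) + a 0 * b 1 * B (e 0) (e 1)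
      + a 1 * b 0 * B (e 1) (e 0) + a 1 * b 1 * B (e 1) (e 1) := by
  conv_lhs => rw [eq_basis a, eq_basis b]
  simp only [map_add, map_smul, add_apply, smul_apply, smul_eq_mul]
  ring

namespace IsLeviCivita

variable {U : Set Plane} {g : Plane → Plane →L[ℝ] Plane →L[ℝ] ℝ}
  {Γ : Plane → Plane →L[ℝ] Plane →L[ℝ] Plane} {A : Plane → ℝ}

section Tensors

variable (h : IsLeviCivita U g Γ A) {u : Plane} (hu : u ∈ U)

include h hu

lemma mem_nhds : U ∈ 𝓝 u := h.isOpen.mem_nhds hu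

lemma contDiffAt_g : ContDiffAt ℝ ∞ g u := h.smooth_g.contDiffAt (h.mem_nhds hu)

lemma contDiffAt_Γ : ContDiffAt ℝ ∞ Γ u := h.smooth_Γ.contDiffAt (h.mem_nhds hu)

lemma contDiffAt_A : ContDiffAt ℝ ∞ A u := h.smooth_A.contDiffAt (h.mem_nhds hu)

lemma hasFDerivAt_g : HasFDerivAt g (fderiv ℝ g u) u :=
  ((h.contDiffAt_g hu).differentiableAt (by simp)).hasFDerivAt

lemma hasFDerivAt_Γ : HasFDerivAt Γ (fderiv ℝ Γ u) u :=
  ((h.contDiffAt_Γ hu).differentiableAt (by simp)).hasFDerivAt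

lemma hasFDerivAt_A : HasFDerivAt A (fderiv ℝ A u) u :=
  ((h.contDiffAt_A hu).differentiableAt (by simp)).hasFDerivAt

lemma hasFDerivAt_fderiv_g : HasFDerivAt (fderiv ℝ g) (fderiv ℝ (fderiv ℝ g) u) u :=
  (((h.contDiffAt_g hu).fderiv_right (m := ∞) (by simp)).differentiableAt (by simp)).hasFDerivAt

/-- The metric is nondegenerate. -/
lemma ext_of_g {a b : Plane} (hab : ∀ c, g u a c = g u b c) : a = b := by
  by_contra hne
  have h1 := h.pos u hu (a - b) (sub_ne_zero.2 hne)
  have h2 : g u (a - b) (a - b) = 0 := by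
    rw [map_sub (g u), sub_apply, hab, sub_self]
  exact h1.ne' h2

lemma area_ne_zero : A u ≠ 0 := by
  have hg := h.pos u hu (-(g u (e 0) (e 1)) • e 0 + g u (e 0) (e 0) • e 1) ?_
  · intro hA
    have ha := h.area u hu
    rw [hA] at ha
    rw [bilin_expand, h.symm u hu (e 1) (e 0)] at hg
    simp at hg ha
    have h2 : g u (e 0) (e 0) * (g u (e 0) (e 0) * g u (e 1) (e 1) - g u (e 0) (e 1) ^ 2) = 0 := by
      rw [← ha, mul_zero]
    linarith
  · have h0 := h.pos u hu (e 0) (by simp)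
    intro h1
    have h2 := congrArg (fun w : Plane => w 1) h1
    simp at h2
    exact h0.ne' h2

lemma fderiv_symm (a b c : Plane) : fderiv ℝ g u a b c = fderiv ℝ g u a c b := by
  have h1 := (((h.hasFDerivAt_g hu).clm_apply (hasFDerivAt_const b u)).clm_apply
    (hasFDerivAt_const c u))
  have h2 := (((h.hasFDerivAt_g hu).clm_apply (hasFDerivAt_const c u)).clm_apply
    (hasFDerivAt_const b u))
  have h3 : (fun u => g u b c) =ᶠ[𝓝 u] (fun u => g u c b) := by
    filter_upwards [h.mem_nhds hu] with y hy using h.symm y hy b c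
  have h4 := congrArg (fun L => L a) (h1.unique (h2.congr_of_eventuallyEq h3))
  simpa using h4

/-- The connection is symmetric, as a consequence of the Koszul formula. -/
lemma Γ_symm (a b : Plane) : Γ u a b = Γ u b a := by
  refine h.ext_of_g hu fun c => ?_
  have h1 := h.koszul u hu a b c
  have h2 := h.koszul u hu b a c
  have h3 := h.fderiv_symm hu c a b
  linarith

/-- The connection preserves the metric. -/
lemma fderiv_g (a b c : Plane) :
    fderiv ℝ g u a b c = g u (Γ u a b) c + g u b (Γ u a c) := by
  have h1 := h.koszul u hu a b c
  have h2 := h.koszul u hu a c b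
  have h3 := h.fderiv_symm hu a b c
  have h4 := h.symm u hu b (Γ u a c)
  linarith

/-- The connection preserves the area form. -/
lemma fderiv_A (a : Plane) :
    fderiv ℝ A u a = A u * (Γ u a (e 0) 0 + Γ u a (e 1) 1) := by
  have hA := (h.hasFDerivAt_A hu).pow 2
  have hij : ∀ i j, HasFDerivAt (fun u => g u (e i) (e j)) _ u := fun i j =>
    (((h.hasFDerivAt_g hu).clm_apply (hasFDerivAt_const (e i) u)).clm_apply
      (hasFDerivAt_const (e j) u))
  have hd := ((hij 0 0).mul (hij 1 1)).sub ((hij 0 1).pow 2)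
  have heq : (fun u => A u ^ 2) =ᶠ[𝓝 u]
      (fun u => g u (e 0) (e 0) * g u (e 1) (e 1) - g u (e 0) (e 1) ^ 2) := by
    filter_upwards [h.mem_nhds hu] with y hy using h.area y hy
  have h1 := congrArg (fun L => L a) (hA.unique (hd.congr_of_eventuallyEq heq))
  simp [h.fderiv_g hu] at h1
  have hA0 := h.area_ne_zero hu
  have h2 := h.area u hu
  rw [bilin_expand (g u) (Γ u a (e 0)) (e 0), bilin_expand (g u) (e 0) (Γ u a (e 0)),
    bilin_expand (g u) (Γ u a (e 1)) (e 1), bilin_expand (g u) (e 1) (Γ u a (e 1)),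
    bilin_expand (g u) (Γ u a (e 0)) (e 1), bilin_expand (g u) (e 0) (Γ u a (e 1)),
    h.symm u hu (e 1) (e 0)] at h1
  simp at h1
  have h3 : A u * (fderiv ℝ A u a) =
    A u * (A u * (Γ u a (e 0) 0 + Γ u a (e 1) 1)) := by
    rw [← mul_assoc, ← pow_two, h2]
    simp
    linarith
  simpa using mul_left_cancel₀ hA0 h3

/-- The curvature operators are skew-symmetric. -/
lemma curv_skew (a b c d : Plane) : g u (curv Γ u a b c) d = - g u c (curv Γ u a b d) := by
  have key : ∀ p q : Plane, fderiv ℝ (fderiv ℝ g) u p q c d =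
      g u (Γ u p (Γ u q c)) d + g u (Γ u q c) (Γ u p d) + g u (fderiv ℝ Γ u p q c) d
        + g u (Γ u p c) (Γ u q d) + g u c (Γ u p (Γ u q d)) + g u c (fderiv ℝ Γ u p q d) := by
    intro p q
    have h1 := (((h.hasFDerivAt_fderiv_g hu).clm_apply (hasFDerivAt_const q u)).clm_apply
      (hasFDerivAt_const c u)).clm_apply (hasFDerivAt_const d u)
    have hG : ∀ w : Plane, HasFDerivAt (fun u => Γ u q w) _ u := fun w =>
      (((h.hasFDerivAt_Γ hu).clm_apply (hasFDerivAt_const q u)).clm_apply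
      (hasFDerivAt_const w u))
    have h2 := ((((h.hasFDerivAt_g hu).clm_apply (hG c)).clm_apply
      (hasFDerivAt_const d u))).add (((h.hasFDerivAt_g hu).clm_apply
      (hasFDerivAt_const c u)).clm_apply (hG d))
    have heq : (fun u => fderiv ℝ g u q c d) =ᶠ[𝓝 u]
        (fun u => g u (Γ u q c) d + g u c (Γ u q d)) := by
      filter_upwards [h.mem_nhds hu] with y hy using h.fderiv_g hy q c d
    have h3 := congrArg (fun L => L p) (h1.unique (h2.congr_of_eventuallyEq heq))
    simp [h.fderiv_g hu] at h3
    linarith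
  have hs : fderiv ℝ (fderiv ℝ g) u a b = fderiv ℝ (fderiv ℝ g) u b a :=
    ((h.contDiffAt_g hu).isSymmSndFDerivAt (by simpa using two_le_smooth)) a b
  have h1 := key a b
  have h2 := key b a
  rw [hs] at h1
  simp only [curv, map_add, map_sub, add_apply,
    sub_apply]
  linarith

end Tensors

end IsLeviCivita
end PlaneMetric

/-! ### Covariant derivatives along maps into the plane -/

namespace PlaneMetric

lemma wedge_add_right (a b c : Plane) : wedge a (b + c) = wedge a b + wedge a c := by
  simp [wedge]; ring

lemma wedge_sub_right (a b c : Plane) : wedge a (b - c) = wedge a b - wedge a c := by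
  simp [wedge]; ring

lemma wedge_smul_right (r : ℝ) (a b : Plane) : wedge a (r • b) = r * wedge a b := by
  simp [wedge]; ring

/-- The covariant derivative, in the direction `d` of the parameter space, of the vector field `W`
along the parametrized map `x`. -/
noncomputable def cov {P : Type*} [NormedAddCommGroup P] [NormedSpace ℝ P]
    (Γ : Plane → Plane →L[ℝ] Plane →L[ℝ] Plane)
    (x W : P → Plane) (d z : P) : Plane :=
  fderiv ℝ W z d + Γ (x z) (fderiv ℝ x z d) (W z)

lemma hasFDerivAt_wedge {P : Type*} [NormedAddCommGroup P] [NormedSpace ℝ P]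
    {V W : P → Plane} {V' W' : P →L[ℝ] Plane} {z : P}
    (hV : HasFDerivAt V V' z) (hW : HasFDerivAt W W' z) :
    ∃ L : P →L[ℝ] ℝ, HasFDerivAt (fun z => wedge (V z) (W z)) L z ∧
      ∀ d, L d = wedge (V' d) (W z) + wedge (V z) (W' d) := by
  have hc : ∀ (f : P → Plane) (f' : P →L[ℝ] Plane), HasFDerivAt f f' z → ∀ i : Fin 2,
      HasFDerivAt (fun z => f z i) ((EuclideanSpace.proj i : Plane →L[ℝ] ℝ).comp f') z :=
    fun f f' hf i => (EuclideanSpace.proj i : Plane →L[ℝ] ℝ).hasFDerivAt.comp z hf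
  refine ⟨_, ((hc V V' hV 0).mul (hc W W' hW 1)).sub ((hc V V' hV 1).mul (hc W W' hW 0)), ?_⟩
  intro d
  simp [wedge]
  ring

namespace IsLeviCivita

variable {U : Set Plane} {g : Plane → Plane →L[ℝ] Plane →L[ℝ] ℝ}
  {Γ : Plane → Plane →L[ℝ] Plane →L[ℝ] Plane} {A : Plane → ℝ}
  {P : Type*} [NormedAddCommGroup P] [NormedSpace ℝ P] {x V W : P → Plane} {z : P}

section Algebra

variable (h : IsLeviCivita U g Γ A) {u : Plane} (hu : u ∈ U)
include h hu

/-- The area form and the inner product determine each other: `g(a, b) = ω(v, a) ω(v, b)` for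
`a ⟂ v` and a unit vector `v`. -/
lemma inner_eq_area {v a : Plane} (hv : g u v v = 1) (b : Plane) :
    g u a b = (A u * wedge v a) * (A u * wedge v b) + g u a v * g u b v := by
  have h1 : g u a b * g u v v = (A u * wedge v a) * (A u * wedge v b) + g u a v * g u b v := by
    have h2 := h.area u hu
    have h3 : (A u * wedge v a) * (A u * wedge v b) = A u ^ 2 * (wedge v a * wedge v b) := by ring
    rw [h3, h2, bilin_expand (g u) a b, bilin_expand (g u) v v, bilin_expand (g u) a v,
      bilin_expand (g u) b v, h.symm u hu (e 1) (e 0)]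
    simp only [wedge]
    ring
  rwa [hv, mul_one] at h1

/-- For a unit vector `v` and `a ⟂ v` one has `ω(a, b) = -ω(v, a) g(b, v)`. -/
lemma area_of_orthogonal {v a : Plane} (hv : g u v v = 1) (ha : g u a v = 0) (b : Plane) :
    A u * wedge a b = - (A u * wedge v a) * g u b v := by
  have h1 : wedge a b * g u v v = g u a v * wedge v b - wedge v a * g u b v := by
    rw [bilin_expand (g u) v v, bilin_expand (g u) a v,
      bilin_expand (g u) b v, h.symm u hu (e 1) (e 0)]
    simp only [wedge]
    ring
  rw [hv, ha] at h1
  linear_combination A u * h1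

/-- In dimension two the curvature depends on the first two arguments only through their wedge. -/
lemma curv_bilin (a b c : Plane) : curv Γ u a b c = wedge a b • curv Γ u (e 0) (e 1) c := by
  have key : curv Γ u (a 0 • e 0 + a 1 • e 1) (b 0 • e 0 + b 1 • e 1) c =
      wedge a b • curv Γ u (e 0) (e 1) c := by
    simp only [curv, wedge, map_add, map_smul, add_apply, smul_apply]
    module
  rwa [← eq_basis, ← eq_basis] at key

/-- The curvature of a surface acts on a unit vector as rotation: `ω(v, R(v, a)v) = -K ω(v, a)`. -/
lemma area_curv {v : Plane} (hv : g u v v = 1) (a : Plane) :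
    A u * wedge v (curv Γ u v a v) = - gauss g Γ u * (A u * wedge v a) := by
  set r := curv Γ u (e 0) (e 1) v with hr
  have hA := h.area_ne_zero hu
  have hrv : g u r v = 0 := by
    have h1 := h.curv_skew hu (e 0) (e 1) v v
    rw [h.symm u hu v] at h1
    rw [hr]; linarith
  have hB : ∀ c d, g u (curv Γ u (e 0) (e 1) c) d =
      - g u (e 0) (curv Γ u (e 0) (e 1) (e 1)) * wedge c d := by
    intro c d
    have hlin : curv Γ u (e 0) (e 1) c =
        c 0 • curv Γ u (e 0) (e 1) (e 0) + c 1 • curv Γ u (e 0) (e 1) (e 1) := by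
      conv_lhs => rw [eq_basis c]
      simp only [curv, map_add, map_smul]
      module
    have h00 := h.curv_skew hu (e 0) (e 1) (e 0) (e 0)
    have h11 := h.curv_skew hu (e 0) (e 1) (e 1) (e 1)
    have h01 := h.curv_skew hu (e 0) (e 1) (e 0) (e 1)
    have h10 := h.curv_skew hu (e 0) (e 1) (e 1) (e 0)
    rw [h.symm u hu (e 0)] at h00
    rw [h.symm u hu (e 1)] at h11
    have h00' : g u (curv Γ u (e 0) (e 1) (e 0)) (e 0) = 0 := by linarith
    have h11' : g u (curv Γ u (e 0) (e 1) (e 1)) (e 1) = 0 := by linarith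
    have h10' := h.symm u hu (e 0) (curv Γ u (e 0) (e 1) (e 1))
    have hd : ∀ w : Plane, g u w d = d 0 * g u w (e 0) + d 1 * g u w (e 1) := by
      intro w
      conv_lhs => rw [eq_basis d]
      simp only [map_add, map_smul, smul_eq_mul]
    rw [hlin, map_add, map_smul, map_smul, add_apply, smul_apply, smul_apply, hd, hd, h00', h11',
      h01, ← h10']
    simp only [wedge, smul_eq_mul]
    ring
  obtain ⟨d, hd⟩ : ∃ d : Plane, wedge v d ≠ 0 := by
    by_contra hcon
    push Not at hcon
    have h0 := hcon (e 0)
    have h1 := hcon (e 1)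
    simp [wedge] at h0 h1
    have hv0 : v = 0 := by rw [eq_basis v, h0, h1]; simp
    rw [hv0] at hv
    simp at hv
  have h1 := h.inner_eq_area hu hv (a := r) d
  rw [hrv, zero_mul, add_zero, hr, hB v d, ← hr] at h1
  have h2 : A u ^ 2 * wedge v r = - g u (e 0) (curv Γ u (e 0) (e 1) (e 1)) :=
    mul_right_cancel₀ hd (by linear_combination -h1)
  rw [h.curv_bilin hu v a, wedge_smul_right, gauss, ← h.area u hu, ← hr]
  field_simp
  linear_combination (wedge v a) * h2

end Algebra

section Along

variable (h : IsLeviCivita U g Γ A) (hz : x z ∈ U) (hx : DifferentiableAt ℝ x z)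
  (hV : DifferentiableAt ℝ V z) (hW : DifferentiableAt ℝ W z)

include h hz hx hV hW

/-- The product rule for the metric along a parametrized map. -/
lemma hasFDerivAt_inner_along : ∃ L : P →L[ℝ] ℝ,
    HasFDerivAt (fun z => g (x z) (V z) (W z)) L z ∧
    ∀ d, L d = g (x z) (cov Γ x V d z) (W z) + g (x z) (V z) (cov Γ x W d z) := by
  refine ⟨_, (((h.hasFDerivAt_g hz).comp z hx.hasFDerivAt).clm_apply hV.hasFDerivAt).clm_apply
    hW.hasFDerivAt, fun d => ?_⟩
  simp [h.fderiv_g hz, cov]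
  ring

/-- The product rule for the area form along a parametrized map. -/
lemma hasFDerivAt_area_along : ∃ L : P →L[ℝ] ℝ,
    HasFDerivAt (fun z => A (x z) * wedge (V z) (W z)) L z ∧
    ∀ d, L d = A (x z) * wedge (cov Γ x V d z) (W z)
      + A (x z) * wedge (V z) (cov Γ x W d z) := by
  obtain ⟨L, hL, hL'⟩ := hasFDerivAt_wedge hV.hasFDerivAt hW.hasFDerivAt
  refine ⟨_, ((h.hasFDerivAt_A hz).comp z hx.hasFDerivAt).mul hL, fun d => ?_⟩
  have hG : ∀ w : Plane, Γ (x z) (fderiv ℝ x z d) w =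
      w 0 • Γ (x z) (fderiv ℝ x z d) (e 0) + w 1 • Γ (x z) (fderiv ℝ x z d) (e 1) := by
    intro w
    conv_lhs => rw [eq_basis w]
    simp only [map_add, map_smul]
  simp [h.fderiv_A hz, cov, hL']
  rw [hG (V z), hG (W z)]
  simp [wedge]
  ring

end Along

section SecondOrder

variable (h : IsLeviCivita U g Γ A) (hz : x z ∈ U) (hx : ContDiffAt ℝ ∞ x z)
  (hW : ContDiffAt ℝ ∞ W z)

include h hz hx

lemma contDiffAt_cov (hW : ContDiffAt ℝ ∞ W z) (d : P) : ContDiffAt ℝ ∞ (cov Γ x W d) z := by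
  have h1 : ContDiffAt ℝ ∞ (fun z => fderiv ℝ W z d) z :=
    (hW.fderiv_right (m := ∞) (by simp)).clm_apply contDiffAt_const
  have h2 : ContDiffAt ℝ ∞ (fun z => fderiv ℝ x z d) z :=
    (hx.fderiv_right (m := ∞) (by simp)).clm_apply contDiffAt_const
  exact h1.add ((((h.contDiffAt_Γ hz).comp z hx).clm_apply h2).clm_apply hW)

/-- The connection is torsion-free: mixed covariant derivatives of a parametrized map commute. -/
lemma cov_fderiv_comm (d d' : P) :
    cov Γ x (fun z => fderiv ℝ x z d') d z = cov Γ x (fun z => fderiv ℝ x z d) d' z := by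
  have hs : fderiv ℝ (fderiv ℝ x) z d d' = fderiv ℝ (fderiv ℝ x) z d' d :=
    (hx.isSymmSndFDerivAt (by simpa using two_le_smooth)) d d'
  have hd : HasFDerivAt (fderiv ℝ x) (fderiv ℝ (fderiv ℝ x) z) z :=
    ((hx.fderiv_right (m := ∞) (by simp)).differentiableAt (by simp)).hasFDerivAt
  have h1 := fun c : P => (hd.clm_apply (hasFDerivAt_const c z)).fderiv
  simp only [cov, h1]
  simp [hs, h.Γ_symm hz (fderiv ℝ x z d)]

/-- The commutator of covariant derivatives is the curvature. -/
lemma cov_cov_sub (hW : ContDiffAt ℝ ∞ W z) (d d' : P) :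
    cov Γ x (cov Γ x W d') d z - cov Γ x (cov Γ x W d) d' z =
      curv Γ (x z) (fderiv ℝ x z d) (fderiv ℝ x z d') (W z) := by
  have hs : fderiv ℝ (fderiv ℝ x) z d d' = fderiv ℝ (fderiv ℝ x) z d' d :=
    (hx.isSymmSndFDerivAt (by simpa using two_le_smooth)) d d'
  have hsW : fderiv ℝ (fderiv ℝ W) z d d' = fderiv ℝ (fderiv ℝ W) z d' d :=
    (hW.isSymmSndFDerivAt (by simpa using two_le_smooth)) d d'
  have hd : HasFDerivAt (fderiv ℝ x) (fderiv ℝ (fderiv ℝ x) z) z :=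
    ((hx.fderiv_right (m := ∞) (by simp)).differentiableAt (by simp)).hasFDerivAt
  have hdW : HasFDerivAt (fderiv ℝ W) (fderiv ℝ (fderiv ℝ W) z) z :=
    ((hW.fderiv_right (m := ∞) (by simp)).differentiableAt (by simp)).hasFDerivAt
  have hxd := (hx.differentiableAt (by simp)).hasFDerivAt
  have hWd := (hW.differentiableAt (by simp)).hasFDerivAt
  have h1 := fun c : P => ((hdW.clm_apply (hasFDerivAt_const c z)).add
    ((((h.hasFDerivAt_Γ hz).comp z hxd).clm_apply
      (hd.clm_apply (hasFDerivAt_const c z))).clm_apply hWd))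
  have h2 : ∀ c : P, fderiv ℝ (cov Γ x W c) z = _ := fun c => (h1 c).fderiv
  simp only [cov] at h2 ⊢
  rw [h2, h2]
  simp [hs, hsW, curv]
  abel

end SecondOrder

end IsLeviCivita
end PlaneMetric

/-! ### Families of curves of prescribed geodesic curvature, and isometries -/

namespace PlaneMetric
namespace IsLeviCivita

variable {U : Set Plane} {g : Plane → Plane →L[ℝ] Plane →L[ℝ] ℝ}
  {Γ : Plane → Plane →L[ℝ] Plane →L[ℝ] Plane} {A : Plane → ℝ}
  {P : Type*} [NormedAddCommGroup P] [NormedSpace ℝ P]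

/-- The structure equations along a family of curves of prescribed geodesic curvature `L`: if `v` is
a unit field along `x` which is the velocity in the direction `d`, and `ω(v, D_d v) = L`, then the
components `ω₁, ω₂, ψ` of the variation in the direction `d'` satisfy the Jacobi equations. -/
lemma jacobi (h : IsLeviCivita U g Γ A) {x v : P → Plane} {L : P → ℝ} {z d : P} (hz : x z ∈ U)
    (hx : ContDiffAt ℝ ∞ x z) (hv : ContDiffAt ℝ ∞ v z)
    (hvel : ∀ᶠ y in 𝓝 z, fderiv ℝ x y d = v y)
    (hunit : ∀ᶠ y in 𝓝 z, g (x y) (v y) (v y) = 1)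
    (hL : ∀ᶠ y in 𝓝 z, A (x y) * wedge (v y) (cov Γ x v d y) = L y) (d' : P) :
    (∃ L₁ : P →L[ℝ] ℝ, HasFDerivAt (fun y => g (x y) (fderiv ℝ x y d') (v y)) L₁ z ∧
      L₁ d = L z * (A (x z) * wedge (v z) (fderiv ℝ x z d'))) ∧
    (∃ L₂ : P →L[ℝ] ℝ, HasFDerivAt (fun y => A (x y) * wedge (v y) (fderiv ℝ x y d')) L₂ z ∧
      L₂ d = A (x z) * wedge (v z) (cov Γ x v d' z)
        - L z * g (x z) (fderiv ℝ x z d') (v z)) ∧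
    (∃ L₃ : P →L[ℝ] ℝ, HasFDerivAt (fun y => A (x y) * wedge (v y) (cov Γ x v d' y)) L₃ z ∧
      L₃ d = fderiv ℝ L z d'
        - gauss g Γ (x z) * (A (x z) * wedge (v z) (fderiv ℝ x z d'))) := by
  have hxd := hx.differentiableAt (by simp)
  have hvd := hv.differentiableAt (by simp)
  have hxs : DifferentiableAt ℝ (fun y => fderiv ℝ x y d') z :=
    ((hx.fderiv_right (m := ∞) (by simp)).clm_apply contDiffAt_const).differentiableAt (by simp)
  have hcd : ∀ c, DifferentiableAt ℝ (cov Γ x v c) z := fun c =>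
    (h.contDiffAt_cov hz hx hv c).differentiableAt (by simp)
  have hu1 : g (x z) (v z) (v z) = 1 := hunit.self_of_nhds
  have horth : ∀ c, g (x z) (cov Γ x v c z) (v z) = 0 := by
    intro c
    obtain ⟨M, hM, hM'⟩ := h.hasFDerivAt_inner_along hz hxd hvd hvd
    have h0 : HasFDerivAt (fun y => g (x y) (v y) (v y)) (0 : P →L[ℝ] ℝ) z :=
      (hasFDerivAt_const (1 : ℝ) z).congr_of_eventuallyEq hunit
    have h1 := hM' c
    rw [hM.unique h0, h.symm _ hz (v z)] at h1
    have h2 : g (x z) (cov Γ x v c z) (v z) + g (x z) (cov Γ x v c z) (v z) = 0 := h1.symm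
    linarith
  have hL1 : A (x z) * wedge (v z) (cov Γ x v d z) = L z := hL.self_of_nhds
  have hcomm : cov Γ x (fun y => fderiv ℝ x y d') d z = cov Γ x v d' z := by
    rw [h.cov_fderiv_comm hz hx d d']
    have he : (fun y => fderiv ℝ x y d) =ᶠ[𝓝 z] v := hvel
    simp only [cov]
    rw [he.fderiv_eq, hvel.self_of_nhds]
  refine ⟨?_, ?_, ?_⟩
  · obtain ⟨M, hM, hM'⟩ := h.hasFDerivAt_inner_along hz hxd hxs hvd
    refine ⟨M, hM, ?_⟩
    rw [hM', hcomm, horth, h.symm _ hz (fderiv ℝ x z d'), h.inner_eq_area hz hu1, horth, hL1]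
    ring
  · obtain ⟨M, hM, hM'⟩ := h.hasFDerivAt_area_along hz hxd hvd hxs
    refine ⟨M, hM, ?_⟩
    rw [hM', hcomm, h.area_of_orthogonal hz hu1 (horth d), hL1]
    ring
  · obtain ⟨M, hM, hM'⟩ := h.hasFDerivAt_area_along hz hxd hvd (hcd d')
    refine ⟨M, hM, ?_⟩
    obtain ⟨N, hN, hN'⟩ := h.hasFDerivAt_area_along hz hxd hvd (hcd d)
    have hLd : fderiv ℝ L z = N := (hN.congr_of_eventuallyEq (EventuallyEq.symm hL)).fderiv
    have hc := h.cov_cov_sub hz hx hv d d'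
    rw [hvel.self_of_nhds] at hc
    have hK := h.area_curv hz hu1 (fderiv ℝ x z d')
    rw [hM', hLd, hN', h.area_of_orthogonal hz hu1 (horth d), horth,
      h.area_of_orthogonal hz hu1 (horth d'), horth]
    rw [← hc, wedge_sub_right] at hK
    linarith

/-- The transformation law of the Christoffel symbols under an isometry. -/
lemma map_Γ {U' : Set Plane} {g' : Plane → Plane →L[ℝ] Plane →L[ℝ] ℝ}
    {Γ' : Plane → Plane →L[ℝ] Plane →L[ℝ] Plane} {A' : Plane → ℝ}
    (h : IsLeviCivita U g Γ A) (h' : IsLeviCivita U' g' Γ' A') {τ : Plane → Plane} {u : Plane}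
    (hu : u ∈ U) (hu' : τ u ∈ U') (hτ : ContDiffAt ℝ ∞ τ u)
    (hiso : ∀ᶠ y in 𝓝 u, ∀ a b, g y a b = g' (τ y) (fderiv ℝ τ y a) (fderiv ℝ τ y b))
    (a b : Plane) :
    fderiv ℝ τ u (Γ u a b) =
      fderiv ℝ (fderiv ℝ τ) u a b + Γ' (τ u) (fderiv ℝ τ u a) (fderiv ℝ τ u b) := by
  have hs : ∀ p q, fderiv ℝ (fderiv ℝ τ) u p q = fderiv ℝ (fderiv ℝ τ) u q p := fun p q =>
    (hτ.isSymmSndFDerivAt (by simpa using two_le_smooth)) p q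
  have hd : HasFDerivAt (fderiv ℝ τ) (fderiv ℝ (fderiv ℝ τ) u) u :=
    ((hτ.fderiv_right (m := ∞) (by simp)).differentiableAt (by simp)).hasFDerivAt
  have hτd := (hτ.differentiableAt (by simp)).hasFDerivAt
  have hiso0 : ∀ a b, g u a b = g' (τ u) (fderiv ℝ τ u a) (fderiv ℝ τ u b) := hiso.self_of_nhds
  have hDg : ∀ p q r, fderiv ℝ g u p q r =
      fderiv ℝ g' (τ u) (fderiv ℝ τ u p) (fderiv ℝ τ u q) (fderiv ℝ τ u r)
      + g' (τ u) (fderiv ℝ (fderiv ℝ τ) u p q) (fderiv ℝ τ u r)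
      + g' (τ u) (fderiv ℝ τ u q) (fderiv ℝ (fderiv ℝ τ) u p r) := by
    intro p q r
    have h1 := ((h.hasFDerivAt_g hu).clm_apply (hasFDerivAt_const q u)).clm_apply
      (hasFDerivAt_const r u)
    have h2 := (((h'.hasFDerivAt_g hu').comp u hτd).clm_apply
      (hd.clm_apply (hasFDerivAt_const q u))).clm_apply (hd.clm_apply (hasFDerivAt_const r u))
    have heq : (fun y => g y q r) =ᶠ[𝓝 u]
        (fun y => g' (τ y) (fderiv ℝ τ y q) (fderiv ℝ τ y r)) := by
      filter_upwards [hiso] with y hy using hy q r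
    have h3 := congrArg (fun M => M p) (h1.unique (h2.congr_of_eventuallyEq heq))
    simp at h3
    linarith
  have hinj : Function.Injective (fderiv ℝ τ u) := by
    rw [injective_iff_map_eq_zero]
    intro p hp
    by_contra hne
    have h1 := h.pos u hu p hne
    rw [hiso0, hp] at h1
    simp at h1
  have hsurj : Function.Surjective (fderiv ℝ τ u) :=
    LinearMap.surjective_of_injective (f := (fderiv ℝ τ u).toLinearMap) hinj
  refine h'.ext_of_g hu' fun c' => ?_
  obtain ⟨c, rfl⟩ := hsurj c'
  rw [← hiso0, map_add, add_apply]
  have h1 := h.koszul u hu a b c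
  have h2 := h'.koszul _ hu' (fderiv ℝ τ u a) (fderiv ℝ τ u b) (fderiv ℝ τ u c)
  rw [hDg, hDg, hDg, hs b a, hs c a, hs c b] at h1
  have h3 := h'.symm _ hu' (fderiv ℝ τ u b) (fderiv ℝ (fderiv ℝ τ) u a c)
  have h4 := h'.symm _ hu' (fderiv ℝ τ u a) (fderiv ℝ (fderiv ℝ τ) u b c)
  linarith

end IsLeviCivita
end PlaneMetric

/-! ### The metric of a surface in a chart -/

namespace SurfaceChart
open PlaneMetric

variable {M : Type*} [TopologicalSpace M] [ChartedSpace Plane M] [IsManifold (𝓡 2) ∞ M]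

/-- The tangent vector at `y` with coordinates `w` in the preferred chart at `x`. -/
noncomputable def vecOf (x y : M) (w : Plane) : TangentSpace (𝓡 2) y :=
  (trivializationAt Plane (TangentSpace (𝓡 2)) x).symmL ℝ y w

/-- The coordinates, in the preferred chart at `x`, of a tangent vector at `y`. -/
noncomputable def coordOf (x y : M) (V : TangentSpace (𝓡 2) y) : Plane :=
  (trivializationAt Plane (TangentSpace (𝓡 2)) x ⟨y, V⟩).2

lemma mem_baseSet {x y : M} (hy : y ∈ (chartAt Plane x).source) :
    y ∈ (trivializationAt Plane (TangentSpace (𝓡 2)) x).baseSet := by simpa using hy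

lemma coordOf_vecOf {x y : M} (hy : y ∈ (chartAt Plane x).source) (w : Plane) :
    coordOf x y (vecOf x y w) = w := by
  have h := (trivializationAt Plane (TangentSpace (𝓡 2)) x).continuousLinearMapAt_symmL (R := ℝ)
    (mem_baseSet hy) w
  rwa [Trivialization.continuousLinearMapAt_apply, Trivialization.linearMapAt_def_of_mem _
    (mem_baseSet hy)] at h

lemma vecOf_coordOf {x y : M} (hy : y ∈ (chartAt Plane x).source) (V : TangentSpace (𝓡 2) y) :
    vecOf x y (coordOf x y V) = V := by
  have h := (trivializationAt Plane (TangentSpace (𝓡 2)) x).symmL_continuousLinearMapAt (R := ℝ)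
    (mem_baseSet hy) V
  rwa [Trivialization.continuousLinearMapAt_apply, Trivialization.linearMapAt_def_of_mem _
    (mem_baseSet hy)] at h

lemma coordVec_eq (x y : M) (i : Fin 2) : coordVec x y i = vecOf x y (e i) := rfl

lemma vecOf_add (x y : M) (a b : Plane) : vecOf x y (a + b) = vecOf x y a + vecOf x y b :=
  map_add _ _ _

lemma vecOf_smul (x y : M) (r : ℝ) (a : Plane) : vecOf x y (r • a) = r • vecOf x y a :=
  map_smul _ _ _

/-- At the centre of its preferred chart a tangent vector is, by definition of the tangent bundle,
equal to its coordinate vector. -/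
lemma coordOf_self (x : M) (V : TangentSpace (𝓡 2) x) : coordOf x x V = V :=
  tangentCoordChange_self (by simp)

lemma vecOf_self (x : M) (w : Plane) : vecOf x x w = w := by
  have h := vecOf_coordOf (mem_chart_source Plane x) (w : TangentSpace (𝓡 2) x)
  exact (congrArg (vecOf x x) (coordOf_self x w)).symm.trans h

/-- Coordinates of tangent vectors change by the derivative of the change of charts. -/
lemma coordOf_eq_fderiv {x x' y : M} (hy : y ∈ (chartAt Plane x).source)
    (hy' : y ∈ (chartAt Plane x').source) (V : TangentSpace (𝓡 2) y) :
    coordOf x' y V = fderiv ℝ (chartAt Plane x' ∘ (chartAt Plane x).symm) (chartAt Plane x y)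
      (coordOf x y V) := by
  have h2 : tangentCoordChange (𝓡 2) x x' y (coordOf x y V) = coordOf x' y V :=
    tangentCoordChange_comp (by simp [hy, hy'])
  rw [← h2, tangentCoordChange_def]
  simp

/-- The charts of `TM` in terms of base coordinates and vector coordinates. -/
lemma chart_symm_tangent (p : TangentBundle (𝓡 2) M) {u : Plane} (w : Plane)
    (hu : u ∈ (chartAt Plane p.1).target) :
    (chartAt (ModelProd Plane Plane) p).symm (u, w) =
      ⟨(chartAt Plane p.1).symm u, vecOf p.1 ((chartAt Plane p.1).symm u) w⟩ := by
  have h := ((trivializationAt Plane (TangentSpace (𝓡 2)) p.1).mk_symm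
    (b := (chartAt Plane p.1).symm u) (mem_baseSet ((chartAt Plane p.1).map_target hu)) w)
  unfold vecOf
  rw [Trivialization.symmL_apply, h, TangentBundle.chartAt]
  · rfl
  · exact mem_baseSet ((chartAt Plane p.1).map_target hu)

variable [RiemannianBundle (fun x : M => TangentSpace (𝓡 2) x)]

/-- The metric in the preferred chart at `x`, as a bilinear form. -/
noncomputable def metricForm (x : M) (u : Plane) : Plane →L[ℝ] Plane →L[ℝ] ℝ :=
  ∑ i, ∑ j, gram x u i j • (EuclideanSpace.proj i : Plane →L[ℝ] ℝ).smulRight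
    (EuclideanSpace.proj j : Plane →L[ℝ] ℝ)

/-- The Christoffel symbols in the preferred chart at `x`, as a bilinear map. -/
noncomputable def christoffelForm (x : M) (u : Plane) : Plane →L[ℝ] Plane →L[ℝ] Plane :=
  ∑ k, ∑ i, ∑ j, christoffel x k i j u • (EuclideanSpace.proj i : Plane →L[ℝ] ℝ).smulRight
    ((EuclideanSpace.proj j : Plane →L[ℝ] ℝ).smulRight (e k))

lemma metricForm_apply' (x : M) (u a b : Plane) :
    metricForm x u a b = ∑ i, ∑ j, gram x u i j * a i * b j := by
  simp [metricForm, mul_assoc]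

lemma metricForm_apply (x : M) (u a b : Plane) :
    metricForm x u a b = inner ℝ (vecOf x ((chartAt Plane x).symm u) a)
      (vecOf x ((chartAt Plane x).symm u) b) := by
  rw [metricForm_apply']
  conv_rhs => rw [eq_basis a, eq_basis b]
  simp only [vecOf_add, vecOf_smul, inner_add_left, inner_add_right, inner_smul_left,
    inner_smul_right, Fin.sum_univ_two, gram, coordVec_eq, Matrix.of_apply, RCLike.conj_to_real]
  ring

lemma metricForm_basis (x : M) (u : Plane) (i j : Fin 2) :
    metricForm x u (e i) (e j) = gram x u i j := by
  rw [metricForm_apply]; rfl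

lemma christoffelForm_apply (x : M) (u a b : Plane) (k : Fin 2) :
    christoffelForm x u a b k = ∑ i, ∑ j, christoffel x k i j u * a i * b j := by
  fin_cases k <;> simp [christoffelForm, Fin.sum_univ_two] <;> ring

lemma christoffelForm_basis (x : M) (u : Plane) (i j k : Fin 2) :
    christoffelForm x u (e i) (e j) k = christoffel x k i j u := by
  rw [christoffelForm_apply]
  fin_cases i <;> fin_cases j <;> simp

lemma gram_symm (x : M) (u : Plane) (i j : Fin 2) : gram x u i j = gram x u j i := by
  simp only [gram, Matrix.of_apply]; exact real_inner_comm _ _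

lemma metricForm_symm (x : M) (u a b : Plane) : metricForm x u a b = metricForm x u b a := by
  simp only [metricForm_apply]; exact real_inner_comm _ _

lemma metricForm_pos (x : M) {u : Plane} (hu : u ∈ (chartAt Plane x).target) {a : Plane}
    (ha : a ≠ 0) : 0 < metricForm x u a a := by
  rw [metricForm_apply]
  refine real_inner_self_pos.2 fun h0 => ha ?_
  have h1 := coordOf_vecOf ((chartAt Plane x).map_target hu) a
  have h2 := coordOf_vecOf ((chartAt Plane x).map_target hu) (0 : Plane)
  have h3 : vecOf x ((chartAt Plane x).symm u) (0 : Plane) = 0 := map_zero _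
  rw [← h1, h0, ← h3, h2]

lemma det_gram (x : M) (u : Plane) :
    (gram x u).det = gram x u 0 0 * gram x u 1 1 - gram x u 0 1 ^ 2 := by
  rw [Matrix.det_fin_two, gram_symm x u 1 0]; ring

lemma det_gram_pos (x : M) {u : Plane} (hu : u ∈ (chartAt Plane x).target) :
    0 < (gram x u).det := by
  have h0 := metricForm_pos x hu (a := e 0) (by simp)
  have h1 := metricForm_pos x hu (a := -(gram x u 0 1) • e 0 + gram x u 0 0 • e 1) ?_
  · rw [metricForm_basis] at h0
    simp only [map_add, map_smul, add_apply, smul_apply, metricForm_basis, smul_eq_mul] at h1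
    rw [gram_symm x u 1 0] at h1
    rw [det_gram]
    refine pos_of_mul_pos_right (a := gram x u 0 0) ?_ h0.le
    linarith
  · intro h2
    have h3 := congrArg (fun w : Plane => w 1) h2
    simp at h3
    rw [metricForm_basis] at h0
    exact h0.ne' h3

variable [IsContMDiffRiemannianBundle (𝓡 2) ∞ Plane (fun x : M => TangentSpace (𝓡 2) x)]

lemma contDiffOn_gram (x : M) (i j : Fin 2) :
    ContDiffOn ℝ ∞ (fun u => gram x u i j) (chartAt Plane x).target := by
  have hM : IsManifold ((𝓡 2).prod 𝓘(ℝ, Plane)) ∞ (TangentBundle (𝓡 2) M) :=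
    Bundle.TotalSpace.isManifold Plane (TangentSpace (𝓡 2))
  have hsec : ∀ w : Plane, ContMDiffOn (𝓡 2) ((𝓡 2).prod 𝓘(ℝ, Plane)) ∞
      (fun u => (⟨(chartAt Plane x).symm u, vecOf x ((chartAt Plane x).symm u) w⟩ :
        TangentBundle (𝓡 2) M)) (chartAt Plane x).target := by
    intro w
    have h1 : ContMDiffOn 𝓘(ℝ, Plane × Plane) ((𝓡 2).prod 𝓘(ℝ, Plane)) ∞
        (extChartAt ((𝓡 2).prod 𝓘(ℝ, Plane)) (⟨x, 0⟩ : TangentBundle (𝓡 2) M)).symm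
        (extChartAt ((𝓡 2).prod 𝓘(ℝ, Plane)) (⟨x, 0⟩ : TangentBundle (𝓡 2) M)).target :=
      contMDiffOn_extChartAt_symm _
    have h2 : ContMDiff (𝓡 2) 𝓘(ℝ, Plane × Plane) ∞ (fun u : Plane => (u, w)) :=
      (contDiff_id.prodMk contDiff_const).contMDiff
    refine (h1.comp h2.contMDiffOn (s := (chartAt Plane x).target) ?_).congr ?_
    · intro u hu
      rw [mem_preimage, extChartAt_target]
      exact ⟨(TangentBundle.mem_chart_target_iff (I := 𝓡 2) _ _).2 hu, by
        rw [ModelWithCorners.Boundaryless.range_eq_univ]; trivial⟩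
    · intro u hu
      exact (chart_symm_tangent (⟨x, 0⟩ : TangentBundle (𝓡 2) M) w hu).symm
  intro u hu
  have hn := (chartAt Plane x).open_target.mem_nhds hu
  exact (ContMDiffAt.inner_bundle ((hsec (e i)).contMDiffAt hn)
    ((hsec (e j)).contMDiffAt hn)).contDiffAt.contDiffWithinAt

lemma contDiffOn_metricForm (x : M) :
    ContDiffOn ℝ ∞ (metricForm x) (chartAt Plane x).target := by
  refine ContDiffOn.sum fun i _ => ContDiffOn.sum fun j _ => ?_
  exact (contDiffOn_gram x i j).smul contDiffOn_const

lemma contDiffOn_partialD {f : Plane → ℝ} {U : Set Plane} (hU : IsOpen U)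
    (hf : ContDiffOn ℝ ∞ f U) (i : Fin 2) : ContDiffOn ℝ ∞ (partialD i f) U :=
  (hf.fderiv_of_isOpen hU (m := ∞) (by simp)).clm_apply contDiffOn_const

lemma contDiffOn_gram_inv (x : M) (i j : Fin 2) :
    ContDiffOn ℝ ∞ (fun u => (gram x u)⁻¹ i j) (chartAt Plane x).target := by
  have hdet : ContDiffOn ℝ ∞ (fun u => (gram x u).det) (chartAt Plane x).target := by
    simp only [Matrix.det_fin_two]
    exact ((contDiffOn_gram x 0 0).mul (contDiffOn_gram x 1 1)).sub
      ((contDiffOn_gram x 0 1).mul (contDiffOn_gram x 1 0))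
  have hinv := hdet.inv fun u hu => (det_gram_pos x hu).ne'
  have h : ∀ i j, ContDiffOn ℝ ∞ (fun u => (gram x u).adjugate i j) (chartAt Plane x).target := by
    intro i j
    simp only [Matrix.adjugate_fin_two]
    fin_cases i <;> fin_cases j
    · exact contDiffOn_gram x 1 1
    · exact (contDiffOn_gram x 0 1).neg
    · exact (contDiffOn_gram x 1 0).neg
    · exact contDiffOn_gram x 0 0
  simp only [Matrix.inv_def, Ring.inverse_eq_inv', Matrix.smul_apply, smul_eq_mul]
  exact hinv.mul (h i j)

lemma contDiffOn_christoffel (x : M) (k i j : Fin 2) :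
    ContDiffOn ℝ ∞ (christoffel x k i j) (chartAt Plane x).target := by
  have ho := (chartAt Plane x).open_target
  refine contDiffOn_const.mul (ContDiffOn.sum fun l _ => (contDiffOn_gram_inv x k l).mul ?_)
  exact ((contDiffOn_partialD ho (contDiffOn_gram x j l) i).add
    (contDiffOn_partialD ho (contDiffOn_gram x i l) j)).sub
    (contDiffOn_partialD ho (contDiffOn_gram x i j) l)

lemma contDiffOn_christoffelForm (x : M) :
    ContDiffOn ℝ ∞ (christoffelForm x) (chartAt Plane x).target :=
  ContDiffOn.sum fun k _ => ContDiffOn.sum fun i _ => ContDiffOn.sum fun j _ =>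
    (contDiffOn_christoffel x k i j).smul contDiffOn_const

lemma fderiv_metricForm_basis (x : M) {u : Plane} (hu : u ∈ (chartAt Plane x).target)
    (k i j : Fin 2) :
    fderiv ℝ (metricForm x) u (e k) (e i) (e j) = partialD k (fun u' => gram x u' i j) u := by
  have hd := (((contDiffOn_metricForm x).contDiffAt
    ((chartAt Plane x).open_target.mem_nhds hu)).differentiableAt (by simp)).hasFDerivAt
  have h1 := ((hd.clm_apply (hasFDerivAt_const (e i) u)).clm_apply
    (hasFDerivAt_const (e j) u)).fderiv
  simp only [metricForm_basis] at h1
  simp [partialD, h1]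

lemma fderiv_christoffelForm_basis (x : M) {u : Plane} (hu : u ∈ (chartAt Plane x).target)
    (k l i j : Fin 2) :
    fderiv ℝ (christoffelForm x) u (e k) (e i) (e j) l = partialD k (christoffel x l i j) u := by
  have hd := (((contDiffOn_christoffelForm x).contDiffAt
    ((chartAt Plane x).open_target.mem_nhds hu)).differentiableAt (by simp)).hasFDerivAt
  have h1 := ((EuclideanSpace.proj l : Plane →L[ℝ] ℝ).hasFDerivAt.comp u
    ((hd.clm_apply (hasFDerivAt_const (e i) u)).clm_apply (hasFDerivAt_const (e j) u))).fderiv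
  have h2 : (fun u => christoffelForm x u (e i) (e j) l) = christoffel x l i j := by
    ext u; exact christoffelForm_basis x u i j l
  change fderiv ℝ (fun u => christoffelForm x u (e i) (e j) l) u = _ at h1
  rw [h2] at h1
  simp [partialD, h1]

lemma apply_eq_one_mul_add (r : Fin 2 → ℝ) : ∀ m, r m =
    (1 : Matrix (Fin 2) (Fin 2) ℝ) m 0 * r 0 + (1 : Matrix (Fin 2) (Fin 2) ℝ) m 1 * r 1 :=
  Fin.forall_fin_two.2 ⟨by simp, by simp⟩

lemma koszul_basis (x : M) {u : Plane} (hu : u ∈ (chartAt Plane x).target) (i j m : Fin 2) :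
    2 * metricForm x u (christoffelForm x u (e i) (e j)) (e m) =
      partialD i (fun u' => gram x u' j m) u + partialD j (fun u' => gram x u' i m) u
        - partialD m (fun u' => gram x u' i j) u := by
  have hinv := Matrix.mul_nonsing_inv (gram x u) (det_gram_pos x hu).ne'.isUnit
  have hm : ∀ l, gram x u m 0 * (gram x u)⁻¹ 0 l + gram x u m 1 * (gram x u)⁻¹ 1 l =
      (1 : Matrix (Fin 2) (Fin 2) ℝ) m l := by
    intro l
    rw [← hinv, Matrix.mul_apply, Fin.sum_univ_two]
  rw [eq_basis (christoffelForm x u (e i) (e j))]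
  simp only [map_add, map_smul, add_apply, smul_apply, metricForm_basis, christoffelForm_basis,
    smul_eq_mul, christoffel, Fin.sum_univ_two, gram_symm x u _ m]
  have h0 := hm 0
  have h1 := hm 1
  set p := fun l : Fin 2 => partialD i (fun u' => gram x u' j l) u
    + partialD j (fun u' => gram x u' i l) u - partialD l (fun u' => gram x u' i j) u with hp
  have hpm : p m = (1 : Matrix (Fin 2) (Fin 2) ℝ) m 0 * p 0
      + (1 : Matrix (Fin 2) (Fin 2) ℝ) m 1 * p 1 := by
    exact apply_eq_one_mul_add p m
  change _ = p m
  rw [hpm]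
  simp only [hp]
  linear_combination (p 0) * h0 + (p 1) * h1

/-- The Christoffel symbols satisfy the Koszul formula, which characterizes them. -/
lemma koszul_metricForm (x : M) {u : Plane} (hu : u ∈ (chartAt Plane x).target) (a b c : Plane) :
    2 * metricForm x u (christoffelForm x u a b) c =
      fderiv ℝ (metricForm x) u a b c + fderiv ℝ (metricForm x) u b a c
        - fderiv ℝ (metricForm x) u c a b := by
  have key : ∀ i j m, 2 * metricForm x u (christoffelForm x u (e i) (e j)) (e m) =
      fderiv ℝ (metricForm x) u (e i) (e j) (e m) + fderiv ℝ (metricForm x) u (e j) (e i) (e m)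
        - fderiv ℝ (metricForm x) u (e m) (e i) (e j) := by
    intro i j m
    simp only [fderiv_metricForm_basis x hu, koszul_basis x hu]
  rw [eq_basis a, eq_basis b, eq_basis c]
  simp only [map_add, map_smul, add_apply, smul_apply, smul_eq_mul]
  linear_combination a 0 * b 0 * c 0 * key 0 0 0 + a 0 * b 0 * c 1 * key 0 0 1
    + a 0 * b 1 * c 0 * key 0 1 0 + a 0 * b 1 * c 1 * key 0 1 1
    + a 1 * b 0 * c 0 * key 1 0 0 + a 1 * b 0 * c 1 * key 1 0 1
    + a 1 * b 1 * c 0 * key 1 1 0 + a 1 * b 1 * c 1 * key 1 1 1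

/-- The Gauss curvature at `x` is the coordinate expression in the preferred chart at `x`. -/
lemma gaussCurvature_eq (x : M) :
    gaussCurvature x = gauss (metricForm x) (christoffelForm x) (chartAt Plane x x) := by
  have hu : chartAt Plane x x ∈ (chartAt Plane x).target := mem_chart_target Plane x
  have hc : ∀ l, curv (christoffelForm x) (chartAt Plane x x) (e 0) (e 1) (e 1) l =
      curvatureCoeff x l 0 1 1 (chartAt Plane x x) := by
    intro l
    simp only [curv, PiLp.add_apply, PiLp.sub_apply, fderiv_christoffelForm_basis x hu]
    rw [eq_basis (christoffelForm x _ (e 1) (e 1)), eq_basis (christoffelForm x _ (e 0) (e 1))]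
    simp only [map_add, map_smul, PiLp.add_apply, PiLp.smul_apply, christoffelForm_basis,
      curvatureCoeff, Fin.sum_univ_two, smul_eq_mul]
    ring
  rw [gauss, gaussCurvature, det_gram]
  simp only [metricForm_basis]
  congr 1
  rw [eq_basis (curv _ _ _ _ _)]
  simp only [map_add, map_smul, metricForm_basis, hc, Fin.sum_univ_two, smul_eq_mul]
  ring

end SurfaceChart

/-! ### The area form of an oriented surface in a chart -/

namespace SurfaceChart
open PlaneMetric

variable {M : Type*} [TopologicalSpace M] [ChartedSpace Plane M] [IsManifold (𝓡 2) ∞ M]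

/-- An open neighbourhood of `x` in its preferred chart on which the orientation is constant in
that chart. -/
def orientDomain (o : SurfaceOrientation M) (x : M) : Set M :=
  interior {y : M | ∃ L : TangentSpace (𝓡 2) y ≃ₗ[ℝ] TangentSpace (𝓡 2) x,
      (∀ v : TangentSpace (𝓡 2) y, L v = tangentCoordChange (𝓡 2) y x y v) ∧
        Orientation.map (Fin 2) L (o.orient y) = o.orient x} ∩ (chartAt Plane x).source

/-- The coordinate image of `orientDomain o x`. -/
def coordDomain (o : SurfaceOrientation M) (x : M) : Set Plane :=
  (chartAt Plane x).target ∩ (chartAt Plane x).symm ⁻¹' orientDomain o x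

lemma isOpen_orientDomain (o : SurfaceOrientation M) (x : M) : IsOpen (orientDomain o x) :=
  isOpen_interior.inter (chartAt Plane x).open_source

lemma mem_orientDomain (o : SurfaceOrientation M) (x : M) : x ∈ orientDomain o x :=
  ⟨mem_interior_iff_mem_nhds.2 (o.locallyConstant x), mem_chart_source Plane x⟩

lemma orientDomain_subset (o : SurfaceOrientation M) (x : M) :
    orientDomain o x ⊆ (chartAt Plane x).source := inter_subset_right

lemma isOpen_coordDomain (o : SurfaceOrientation M) (x : M) : IsOpen (coordDomain o x) :=
  (chartAt Plane x).isOpen_inter_preimage_symm (isOpen_orientDomain o x)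

lemma chart_mem_coordDomain {o : SurfaceOrientation M} {x y : M} (hy : y ∈ orientDomain o x) :
    chartAt Plane x y ∈ coordDomain o x := by
  refine ⟨(chartAt Plane x).map_source hy.2, ?_⟩
  rw [mem_preimage, (chartAt Plane x).left_inv hy.2]
  exact hy

/-- The standard basis of the tangent plane at the centre `x` of the preferred chart. -/
noncomputable def tangentBasis (x : M) : Module.Basis (Fin 2) ℝ (TangentSpace (𝓡 2) x) :=
  (EuclideanSpace.basisFun (Fin 2) ℝ).toBasis

lemma tangentBasis_apply (x : M) (i : Fin 2) : tangentBasis x i = e i := by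
  have h := congrFun (EuclideanSpace.basisFun (Fin 2) ℝ).coe_toBasis i
  exact h.trans (by simp)

variable [RiemannianBundle (fun x : M => TangentSpace (𝓡 2) x)]

/-- The density of the area form of the oriented surface in the preferred chart at `x`. -/
noncomputable def areaDensity (o : SurfaceOrientation M) (x : M) (u : Plane) : ℝ :=
  (o.orient ((chartAt Plane x).symm u)).areaForm (vecOf x ((chartAt Plane x).symm u) (e 0))
    (vecOf x ((chartAt Plane x).symm u) (e 1))

lemma areaForm_vecOf (o : SurfaceOrientation M) (x : M) (u a b : Plane) :
    (o.orient ((chartAt Plane x).symm u)).areaForm (vecOf x ((chartAt Plane x).symm u) a)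
      (vecOf x ((chartAt Plane x).symm u) b) = areaDensity o x u * wedge a b := by
  conv_lhs => rw [eq_basis a, eq_basis b]
  simp only [vecOf_add, vecOf_smul, map_add, map_smul, LinearMap.add_apply, LinearMap.smul_apply,
    Orientation.areaForm_apply_self, smul_eq_mul, areaDensity, wedge]
  rw [Orientation.areaForm_swap _ (vecOf x _ (e 1)) (vecOf x _ (e 0))]
  ring

lemma areaDensity_sq (o : SurfaceOrientation M) (x : M) (u : Plane) :
    areaDensity o x u ^ 2 = (gram x u).det := by
  have h := (o.orient ((chartAt Plane x).symm u)).inner_sq_add_areaForm_sq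
    (vecOf x ((chartAt Plane x).symm u) (e 0)) (vecOf x ((chartAt Plane x).symm u) (e 1))
  rw [← real_inner_self_eq_norm_sq, ← real_inner_self_eq_norm_sq, ← metricForm_apply,
    ← metricForm_apply, ← metricForm_apply] at h
  simp only [metricForm_basis] at h
  rw [det_gram, areaDensity]
  linarith

/-- The sign of the area density is determined by the orientation at the centre of the chart. -/
lemma areaDensity_pos_iff (o : SurfaceOrientation M) (x : M) {u : Plane}
    (hu : u ∈ coordDomain o x) :
    0 < areaDensity o x u ↔
      o.orient x = (tangentBasis x).orientation := by
  set B := tangentBasis x with hB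
  set y := (chartAt Plane x).symm u with hy
  have hys : y ∈ (chartAt Plane x).source := orientDomain_subset o x hu.2
  obtain ⟨L, hL, hLo⟩ := interior_subset hu.2.1
  have hLs : ∀ w : Plane, L.symm (w : TangentSpace (𝓡 2) x) = vecOf x y w := by
    intro w
    refine L.symm_apply_eq.2 ?_
    rw [hL]
    exact (coordOf_vecOf hys w).symm
  set ob := (o.orient y).finOrthonormalBasis (by norm_num) (factFinrankTangent y).out with hob
  have hobo : ob.toBasis.orientation = o.orient y :=
    (o.orient y).finOrthonormalBasis_orientation (by norm_num) _
  have h1 : areaDensity o x u = ob.toBasis.det (B.map L.symm) := by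
    rw [areaDensity, Orientation.areaForm_to_volumeForm, (o.orient y).volumeForm_robust ob hobo]
    congr 1
    ext i
    fin_cases i
    · exact ((B.map_apply L.symm 0).trans
        ((congrArg L.symm (tangentBasis_apply x 0)).trans (hLs (e 0)))).symm
    · exact ((B.map_apply L.symm 1).trans
        ((congrArg L.symm (tangentBasis_apply x 1)).trans (hLs (e 1)))).symm
  rw [h1, ← Module.Basis.orientation_eq_iff_det_pos, hobo, Module.Basis.orientation_map, ← hLo]
  constructor
  · intro h2
    rw [h2, ← Module.Basis.orientation_map, ← Module.Basis.orientation_map]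
    congr 1
    ext i; simp
  · intro h2
    rw [← h2, ← Orientation.map_symm]
    exact ((Orientation.map (Fin 2) L).symm_apply_apply _).symm

/-- The area density is `± √det g`, with a constant sign on the domain. -/
lemma contDiffOn_areaDensity
    [IsContMDiffRiemannianBundle (𝓡 2) ∞ Plane (fun x : M => TangentSpace (𝓡 2) x)]
    (o : SurfaceOrientation M) (x : M) :
    ContDiffOn ℝ ∞ (areaDensity o x) (coordDomain o x) := by
  have hsub : coordDomain o x ⊆ (chartAt Plane x).target := inter_subset_left
  have hdet : ContDiffOn ℝ ∞ (fun u => √((gram x u).det)) (coordDomain o x) := by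
    refine ContDiffOn.sqrt ?_ fun u hu => (det_gram_pos x (hsub hu)).ne'
    simp only [Matrix.det_fin_two]
    exact (((contDiffOn_gram x 0 0).mul (contDiffOn_gram x 1 1)).sub
      ((contDiffOn_gram x 0 1).mul (contDiffOn_gram x 1 0))).mono hsub
  by_cases hor : o.orient x = (tangentBasis x).orientation
  · refine hdet.congr fun u hu => ?_
    rw [← areaDensity_sq o x u, Real.sqrt_sq ((areaDensity_pos_iff o x hu).2 hor).le]
  · refine hdet.neg.congr fun u hu => ?_
    rw [← areaDensity_sq o x u, Real.sqrt_sq_eq_abs,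
      abs_of_nonpos (not_lt.1 fun h => hor ((areaDensity_pos_iff o x hu).1 h)), neg_neg]

/-- The metric of an oriented surface in the preferred chart at `x`, with its Levi-Civita connection
and its area form. -/
lemma isLeviCivita
    [IsContMDiffRiemannianBundle (𝓡 2) ∞ Plane (fun x : M => TangentSpace (𝓡 2) x)]
    (o : SurfaceOrientation M) (x : M) :
    IsLeviCivita (coordDomain o x) (metricForm x) (christoffelForm x) (areaDensity o x) where
  isOpen := isOpen_coordDomain o x
  smooth_g := (contDiffOn_metricForm x).mono inter_subset_left
  smooth_Γ := (contDiffOn_christoffelForm x).mono inter_subset_left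
  smooth_A := contDiffOn_areaDensity o x
  symm u _ a b := metricForm_symm x u a b
  pos _ hu _ ha := metricForm_pos x hu.1 ha
  koszul _ hu a b c := koszul_metricForm x hu.1 a b c
  area u _ := by
    rw [areaDensity_sq, det_gram]
    simp only [metricForm_basis]

end SurfaceChart

/-! ### Coordinates on the unit tangent bundle -/

namespace UnitTangentBundle
open PlaneMetric SurfaceChart

variable {M : Type*} [TopologicalSpace M] [ChartedSpace Plane M] [IsManifold (𝓡 2) ∞ M]
  [RiemannianBundle (fun x : M => TangentSpace (𝓡 2) x)]
  [IsContMDiffRiemannianBundle (𝓡 2) ∞ Plane (fun x : M => TangentSpace (𝓡 2) x)]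

/-- The direction of the ray of slope `s` in the chart of `SM` at `p`. -/
noncomputable def rayDir (p : UnitTangentBundle M) (s : ℝ) : Plane := p.axis + s • rotPlane p.axis

lemma norm_rayPoint (p : UnitTangentBundle M) {z : Plane × ℝ}
    (hz : z.1 ∈ (chartAt Plane p.incl.1).target) :
    ‖(p.rayPoint z).2‖ = √(metricForm p.incl.1 z.1 (p.rayDir z.2) (p.rayDir z.2)) := by
  have h : p.rayPoint z = ⟨(chartAt Plane p.incl.1).symm z.1,
      vecOf p.incl.1 ((chartAt Plane p.incl.1).symm z.1) (p.rayDir z.2)⟩ :=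
    chart_symm_tangent p.incl _ hz
  rw [h, metricForm_apply, real_inner_self_eq_norm_sq, Real.sqrt_sq (norm_nonneg _)]

/-- The inclusion `SM → TM` in the charts at `p`. -/
lemma chart_incl_symm (p : UnitTangentBundle M) {z : Plane × ℝ}
    (hz : z.1 ∈ (chartAt Plane p.incl.1).target) :
    chartAt (ModelProd Plane Plane) p.incl ((chart p).symm z).incl =
      (z.1, (√(metricForm p.incl.1 z.1 (p.rayDir z.2) (p.rayDir z.2)))⁻¹ • p.rayDir z.2) := by
  have h := chart_normalize p.incl p (p.rayPoint_base_mem hz) (p.rayPoint_ne_zero hz)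
  rw [p.rayPoint_chart hz, p.norm_rayPoint hz] at h
  exact h

/-- The inclusion in `TM` of `SM`, with the charts given by the slope, is smooth: in charts it is
the normalization of a non-zero vector. -/
lemma contMDiff_incl : ContMDiff model ((𝓡 2).prod 𝓘(ℝ, Plane)) ∞
    (incl : UnitTangentBundle M → TangentBundle (𝓡 2) M) := by
  intro p
  rw [contMDiffAt_iff]
  refine ⟨continuous_incl.continuousAt, ?_⟩
  rw [ModelWithCorners.Boundaryless.range_eq_univ, contDiffWithinAt_univ]
  set z₀ : Plane × ℝ := extChartAt model p p with hz₀
  have hz₀t : z₀.1 ∈ (chartAt Plane p.incl.1).target :=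
    (chartAt Plane p.incl.1).map_source (mem_chart_source _ _)
  have hnear : ∀ᶠ z : Plane × ℝ in 𝓝 z₀, z.1 ∈ (chartAt Plane p.incl.1).target :=
    continuous_fst.continuousAt ((chartAt Plane p.incl.1).open_target.mem_nhds hz₀t)
  have hdir : ContDiff ℝ ∞ (fun z : Plane × ℝ => p.rayDir z.2) := by
    unfold rayDir; fun_prop
  have hmetric : ContDiffAt ℝ ∞ (fun z : Plane × ℝ =>
      metricForm p.incl.1 z.1 (p.rayDir z.2) (p.rayDir z.2)) z₀ := by
    have h1 : ContDiffAt ℝ ∞ (metricForm p.incl.1) z₀.1 :=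
      (contDiffOn_metricForm p.incl.1).contDiffAt
        ((chartAt Plane p.incl.1).open_target.mem_nhds hz₀t)
    exact ((h1.comp z₀ contDiffAt_fst).clm_apply hdir.contDiffAt).clm_apply hdir.contDiffAt
  have hpos : 0 < metricForm p.incl.1 z₀.1 (p.rayDir z₀.2) (p.rayDir z₀.2) :=
    metricForm_pos _ hz₀t (add_smul_rotPlane_ne_zero p.axis_ne_zero _)
  have hmain : ContDiffAt ℝ ∞ (fun z : Plane × ℝ => (z.1,
      (√(metricForm p.incl.1 z.1 (p.rayDir z.2) (p.rayDir z.2)))⁻¹ • p.rayDir z.2)) z₀ :=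
    contDiffAt_fst.prodMk (((hmetric.sqrt hpos.ne').inv (Real.sqrt_pos.2 hpos).ne').smul
      hdir.contDiffAt)
  refine hmain.congr_of_eventuallyEq ?_
  filter_upwards [hnear] with z hz
  exact p.chart_incl_symm hz

/-- The coordinates `(x, v)` of a unit tangent vector in the preferred chart of `M` at `x₁`. -/
noncomputable def coord (x₁ : M) (q : UnitTangentBundle M) : Plane × Plane :=
  (chartAt Plane x₁ q.base, coordOf x₁ q.base q.vec)

/-- The velocity of the coordinates `(x, v)`. -/
noncomputable def dcoord (x₁ : M) (q : UnitTangentBundle M) (ξ : TangentSpace model q) :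
    Plane × Plane :=
  mfderiv model 𝓘(ℝ, Plane × Plane) (coord x₁) q ξ

lemma coord_eq (x₁ : M) : coord x₁ = fun q : UnitTangentBundle M =>
    extChartAt ((𝓡 2).prod 𝓘(ℝ, Plane)) (⟨x₁, 0⟩ : TangentBundle (𝓡 2) M) q.incl := rfl

lemma continuous_base : Continuous (base : UnitTangentBundle M → M) :=
  (FiberBundle.continuous_proj Plane _).comp continuous_incl

lemma isOpen_base_preimage {W : Set M} (hW : IsOpen W) :
    IsOpen {q : UnitTangentBundle M | q.base ∈ W} := hW.preimage continuous_base

lemma contMDiffAt_coord {x₁ : M} {q : UnitTangentBundle M}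
    (hq : q.base ∈ (chartAt Plane x₁).source) :
    ContMDiffAt model 𝓘(ℝ, Plane × Plane) ∞ (coord x₁) q := by
  have hM : IsManifold ((𝓡 2).prod 𝓘(ℝ, Plane)) ∞ (TangentBundle (𝓡 2) M) :=
    Bundle.TotalSpace.isManifold Plane (TangentSpace (𝓡 2))
  rw [coord_eq]
  have h := contMDiffAt_extChartAt' (I := (𝓡 2).prod 𝓘(ℝ, Plane)) (n := ∞)
    (x := (⟨x₁, 0⟩ : TangentBundle (𝓡 2) M)) (x' := q.incl)
    ((TangentBundle.mem_chart_source_iff _ _).2 hq)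
  exact h.comp q contMDiff_incl.contMDiffAt

lemma mdifferentiableAt_coord {x₁ : M} {q : UnitTangentBundle M}
    (hq : q.base ∈ (chartAt Plane x₁).source) :
    MDifferentiableAt model 𝓘(ℝ, Plane × Plane) (coord x₁) q :=
  (contMDiffAt_coord hq).mdifferentiableAt (by simp)

lemma coordVelocity_eq (q : UnitTangentBundle M) (ξ : TangentSpace model q) :
    coordVelocity q ξ = dcoord q.base q ξ := by
  have h1 : MDifferentiableAt model ((𝓡 2).prod 𝓘(ℝ, Plane)) incl q :=
    contMDiff_incl.mdifferentiable (by simp) q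
  have h2 := mdifferentiableAt_coord (x₁ := q.base) (q := q) (mem_chart_source _ _)
  exact (DFunLike.congr_fun h1.mfderiv ξ).trans (DFunLike.congr_fun h2.mfderiv ξ).symm

lemma dbase_eq (q : UnitTangentBundle M) (ξ : TangentSpace model q) :
    dbase q ξ = (dcoord q.base q ξ).1 := by
  have h2 := mdifferentiableAt_coord (x₁ := q.base) (q := q) (mem_chart_source _ _)
  have hb : MDifferentiableAt model (𝓡 2) base q :=
    ((Bundle.contMDiff_proj (IB := 𝓡 2) (n := ∞) (F := Plane) (TangentSpace (𝓡 2) (M := M))).comp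
      contMDiff_incl).mdifferentiable (by simp) q
  have h4 : HasMFDerivAt model 𝓘(ℝ, Plane) (fun q' : UnitTangentBundle M => (coord q.base q').1) q
      ((ContinuousLinearMap.fst ℝ Plane Plane).comp
        (mfderiv model 𝓘(ℝ, Plane × Plane) (coord q.base) q)) :=
    HasMFDerivAt.comp q (hasFDerivAt_fst (𝕜 := ℝ) (p := coord q.base q)).hasMFDerivAt
      h2.hasMFDerivAt
  exact (DFunLike.congr_fun hb.mfderiv ξ).trans
    ((DFunLike.congr_fun h4.mdifferentiableAt.mfderiv ξ).symm.trans
      (DFunLike.congr_fun h4.mfderiv ξ))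

end UnitTangentBundle

/-! ### The canonical coframe in charts -/

namespace UnitTangentBundle
open PlaneMetric SurfaceChart

variable {M : Type*} [TopologicalSpace M] [ChartedSpace Plane M] [IsManifold (𝓡 2) ∞ M]
  [RiemannianBundle (fun x : M => TangentSpace (𝓡 2) x)]
  [IsContMDiffRiemannianBundle (𝓡 2) ∞ Plane (fun x : M => TangentSpace (𝓡 2) x)]

section ChartChange

variable {x₀ x₁ : M}

/-- The change from the preferred chart at `x₀` to the one at `x₁`. -/
noncomputable def chartChange (x₀ x₁ : M) : Plane → Plane :=
  chartAt Plane x₁ ∘ (chartAt Plane x₀).symm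

lemma contDiffAt_chartChange {y : M} (h0 : y ∈ (chartAt Plane x₀).source)
    (h1 : y ∈ (chartAt Plane x₁).source) :
    ContDiffAt ℝ ∞ (chartChange x₀ x₁) (chartAt Plane x₀ y) := by
  have h := contDiffWithinAt_ext_coord_change (I := 𝓡 2) (n := ∞) x₁ x₀
    (y := chartAt Plane x₀ y) ?_
  · rwa [ModelWithCorners.Boundaryless.range_eq_univ, contDiffWithinAt_univ] at h
  · rw [PartialEquiv.trans_source]
    refine ⟨?_, ?_⟩
    · simpa using (chartAt Plane x₀).map_source h0
    · simpa [(chartAt Plane x₀).left_inv h0] using h1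

lemma chartChange_chart {y : M} (h0 : y ∈ (chartAt Plane x₀).source) :
    chartChange x₀ x₁ (chartAt Plane x₀ y) = chartAt Plane x₁ y := by
  simp [chartChange, (chartAt Plane x₀).left_inv h0]

lemma eventually_symm_mem {y : M} (h0 : y ∈ (chartAt Plane x₀).source)
    (h1 : y ∈ (chartAt Plane x₁).source) : ∀ᶠ u in 𝓝 (chartAt Plane x₀ y),
      u ∈ (chartAt Plane x₀).target ∧ (chartAt Plane x₀).symm u ∈ (chartAt Plane x₁).source := by
  have ht := (chartAt Plane x₀).map_source h0
  refine Filter.Eventually.and ((chartAt Plane x₀).open_target.mem_nhds ht) ?_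
  refine ((chartAt Plane x₀).continuousAt_symm ht) ((chartAt Plane x₁).open_source.mem_nhds ?_)
  rwa [(chartAt Plane x₀).left_inv h0]

/-- The coordinates of a fixed tangent vector in two charts. -/
lemma vecOf_chartChange {u : Plane} (hu : u ∈ (chartAt Plane x₀).target)
    (hu' : (chartAt Plane x₀).symm u ∈ (chartAt Plane x₁).source) (a : Plane) :
    vecOf x₁ ((chartAt Plane x₀).symm u) (fderiv ℝ (chartChange x₀ x₁) u a) =
      vecOf x₀ ((chartAt Plane x₀).symm u) a := by
  have hs := (chartAt Plane x₀).map_target hu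
  have h := coordOf_eq_fderiv hs hu' (vecOf x₀ ((chartAt Plane x₀).symm u) a)
  rw [coordOf_vecOf hs, (chartAt Plane x₀).right_inv hu] at h
  change _ = fderiv ℝ (chartChange x₀ x₁) u a at h
  rw [← h, vecOf_coordOf hu']

lemma metricForm_chartChange {u : Plane} (hu : u ∈ (chartAt Plane x₀).target)
    (hu' : (chartAt Plane x₀).symm u ∈ (chartAt Plane x₁).source) (a b : Plane) :
    metricForm x₀ u a b = metricForm x₁ (chartChange x₀ x₁ u)
      (fderiv ℝ (chartChange x₀ x₁) u a) (fderiv ℝ (chartChange x₀ x₁) u b) := by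
  have h : (chartAt Plane x₁).symm (chartChange x₀ x₁ u) = (chartAt Plane x₀).symm u :=
    (chartAt Plane x₁).left_inv hu'
  rw [metricForm_apply, metricForm_apply, h, vecOf_chartChange hu hu', vecOf_chartChange hu hu']

/-- The velocity of the coordinates of a curve in `SM` changes by the derivative of the change of
charts, up to a term involving its second derivative. -/
lemma dcoord_chartChange {q : UnitTangentBundle M} (h0 : q.base ∈ (chartAt Plane x₀).source)
    (h1 : q.base ∈ (chartAt Plane x₁).source) (ξ : TangentSpace model q) :
    dcoord x₁ q ξ = (fderiv ℝ (chartChange x₀ x₁) (coord x₀ q).1 (dcoord x₀ q ξ).1,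
      fderiv ℝ (fderiv ℝ (chartChange x₀ x₁)) (coord x₀ q).1 (dcoord x₀ q ξ).1 (coord x₀ q).2
      + fderiv ℝ (chartChange x₀ x₁) (coord x₀ q).1 (dcoord x₀ q ξ).2) := by
  have hτ := contDiffAt_chartChange h0 h1
  have hd : HasFDerivAt (chartChange x₀ x₁) _ (coord x₀ q).1 :=
    (hτ.differentiableAt (by simp)).hasFDerivAt
  have hdd : HasFDerivAt (fderiv ℝ (chartChange x₀ x₁)) _ (coord x₀ q).1 :=
    ((hτ.fderiv_right (m := ∞) (by simp)).differentiableAt (by simp)).hasFDerivAt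
  have hT := (hd.comp (coord x₀ q) hasFDerivAt_fst).prodMk
    ((hdd.comp (coord x₀ q) hasFDerivAt_fst).clm_apply (hasFDerivAt_snd (𝕜 := ℝ)))
  have hc := (mdifferentiableAt_coord h0).hasMFDerivAt
  have hcomp := HasMFDerivAt.comp q hT.hasMFDerivAt hc
  have heq : coord x₁ =ᶠ[𝓝 q] (fun z : Plane × Plane => (chartChange x₀ x₁ z.1,
      fderiv ℝ (chartChange x₀ x₁) z.1 z.2)) ∘ coord x₀ := by
    filter_upwards [((isOpen_base_preimage (chartAt Plane x₀).open_source).mem_nhds h0),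
      ((isOpen_base_preimage (chartAt Plane x₁).open_source).mem_nhds h1)] with q' h0' h1'
    refine Prod.ext (chartChange_chart h0').symm ?_
    exact coordOf_eq_fderiv h0' h1' q'.vec
  have hfin := (hcomp.congr_of_eventuallyEq heq).mfderiv
  refine (DFunLike.congr_fun hfin ξ).trans ?_
  refine Prod.ext rfl ?_
  simp [dcoord]
  exact add_comm _ _

end ChartChange

section Coframe

variable {o : SurfaceOrientation M} {x₁ : M} {q : UnitTangentBundle M}

lemma coord_self_snd (q : UnitTangentBundle M) : (coord q.base q).2 = q.axis := rfl

/-- The coordinates of the footpoint velocity. -/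
lemma dbase_eq_vecOf (h : q.base ∈ (chartAt Plane x₁).source) (ξ : TangentSpace model q) :
    dbase q ξ = vecOf x₁ q.base (dcoord x₁ q ξ).1 := by
  have hs := mem_chart_source Plane q.base
  rw [dcoord_chartChange hs h, dbase_eq]
  have hu := (chartAt Plane q.base).map_source hs
  have hl := (chartAt Plane q.base).left_inv hs
  have h2 := vecOf_chartChange (x₁ := x₁) hu (by rwa [hl]) (dcoord q.base q ξ).1
  rw [hl, vecOf_self] at h2
  exact h2.symm

/-- The covariant derivative has the same expression in all charts: the second derivative of the
change of charts cancels against the transformation law of the Christoffel symbols. -/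
lemma covDeriv_eq_vecOf (o : SurfaceOrientation M) (h : q.base ∈ orientDomain o x₁)
    (ξ : TangentSpace model q) :
    covDeriv q ξ = vecOf x₁ q.base ((dcoord x₁ q ξ).2 +
      christoffelForm x₁ (coord x₁ q).1 (dcoord x₁ q ξ).1 (coord x₁ q).2) := by
  have hs := mem_chart_source Plane q.base
  have h1 := orientDomain_subset o x₁ h
  have hu := (chartAt Plane q.base).map_source hs
  have hl := (chartAt Plane q.base).left_inv hs
  have hself : covDeriv q ξ = (dcoord q.base q ξ).2 + christoffelForm q.base (coord q.base q).1
      (dcoord q.base q ξ).1 (coord q.base q).2 := by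
    have hk : ∀ a : Plane, ∑ k, a k • coordVec q.base q.base k = a := by
      intro a
      simp only [coordVec_eq, vecOf_self, Fin.sum_univ_two]
      exact (eq_basis a).symm
    rw [← hk ((dcoord q.base q ξ).2 + christoffelForm q.base (coord q.base q).1
      (dcoord q.base q ξ).1 (coord q.base q).2), covDeriv]
    simp only [coordVelocity_eq, PiLp.add_apply, christoffelForm_apply]
    rfl
  have hmap := (isLeviCivita o q.base).map_Γ (isLeviCivita o x₁) (τ := chartChange q.base x₁)
    (chart_mem_coordDomain (mem_orientDomain o q.base))
    (by rw [chartChange_chart hs]; exact chart_mem_coordDomain h)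
    (contDiffAt_chartChange hs h1)
    ((eventually_symm_mem hs h1).mono fun y hy a b => metricForm_chartChange hy.1 hy.2 a b)
    (dcoord q.base q ξ).1 (coord q.base q).2
  have h2 := vecOf_chartChange (x₁ := x₁) hu (by rwa [hl])
    ((dcoord q.base q ξ).2 + christoffelForm q.base (coord q.base q).1
      (dcoord q.base q ξ).1 (coord q.base q).2)
  rw [hl, vecOf_self] at h2
  rw [hself]
  refine h2.symm.trans (congrArg (vecOf x₁ q.base) ?_)
  rw [map_add]
  have hc2 : (coord x₁ q).2 = fderiv ℝ (chartChange q.base x₁) (chartAt Plane q.base q.base)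
      (coord q.base q).2 := coordOf_eq_fderiv hs h1 q.vec
  have hc1 : (coord x₁ q).1 = chartChange q.base x₁ (chartAt Plane q.base q.base) :=
    (chartChange_chart hs).symm
  rw [dcoord_chartChange hs h1, hc1, hc2]
  change _ + fderiv ℝ (chartChange q.base x₁) _ (christoffelForm q.base
    (chartAt Plane q.base q.base) _ _) = _
  rw [hmap]
  change _ = fderiv ℝ (fderiv ℝ (chartChange q.base x₁)) (chartAt Plane q.base q.base) _ _ +
    fderiv ℝ (chartChange q.base x₁) (chartAt Plane q.base q.base) _ + _
  abel

lemma vec_eq_vecOf (h : q.base ∈ (chartAt Plane x₁).source) :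
    q.vec = vecOf x₁ q.base (coord x₁ q).2 := (vecOf_coordOf h q.vec).symm

lemma chart_symm_coord (h : q.base ∈ (chartAt Plane x₁).source) :
    (chartAt Plane x₁).symm (coord x₁ q).1 = q.base := (chartAt Plane x₁).left_inv h

lemma inner_vecOf (h : q.base ∈ (chartAt Plane x₁).source) (a b : Plane) :
    inner ℝ (vecOf x₁ q.base a) (vecOf x₁ q.base b) = metricForm x₁ (coord x₁ q).1 a b := by
  rw [metricForm_apply, chart_symm_coord h]

lemma areaForm_vecOf_base (h : q.base ∈ (chartAt Plane x₁).source) (a b : Plane) :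
    (o.orient q.base).areaForm (vecOf x₁ q.base a) (vecOf x₁ q.base b) =
      areaDensity o x₁ (coord x₁ q).1 * wedge a b := by
  rw [← areaForm_vecOf, chart_symm_coord h]

lemma omega1_eq (h : q.base ∈ (chartAt Plane x₁).source) (ξ : TangentSpace model q) :
    omega1 q ξ = metricForm x₁ (coord x₁ q).1 (dcoord x₁ q ξ).1 (coord x₁ q).2 := by
  rw [omega1, dbase_eq_vecOf h, ← inner_vecOf h, ← vec_eq_vecOf h]

lemma omega2_eq (h : q.base ∈ (chartAt Plane x₁).source) (ξ : TangentSpace model q) :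
    omega2 o q ξ = areaDensity o x₁ (coord x₁ q).1 *
      wedge (coord x₁ q).2 (dcoord x₁ q ξ).1 := by
  rw [omega2, jvec, real_inner_comm, Orientation.inner_rightAngleRotation_left,
    dbase_eq_vecOf h, ← areaForm_vecOf_base h, ← vec_eq_vecOf h]

lemma psi_eq (h : q.base ∈ orientDomain o x₁) (ξ : TangentSpace model q) :
    psi o q ξ = areaDensity o x₁ (coord x₁ q).1 * wedge (coord x₁ q).2 ((dcoord x₁ q ξ).2 +
      christoffelForm x₁ (coord x₁ q).1 (dcoord x₁ q ξ).1 (coord x₁ q).2) := by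
  have h1 := orientDomain_subset o x₁ h
  rw [psi, jvec, real_inner_comm, Orientation.inner_rightAngleRotation_left,
    covDeriv_eq_vecOf o h, ← areaForm_vecOf_base h1, ← vec_eq_vecOf h1]

lemma metricForm_coord (h : q.base ∈ (chartAt Plane x₁).source) :
    metricForm x₁ (coord x₁ q).1 (coord x₁ q).2 (coord x₁ q).2 = 1 := by
  rw [← inner_vecOf h, ← vec_eq_vecOf h, real_inner_self_eq_norm_sq, q.norm_vec, one_pow]

end Coframe

end UnitTangentBundle

/-! ### The canonical frame -/

namespace UnitTangentBundle
open PlaneMetric SurfaceChart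

variable {M : Type*} [TopologicalSpace M] [ChartedSpace Plane M] [IsManifold (𝓡 2) ∞ M]
  [RiemannianBundle (fun x : M => TangentSpace (𝓡 2) x)]
  [IsContMDiffRiemannianBundle (𝓡 2) ∞ Plane (fun x : M => TangentSpace (𝓡 2) x)]

/-- The chart of `SM` at `q` in terms of the coordinates `(x, v)`. -/
noncomputable def slopeMap (q : UnitTangentBundle M) (z : Plane × Plane) : Plane × ℝ :=
  (z.1, slopeAlong q.axis z.2)

lemma extChartAt_eq (q : UnitTangentBundle M) :
    (extChartAt model q : UnitTangentBundle M → Plane × ℝ) = slopeMap q ∘ coord q.base := rfl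

lemma contDiffAt_slopeMap {q : UnitTangentBundle M} {z : Plane × Plane}
    (hz : inner ℝ z.2 q.axis ≠ (0 : ℝ)) : ContDiffAt ℝ ∞ (slopeMap q) z :=
  contDiffAt_fst.prodMk ((contDiffAt_slopeAlong hz).comp z contDiffAt_snd)

lemma inner_axis_ne_zero (q : UnitTangentBundle M) :
    inner ℝ (coord q.base q).2 q.axis ≠ (0 : ℝ) := by
  rw [coord_self_snd]
  exact (real_inner_self_pos.2 q.axis_ne_zero).ne'

/-- The coordinates `(x, v)` immerse `SM`, since the chart of `SM` factors through them. -/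
lemma dcoord_injective (q : UnitTangentBundle M) : Function.Injective (dcoord q.base q) := by
  have h1 := mdifferentiableAt_coord (x₁ := q.base) (q := q) (mem_chart_source _ _)
  have h2 := ((contDiffAt_slopeMap q.inner_axis_ne_zero).differentiableAt (by simp)).hasFDerivAt
  have h3 := HasMFDerivAt.comp q h2.hasMFDerivAt h1.hasMFDerivAt
  rw [← extChartAt_eq] at h3
  have h4 := isInvertible_mfderiv_extChartAt (I := model) (mem_extChartAt_source (I := model) q)
  rw [h3.mfderiv] at h4
  have h5 := h4.injective
  exact Function.Injective.of_comp (f := fderiv ℝ (slopeMap q) (coord q.base q)) h5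

lemma dcoord_add (x₁ : M) (q : UnitTangentBundle M) (ξ η : TangentSpace model q) :
    dcoord x₁ q (ξ + η) = dcoord x₁ q ξ + dcoord x₁ q η :=
  map_add (mfderiv model 𝓘(ℝ, Plane × Plane) (coord x₁) q) ξ η

lemma dcoord_smul (x₁ : M) (q : UnitTangentBundle M) (r : ℝ) (ξ : TangentSpace model q) :
    dcoord x₁ q (r • ξ) = r • dcoord x₁ q ξ :=
  map_smul (mfderiv model 𝓘(ℝ, Plane × Plane) (coord x₁) q) r ξ

section Linear

variable (o : SurfaceOrientation M) (q : UnitTangentBundle M) (ξ η : TangentSpace model q) (r : ℝ)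

lemma omega1_add : omega1 q (ξ + η) = omega1 q ξ + omega1 q η := by
  have h := mem_chart_source Plane q.base
  simp only [omega1_eq h, dcoord_add, Prod.fst_add, map_add, add_apply]

lemma omega1_smul : omega1 q (r • ξ) = r * omega1 q ξ := by
  have h := mem_chart_source Plane q.base
  simp only [omega1_eq h, dcoord_smul, Prod.smul_fst, map_smul, smul_apply, smul_eq_mul]

lemma omega2_add : omega2 o q (ξ + η) = omega2 o q ξ + omega2 o q η := by
  have h := mem_chart_source Plane q.base
  simp only [omega2_eq h, dcoord_add, Prod.fst_add, wedge_add_right, mul_add]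

lemma omega2_smul : omega2 o q (r • ξ) = r * omega2 o q ξ := by
  have h := mem_chart_source Plane q.base
  simp only [omega2_eq h, dcoord_smul, Prod.smul_fst, wedge_smul_right]
  ring

lemma psi_add : psi o q (ξ + η) = psi o q ξ + psi o q η := by
  have h := mem_orientDomain o q.base
  simp only [psi_eq h, dcoord_add, Prod.fst_add, Prod.snd_add, map_add, add_apply,
    wedge_add_right, mul_add]
  ring

lemma psi_smul : psi o q (r • ξ) = r * psi o q ξ := by
  have h := mem_orientDomain o q.base
  simp only [psi_eq h, dcoord_smul, Prod.smul_fst, Prod.smul_snd, map_smul, smul_apply,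
    ← smul_add, wedge_smul_right]
  ring

end Linear

/-- The unit length condition, differentiated. -/
lemma metricForm_covDeriv (o : SurfaceOrientation M) {x₁ : M} {q : UnitTangentBundle M}
    (h : q.base ∈ orientDomain o x₁) (ξ : TangentSpace model q) :
    metricForm x₁ (coord x₁ q).1 ((dcoord x₁ q ξ).2 +
      christoffelForm x₁ (coord x₁ q).1 (dcoord x₁ q ξ).1 (coord x₁ q).2) (coord x₁ q).2 = 0 := by
  have h1 := orientDomain_subset o x₁ h
  have hmem : (coord x₁ q).1 ∈ coordDomain o x₁ := chart_mem_coordDomain h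
  obtain ⟨L, hL, hL'⟩ := (isLeviCivita o x₁).hasFDerivAt_inner_along (P := Plane × Plane)
    (x := Prod.fst) (V := Prod.snd) (W := Prod.snd) (z := coord x₁ q) hmem
    differentiableAt_fst differentiableAt_snd differentiableAt_snd
  have hc := HasMFDerivAt.comp q hL.hasMFDerivAt (mdifferentiableAt_coord h1).hasMFDerivAt
  have h0 : HasMFDerivAt model 𝓘(ℝ, ℝ) ((fun z : Plane × Plane => metricForm x₁ z.1 z.2 z.2) ∘
      coord x₁) q 0 := by
    refine (hasMFDerivAt_const (1 : ℝ) q).congr_of_eventuallyEq ?_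
    filter_upwards [(isOpen_base_preimage (chartAt Plane x₁).open_source).mem_nhds h1] with q' hq'
    exact metricForm_coord hq'
  have h2 : L (dcoord x₁ q ξ) = 0 := DFunLike.congr_fun (hasMFDerivAt_unique hc h0) ξ
  rw [hL', (isLeviCivita o x₁).symm _ hmem (coord x₁ q).2] at h2
  simp only [cov, fderiv_snd, fderiv_fst, ContinuousLinearMap.coe_fst',
    ContinuousLinearMap.coe_snd'] at h2
  linarith

/-- The forms `ω₁, ω₂, ψ` have no common zero. -/
lemma eq_zero_of_coframe (o : SurfaceOrientation M) {q : UnitTangentBundle M}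
    {ξ : TangentSpace model q} (h1 : omega1 q ξ = 0) (h2 : omega2 o q ξ = 0)
    (h3 : psi o q ξ = 0) : ξ = 0 := by
  have hs := mem_chart_source Plane q.base
  have ho := mem_orientDomain o q.base
  have hmem : (coord q.base q).1 ∈ coordDomain o q.base := chart_mem_coordDomain ho
  have hLC := isLeviCivita o q.base
  have hu := metricForm_coord hs
  have horth := metricForm_covDeriv o ho ξ
  rw [omega1_eq hs] at h1
  rw [omega2_eq hs] at h2
  rw [psi_eq ho] at h3
  have hx : (dcoord q.base q ξ).1 = 0 := by
    refine hLC.ext_of_g hmem fun c => ?_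
    rw [hLC.inner_eq_area hmem hu, h1, h2]
    simp
  have hv : (dcoord q.base q ξ).2 + christoffelForm q.base (coord q.base q).1
      (dcoord q.base q ξ).1 (coord q.base q).2 = 0 := by
    refine hLC.ext_of_g hmem fun c => ?_
    rw [hLC.inner_eq_area hmem hu, horth, h3]
    simp
  rw [hx] at hv
  simp at hv
  apply dcoord_injective q
  have h0 : dcoord q.base q (0 : TangentSpace model q) = 0 :=
    map_zero (mfderiv model 𝓘(ℝ, Plane × Plane) (coord q.base) q)
  exact (Prod.ext hx hv : dcoord q.base q ξ = 0).trans h0.symm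

/-- The coordinates of a tangent vector of `SM` in the frame `(X + λV, H + pV, V)`. -/
noncomputable def frameCoords (o : SurfaceOrientation M) (lam p : UnitTangentBundle M → ℝ)
    (q : UnitTangentBundle M) : TangentSpace model q →ₗ[ℝ] ℝ × ℝ × ℝ where
  toFun ξ := (omega1 q ξ, omega2 o q ξ, psi o q ξ - lam q * omega1 q ξ - p q * omega2 o q ξ)
  map_add' ξ η := by
    simp only [omega1_add, omega2_add, psi_add, Prod.mk_add_mk]
    congr 2; ring
  map_smul' r ξ := by
    simp only [omega1_smul, omega2_smul, psi_smul, Prod.smul_mk, RingHom.id_apply, smul_eq_mul]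
    congr 2; ring

lemma frameCoords_apply (o : SurfaceOrientation M) (lam p : UnitTangentBundle M → ℝ)
    (q : UnitTangentBundle M) (ξ : TangentSpace model q) : frameCoords o lam p q ξ =
      (omega1 q ξ, omega2 o q ξ, psi o q ξ - lam q * omega1 q ξ - p q * omega2 o q ξ) := rfl

instance finiteDimensional_tangentSpace (q : UnitTangentBundle M) :
    FiniteDimensional ℝ (TangentSpace model q) :=
  inferInstanceAs (FiniteDimensional ℝ (Plane × ℝ))

lemma frameCoords_injective (o : SurfaceOrientation M) (lam p : UnitTangentBundle M → ℝ)
    (q : UnitTangentBundle M) : Function.Injective (frameCoords o lam p q) := by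
  rw [← LinearMap.ker_eq_bot, LinearMap.ker_eq_bot']
  intro ξ hξ
  rw [frameCoords_apply, Prod.mk_eq_zero, Prod.mk_eq_zero] at hξ
  obtain ⟨h1, h2, h3⟩ := hξ
  refine eq_zero_of_coframe o h1 h2 ?_
  rw [h1, h2] at h3
  simpa using h3

lemma frameCoords_surjective (o : SurfaceOrientation M) (lam p : UnitTangentBundle M → ℝ)
    (q : UnitTangentBundle M) : Function.Surjective (frameCoords o lam p q) := by
  have hfin : Module.finrank ℝ (TangentSpace model q) = Module.finrank ℝ (ℝ × ℝ × ℝ) := by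
    change Module.finrank ℝ (Plane × ℝ) = _
    simp
  exact (LinearMap.injective_iff_surjective_of_finrank_eq_finrank hfin).1
    (frameCoords_injective o lam p q)

/-- The linear isomorphism given by the frame `(X + λV, H + pV, V)`. -/
noncomputable def frameEquiv (o : SurfaceOrientation M) (lam p : UnitTangentBundle M → ℝ)
    (q : UnitTangentBundle M) : TangentSpace model q ≃ₗ[ℝ] ℝ × ℝ × ℝ :=
  LinearEquiv.ofBijective (frameCoords o lam p q)
    ⟨frameCoords_injective o lam p q, frameCoords_surjective o lam p q⟩

lemma frameEquiv_apply (o : SurfaceOrientation M) (lam p : UnitTangentBundle M → ℝ)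
    (q : UnitTangentBundle M) (ξ : TangentSpace model q) :
    frameEquiv o lam p q ξ = frameCoords o lam p q ξ := rfl

/-- The vectors chosen in the definitions of `X` and `H` exist. -/
lemma exists_coframe_eq (o : SurfaceOrientation M) (q : UnitTangentBundle M) (a b c : ℝ) :
    ∃ ξ : TangentSpace model q, omega1 q ξ = a ∧ omega2 o q ξ = b ∧ psi o q ξ = c := by
  obtain ⟨ξ, hξ⟩ := frameCoords_surjective o (fun _ => 0) (fun _ => 0) q (a, b, c)
  rw [frameCoords_apply] at hξ
  simp only [zero_mul, sub_zero, Prod.mk.injEq] at hξ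
  exact ⟨ξ, hξ⟩

lemma coframe_vfX (o : SurfaceOrientation M) (q : UnitTangentBundle M) :
    omega1 q (vfX o q) = 1 ∧ omega2 o q (vfX o q) = 0 ∧ psi o q (vfX o q) = 0 :=
  Classical.epsilon_spec (exists_coframe_eq o q 1 0 0)

lemma coframe_vfH (o : SurfaceOrientation M) (q : UnitTangentBundle M) :
    omega1 q (vfH o q) = 0 ∧ omega2 o q (vfH o q) = 1 ∧ psi o q (vfH o q) = 0 :=
  Classical.epsilon_spec (exists_coframe_eq o q 0 1 0)

lemma rotate_zero (o : SurfaceOrientation M) (q : UnitTangentBundle M) : rotate o 0 q = q := by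
  apply Subtype.ext
  simp [rotate]
  rfl

lemma rotate_vec (o : SurfaceOrientation M) (θ : ℝ) (q : UnitTangentBundle M) :
    (rotate o θ q).vec = Real.cos θ • q.vec + Real.sin θ • q.jvec o := by
  change (o.orient q.base).rotation (θ : Real.Angle) q.vec = _
  rw [Orientation.rotation_apply]
  simp [jvec]

lemma continuous_rotate (o : SurfaceOrientation M) (q : UnitTangentBundle M) :
    Continuous (fun θ : ℝ => rotate o θ q) := by
  refine continuous_induced_rng.2 ?_
  have h1 : Continuous (fun θ : ℝ => Real.cos θ • q.vec + Real.sin θ • q.jvec o) :=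
    (Real.continuous_cos.smul continuous_const).add (Real.continuous_sin.smul continuous_const)
  refine ((FiberBundle.continuous_totalSpaceMk Plane (TangentSpace (𝓡 2) (M := M))
    q.base).comp h1).congr fun θ => ?_
  exact congrArg (fun v => (⟨q.base, v⟩ : TangentBundle (𝓡 2) M)) (rotate_vec o θ q).symm

lemma coordOf_add {x₁ y : M} (hy : y ∈ (chartAt Plane x₁).source) (V W : TangentSpace (𝓡 2) y) :
    coordOf x₁ y (V + W) = coordOf x₁ y V + coordOf x₁ y W :=
  ((trivializationAt Plane (TangentSpace (𝓡 2)) x₁).linear ℝ (mem_baseSet hy)).map_add V W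

lemma coordOf_smul {x₁ y : M} (hy : y ∈ (chartAt Plane x₁).source) (r : ℝ)
    (V : TangentSpace (𝓡 2) y) : coordOf x₁ y (r • V) = r • coordOf x₁ y V :=
  ((trivializationAt Plane (TangentSpace (𝓡 2)) x₁).linear ℝ (mem_baseSet hy)).map_smul r V

lemma coord_rotate (o : SurfaceOrientation M) (q : UnitTangentBundle M) (θ : ℝ) :
    coord q.base (rotate o θ q) = (chartAt Plane q.base q.base,
      Real.cos θ • coordOf q.base q.base q.vec + Real.sin θ • coordOf q.base q.base (q.jvec o)) := by
  have hs := mem_chart_source Plane q.base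
  refine Prod.ext rfl ?_
  change coordOf q.base q.base (rotate o θ q).vec = _
  rw [rotate_vec, coordOf_add hs, coordOf_smul hs, coordOf_smul hs]

/-- The generator of the rotations is vertical, with vertical part `Jv`. -/
lemma dcoord_vfV (o : SurfaceOrientation M) (q : UnitTangentBundle M) :
    dcoord q.base q (vfV o q) = (0, coordOf q.base q.base (q.jvec o)) := by
  have hs := mem_chart_source Plane q.base
  have hder : HasFDerivAt (fun θ : ℝ => ((chartAt Plane q.base q.base,
      Real.cos θ • coordOf q.base q.base q.vec + Real.sin θ • coordOf q.base q.base (q.jvec o)) :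
        Plane × Plane)) (ContinuousLinearMap.toSpanSingleton ℝ
          ((0, coordOf q.base q.base (q.jvec o)) : Plane × Plane)) 0 := by
    have h := ((hasDerivAt_const (0 : ℝ) (chartAt Plane q.base q.base)).prodMk
      (((Real.hasDerivAt_cos 0).smul_const (coordOf q.base q.base q.vec)).add
      ((Real.hasDerivAt_sin 0).smul_const (coordOf q.base q.base (q.jvec o))))).hasFDerivAt
    simpa using h
  have hmd : MDifferentiableAt 𝓘(ℝ, ℝ) model (fun θ : ℝ => rotate o θ q) 0 := by
    rw [mdifferentiableAt_iff]
    refine ⟨(continuous_rotate o q).continuousAt, ?_⟩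
    rw [ModelWithCorners.Boundaryless.range_eq_univ]
    apply DifferentiableAt.differentiableWithinAt
    have h1 : DifferentiableAt ℝ (slopeMap q) (coord q.base q) :=
      (contDiffAt_slopeMap q.inner_axis_ne_zero).differentiableAt (by simp)
    have h2 : DifferentiableAt ℝ (fun θ : ℝ => coord q.base (rotate o θ q)) 0 := by
      simp only [coord_rotate]
      exact hder.differentiableAt
    have h3 : coord q.base q = coord q.base (rotate o 0 q) := by rw [rotate_zero]
    rw [h3] at h1
    have h4 := h1.comp (0 : ℝ) h2
    have h5 : ∀ q' : UnitTangentBundle M, q' = q → DifferentiableAt ℝ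
        ((extChartAt model q' : UnitTangentBundle M → Plane × ℝ) ∘
          fun θ : ℝ => rotate o θ q) 0 := by
      rintro q' rfl; exact h4
    exact h5 _ (rotate_zero o q)
  have hcd : MDifferentiableAt model 𝓘(ℝ, Plane × Plane) (coord q.base) (rotate o 0 q) :=
    mdifferentiableAt_coord hs
  have hcomp := HasMFDerivAt.comp (0 : ℝ) hcd.hasMFDerivAt hmd.hasMFDerivAt
  have hfun : coord q.base ∘ (fun θ : ℝ => rotate o θ q) = fun θ : ℝ =>
      ((chartAt Plane q.base q.base, Real.cos θ • coordOf q.base q.base q.vec +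
        Real.sin θ • coordOf q.base q.base (q.jvec o)) : Plane × Plane) :=
    funext fun θ => coord_rotate o q θ
  rw [hfun] at hcomp
  have huniq := DFunLike.congr_fun (hasMFDerivAt_unique hcomp hder.hasMFDerivAt) (1 : ℝ)
  have htrans : ∀ (q' : UnitTangentBundle M), q' = q → ∀ w : Plane × ℝ,
      (mfderiv model 𝓘(ℝ, Plane × Plane) (coord q.base) q' (w : TangentSpace model q') :
        Plane × Plane) = dcoord q.base q (w : TangentSpace model q) := by
    rintro q' rfl w; rfl
  refine (htrans _ (rotate_zero o q) (vfV o q)).symm.trans (huniq.trans ?_)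
  exact one_smul ℝ ((0, coordOf q.base q.base (q.jvec o)) : Plane × Plane)

lemma coframe_vfV (o : SurfaceOrientation M) (q : UnitTangentBundle M) :
    omega1 q (vfV o q) = 0 ∧ omega2 o q (vfV o q) = 0 ∧ psi o q (vfV o q) = 1 := by
  have hs := mem_chart_source Plane q.base
  have ho := mem_orientDomain o q.base
  refine ⟨?_, ?_, ?_⟩
  · rw [omega1_eq hs, dcoord_vfV]; simp
  · rw [omega2_eq hs, dcoord_vfV]; simp [wedge]
  · rw [psi_eq ho, dcoord_vfV]
    simp only [map_zero, zero_apply, add_zero]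
    rw [← areaForm_vecOf_base hs, ← vec_eq_vecOf hs, vecOf_coordOf hs, jvec,
      Orientation.areaForm_rightAngleRotation_right, real_inner_self_eq_norm_sq, q.norm_vec,
      one_pow]

end UnitTangentBundle

/-! ### Topology of the unit tangent bundle -/

namespace UnitTangentBundle
open PlaneMetric SurfaceChart

variable {M : Type*} [TopologicalSpace M] [ChartedSpace Plane M] [IsManifold (𝓡 2) ∞ M]
  [RiemannianBundle (fun x : M => TangentSpace (𝓡 2) x)]
  [IsContMDiffRiemannianBundle (𝓡 2) ∞ Plane (fun x : M => TangentSpace (𝓡 2) x)]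

/-- Unit vectors with the same footpoint and the same coordinates agree. -/
lemma eq_of_coord_eq {x₁ : M} {q q' : UnitTangentBundle M}
    (hq : q.base ∈ (chartAt Plane x₁).source) (hb : q.base = q'.base)
    (h : coord x₁ q = coord x₁ q') : q = q' := by
  have hq' : q'.base ∈ (chartAt Plane x₁).source := hb ▸ hq
  have h1 : q.incl = ⟨q.base, vecOf x₁ q.base (coord x₁ q).2⟩ := by
    rw [← vec_eq_vecOf hq]; rfl
  have h2 : q'.incl = ⟨q'.base, vecOf x₁ q'.base (coord x₁ q').2⟩ := by
    rw [← vec_eq_vecOf hq']; rfl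
  apply Subtype.ext
  change q.incl = q'.incl
  rw [h1, h2, h, hb]

instance t2Space [T2Space M] : T2Space (UnitTangentBundle M) := by
  refine ⟨fun q q' hne => ?_⟩
  by_cases hb : q.base = q'.base
  · have hs : q.base ∈ (chartAt Plane q.base).source := mem_chart_source _ _
    have hs' : q'.base ∈ (chartAt Plane q.base).source := hb ▸ hs
    have hc : coord q.base q ≠ coord q.base q' := fun h => hne (eq_of_coord_eq hs hb h)
    obtain ⟨U, V, hU, hV, hqU, hqV, hUV⟩ := t2_separation hc
    have hcont : ContinuousOn (coord q.base)
        {r : UnitTangentBundle M | r.base ∈ (chartAt Plane q.base).source} := fun r hr =>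
      (contMDiffAt_coord hr).continuousAt.continuousWithinAt
    have hopen := isOpen_base_preimage (chartAt Plane q.base).open_source
    refine ⟨_, _, hcont.isOpen_inter_preimage hopen hU, hcont.isOpen_inter_preimage hopen hV,
      ⟨hs, hqU⟩, ⟨hs', hqV⟩, ?_⟩
    rw [Set.disjoint_left] at hUV ⊢
    exact fun r hr hr' => hUV hr.2 hr'.2
  · obtain ⟨U, V, hU, hV, hqU, hqV, hUV⟩ := t2_separation hb
    refine ⟨_, _, isOpen_base_preimage hU, isOpen_base_preimage hV, hqU, hqV, ?_⟩
    rw [Set.disjoint_left] at hUV ⊢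
    exact fun r hr hr' => hUV hr hr'

/-- `SM` is compact: it is covered by the images of finitely many products of a compact coordinate
domain with a circle. -/
instance compactSpace [CompactSpace M] : CompactSpace (UnitTangentBundle M) := by
  rcases isEmpty_or_nonempty (UnitTangentBundle M) with hemp | ⟨⟨p⟩⟩
  · infer_instance
  have hloc : LocallyCompactSpace M := ChartedSpace.locallyCompactSpace Plane M
  choose K hK hKs hKc using fun x : M => local_compact_nhds
    ((chartAt Plane x).open_source.mem_nhds (mem_chart_source Plane x))
  obtain ⟨t, ht⟩ := CompactSpace.elim_nhds_subcover K hK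
  -- Unit vectors over a compact coordinate domain are the rescalings of coordinate unit vectors.
  set f : M → Plane × Plane → UnitTangentBundle M := fun x z =>
    normalize p ((chartAt (ModelProd Plane Plane) (⟨x, 0⟩ : TangentBundle (𝓡 2) M)).symm z)
    with hf
  set S : M → Set (Plane × Plane) := fun x =>
    (chartAt Plane x '' K x) ×ˢ Metric.sphere (0 : Plane) 1 with hS
  have hStarget : ∀ x, ∀ z ∈ S x, z.1 ∈ (chartAt Plane x).target := by
    rintro x z ⟨⟨y, hy, hyz⟩, -⟩
    rw [← hyz]
    exact (chartAt Plane x).map_source (hKs x hy)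
  have hfS : ∀ x, IsCompact (f x '' S x) := by
    intro x
    refine IsCompact.image_of_continuousOn (((hKc x).image_of_continuousOn
      ((chartAt Plane x).continuousOn.mono (hKs x))).prod (isCompact_sphere _ _)) ?_
    refine (continuousOn_normalize p).comp
      ((chartAt (ModelProd Plane Plane) (⟨x, 0⟩ : TangentBundle (𝓡 2) M)).continuousOn_symm.mono
        ?_) ?_
    · intro z hz
      exact (TangentBundle.mem_chart_target_iff (I := 𝓡 2) _ _).2 (hStarget x z hz)
    · intro z hz
      have hz1 := hStarget x z hz
      change ((chartAt (ModelProd Plane Plane) (⟨x, 0⟩ : TangentBundle (𝓡 2) M)).symm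
        (z.1, z.2)).2 ≠ 0
      have hsrc : ((chartAt (ModelProd Plane Plane) (⟨x, 0⟩ : TangentBundle (𝓡 2) M)).symm
        (z.1, z.2)).1 ∈ (chartAt Plane x).source := (chartAt Plane x).map_target hz1
      rw [← chart_snd_ne_zero (⟨x, 0⟩ : TangentBundle (𝓡 2) M) hsrc,
        (chartAt (ModelProd Plane Plane) (⟨x, 0⟩ : TangentBundle (𝓡 2) M)).right_inv
          ((TangentBundle.mem_chart_target_iff (I := 𝓡 2) _ _).2 hz1)]
      have hz2 : ‖z.2‖ = 1 := by simpa using hz.2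
      intro h0
      change z.2 = 0 at h0
      rw [h0, norm_zero] at hz2
      exact zero_ne_one hz2
  refine ⟨?_⟩
  have hcov : (univ : Set (UnitTangentBundle M)) = ⋃ x ∈ t, f x '' S x := by
    refine (eq_univ_of_forall fun q => ?_).symm
    have hq : q.base ∈ ⋃ x ∈ t, K x := by rw [ht]; trivial
    simp only [mem_iUnion] at hq ⊢
    obtain ⟨x, hxt, hqx⟩ := hq
    have hs := hKs x hqx
    have hw : coordOf x q.base q.vec ≠ 0 :=
      (chart_snd_ne_zero (⟨x, 0⟩ : TangentBundle (𝓡 2) M) (q := q.incl) hs).2 q.incl_ne_zero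
    have hn : 0 < ‖coordOf x q.base q.vec‖⁻¹ := by positivity
    refine ⟨x, hxt, (chartAt Plane x q.base,
      ‖coordOf x q.base q.vec‖⁻¹ • coordOf x q.base q.vec), ⟨⟨_, hqx, rfl⟩, ?_⟩, ?_⟩
    · simp [norm_smul, hw]
    · refine normalize_incl p q hn ?_
      have h1 := chart_symm_tangent (⟨x, 0⟩ : TangentBundle (𝓡 2) M)
        (‖coordOf x q.base q.vec‖⁻¹ • coordOf x q.base q.vec) ((chartAt Plane x).map_source hs)
      refine h1.trans ?_
      change (⟨(chartAt Plane x).symm (chartAt Plane x q.base), _⟩ : TangentBundle (𝓡 2) M) = _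
      rw [(chartAt Plane x).left_inv hs]
      rw [vecOf_smul, vecOf_coordOf hs]
      rfl
  rw [hcov]
  exact t.finite_toSet.isCompact_biUnion fun x _ => hfS x

/-! ### Continuity of the canonical frame -/

lemma continuousAt_dcoord {x₁ : M} {ζ : TangentBundle model (UnitTangentBundle M)}
    (h : ζ.1.base ∈ (chartAt Plane x₁).source) :
    ContinuousAt (fun ζ : TangentBundle model (UnitTangentBundle M) => dcoord x₁ ζ.1 ζ.2) ζ := by
  have hopen := isOpen_base_preimage (chartAt Plane x₁).open_source
  have h1 : ContMDiffOn model 𝓘(ℝ, Plane × Plane) ∞ (coord x₁)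
      {q : UnitTangentBundle M | q.base ∈ (chartAt Plane x₁).source} := fun q hq =>
    (contMDiffAt_coord hq).contMDiffWithinAt
  have h2 := h1.continuousOn_tangentMapWithin (by simp) hopen.uniqueMDiffOn
  have h3 : (TotalSpace.proj ⁻¹' {q : UnitTangentBundle M | q.base ∈ (chartAt Plane x₁).source} :
      Set (TangentBundle model (UnitTangentBundle M))) ∈ 𝓝 ζ :=
    (hopen.preimage (FiberBundle.continuous_proj (Plane × ℝ) _)).mem_nhds h
  have h4 := (contMDiff_snd_tangentBundle_modelSpace (𝕜 := ℝ) (n := 0) (Plane × Plane)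
    𝓘(ℝ, Plane × Plane)).continuous.continuousAt.comp (h2.continuousAt h3)
  refine h4.congr ?_
  filter_upwards [h3] with ξ hξ
  simp only [Function.comp, tangentMapWithin, dcoord]
  rw [mfderivWithin_of_isOpen hopen hξ]

variable {o : SurfaceOrientation M} {lam p : UnitTangentBundle M → ℝ}

/-- The coframe `(ω₁, ω₂, ψ - λω₁ - pω₂)` is continuous on `T SM`. -/
lemma continuous_frameCoords (o : SurfaceOrientation M) (hlam : Continuous lam)
    (hp : Continuous p) :
    Continuous (fun ζ : TangentBundle model (UnitTangentBundle M) =>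
      frameCoords o lam p ζ.1 ζ.2) := by
  have hproj : Continuous (fun ζ : TangentBundle model (UnitTangentBundle M) => ζ.1) :=
    FiberBundle.continuous_proj (Plane × ℝ) _
  have key : ∀ ζ₀ : TangentBundle model (UnitTangentBundle M),
      ContinuousAt (fun ζ : TangentBundle model (UnitTangentBundle M) => omega1 ζ.1 ζ.2) ζ₀ ∧
      ContinuousAt (fun ζ : TangentBundle model (UnitTangentBundle M) => omega2 o ζ.1 ζ.2) ζ₀ ∧
      ContinuousAt (fun ζ : TangentBundle model (UnitTangentBundle M) => psi o ζ.1 ζ.2) ζ₀ := by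
    intro ζ₀
    set x₁ := ζ₀.1.base with hx₁
    have hs : ζ₀.1.base ∈ (chartAt Plane x₁).source := mem_chart_source _ _
    have ho : ζ₀.1.base ∈ orientDomain o x₁ := mem_orientDomain o x₁
    have hmem : (coord x₁ ζ₀.1).1 ∈ coordDomain o x₁ := chart_mem_coordDomain ho
    have hLC := isLeviCivita o x₁
    have hnear : ∀ᶠ ζ : TangentBundle model (UnitTangentBundle M) in 𝓝 ζ₀,
        ζ.1.base ∈ orientDomain o x₁ :=
      ((isOpen_base_preimage (isOpen_orientDomain o x₁)).preimage hproj).mem_nhds ho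
    have hc : ContinuousAt (fun ζ : TangentBundle model (UnitTangentBundle M) =>
        coord x₁ ζ.1) ζ₀ :=
      (contMDiffAt_coord hs).continuousAt.comp hproj.continuousAt
    have hd := continuousAt_dcoord (x₁ := x₁) hs
    have hg := (hLC.contDiffAt_g hmem).continuousAt.comp
      (f := fun ζ : TangentBundle model (UnitTangentBundle M) => (coord x₁ ζ.1).1) hc.fst
    have hΓ := (hLC.contDiffAt_Γ hmem).continuousAt.comp
      (f := fun ζ : TangentBundle model (UnitTangentBundle M) => (coord x₁ ζ.1).1) hc.fst
    have hA := (hLC.contDiffAt_A hmem).continuousAt.comp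
      (f := fun ζ : TangentBundle model (UnitTangentBundle M) => (coord x₁ ζ.1).1) hc.fst
    have hw : Continuous (fun z : Plane × Plane => wedge z.1 z.2) := by
      unfold wedge; fun_prop
    refine ⟨?_, ?_, ?_⟩
    · refine ((hg.clm_apply hd.fst).clm_apply hc.snd).congr ?_
      filter_upwards [hnear] with ζ hζ
      exact (omega1_eq (orientDomain_subset o x₁ hζ) ζ.2).symm
    · refine (hA.mul (hw.continuousAt.comp (hc.snd.prodMk hd.fst))).congr ?_
      filter_upwards [hnear] with ζ hζ
      exact (omega2_eq (orientDomain_subset o x₁ hζ) ζ.2).symm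
    · refine (hA.mul (hw.continuousAt.comp (hc.snd.prodMk
        (hd.snd.add ((hΓ.clm_apply hd.fst).clm_apply hc.snd))))).congr ?_
      filter_upwards [hnear] with ζ hζ
      exact (psi_eq hζ ζ.2).symm
  have h1 := continuous_iff_continuousAt.2 fun ζ => (key ζ).1
  have h2 := continuous_iff_continuousAt.2 fun ζ => (key ζ).2.1
  have h3 := continuous_iff_continuousAt.2 fun ζ => (key ζ).2.2
  exact h1.prodMk (h2.prodMk ((h3.sub ((hlam.comp hproj).mul h1)).sub ((hp.comp hproj).mul h2)))

instance t2Space_tangentSpace (q : UnitTangentBundle M) : T2Space (TangentSpace model q) :=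
  inferInstanceAs (T2Space (Plane × ℝ))

/-- Vector fields with continuous components in the frame are continuous: in a trivialization the
coframe is a continuous family of invertible maps, and inversion is continuous. -/
lemma continuous_frame_section (o : SurfaceOrientation M) (hlam : Continuous lam)
    (hp : Continuous p) {w : UnitTangentBundle M → ℝ × ℝ × ℝ} (hw : Continuous w) :
    Continuous (fun q : UnitTangentBundle M =>
      (⟨q, (frameEquiv o lam p q).symm (w q)⟩ : TangentBundle model (UnitTangentBundle M))) := by
  rw [continuous_iff_continuousAt]
  intro q₀
  rw [FiberBundle.continuousAt_totalSpace]
  refine ⟨continuousAt_id, ?_⟩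
  set e := trivializationAt (Plane × ℝ) (TangentSpace model) q₀ with he
  have hbase : e.baseSet ∈ 𝓝 q₀ :=
    e.open_baseSet.mem_nhds (FiberBundle.mem_baseSet_trivializationAt' q₀)
  obtain ⟨B, hB⟩ : ∃ B : UnitTangentBundle M → (Plane × ℝ) →L[ℝ] (ℝ × ℝ × ℝ),
      ∀ q a, B q a = frameEquiv o lam p q (e.symmL ℝ q a) :=
    ⟨fun q => ((frameEquiv o lam p q).toContinuousLinearEquiv :
      TangentSpace model q →L[ℝ] ℝ × ℝ × ℝ).comp (e.symmL ℝ q), fun q a => rfl⟩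
  have hBinv : ∀ q ∈ e.baseSet, ∃ L : (Plane × ℝ) ≃L[ℝ] (ℝ × ℝ × ℝ), (L : _ →L[ℝ] _) = B q := by
    intro q hq
    refine ⟨(e.continuousLinearEquivAt ℝ q hq).symm.trans
      (frameEquiv o lam p q).toContinuousLinearEquiv, ContinuousLinearMap.ext fun a => ?_⟩
    rw [hB]
    exact congrArg (frameEquiv o lam p q)
      (congrFun (e.symm_continuousLinearEquivAt_eq hq) a)
  have hBcont : ContinuousAt B q₀ := by
    rw [continuousAt_clm_apply]
    intro a
    have h1 : ContinuousAt (fun q => (⟨q, e.symm q a⟩ :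
        TangentBundle model (UnitTangentBundle M))) q₀ := by
      have h2 := e.continuousOn_symm.continuousAt (x := (q₀, a))
        ((e.open_baseSet.prod isOpen_univ).mem_nhds
          ⟨FiberBundle.mem_baseSet_trivializationAt' q₀, trivial⟩)
      exact h2.comp (f := fun q => (q, a)) (by fun_prop)
    refine ((continuous_frameCoords o hlam hp).continuousAt.comp h1).congr ?_
    filter_upwards [hbase] with q hq
    rw [hB, Trivialization.symmL_apply e hq a, frameEquiv_apply]
    rfl
  obtain ⟨L₀, hL₀⟩ := hBinv q₀ (FiberBundle.mem_baseSet_trivializationAt' q₀)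
  have hinv : ContinuousAt (fun q => (B q).inverse (w q)) q₀ := by
    have h1 : ContinuousAt ContinuousLinearMap.inverse (B q₀) := by
      rw [← hL₀]
      exact (contDiffAt_map_inverse (𝕜 := ℝ) (n := 0) L₀).continuousAt
    exact (h1.comp hBcont).clm_apply hw.continuousAt
  refine hinv.congr ?_
  filter_upwards [hbase] with q hq
  obtain ⟨L, hL⟩ := hBinv q hq
  have h2 : B q (e ⟨q, (frameEquiv o lam p q).symm (w q)⟩).2 = w q := by
    have h3 := e.symmL_continuousLinearMapAt (R := ℝ) hq ((frameEquiv o lam p q).symm (w q))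
    rw [Trivialization.continuousLinearMapAt_apply,
      Trivialization.linearMapAt_def_of_mem _ hq] at h3
    rw [hB, ← LinearEquiv.eq_symm_apply]
    exact h3
  rw [← hL, ContinuousLinearMap.inverse_equiv]
  refine (L.symm_apply_eq).2 ?_
  exact h2.symm.trans (DFunLike.congr_fun hL.symm _)

end UnitTangentBundle

/-! ### The flow and its derivative cocycle -/

namespace UnitTangentBundle
open PlaneMetric SurfaceChart

variable {M : Type*} [TopologicalSpace M] [ChartedSpace Plane M] [IsManifold (𝓡 2) ∞ M]
  [RiemannianBundle (fun x : M => TangentSpace (𝓡 2) x)]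
  [IsContMDiffRiemannianBundle (𝓡 2) ∞ Plane (fun x : M => TangentSpace (𝓡 2) x)]

section Flow

variable {F : ∀ q : UnitTangentBundle M, TangentSpace model q}
  {φ : ℝ → UnitTangentBundle M → UnitTangentBundle M}

namespace IsFlow

lemma contMDiff_time (hφ : IsFlow F φ) (t : ℝ) : ContMDiff model model ∞ (φ t) :=
  hφ.smooth.comp (contMDiff_const.prodMk contMDiff_id)

lemma mdifferentiable_time (hφ : IsFlow F φ) (t : ℝ) : MDifferentiable model model (φ t) :=
  (hφ.contMDiff_time t).mdifferentiable (by simp)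

lemma continuous (hφ : IsFlow F φ) (t : ℝ) : Continuous (φ t) := (hφ.contMDiff_time t).continuous

lemma continuous_orbit (hφ : IsFlow F φ) (q : UnitTangentBundle M) : Continuous (fun t => φ t q) :=
  hφ.smooth.continuous.comp (continuous_id.prodMk continuous_const : Continuous fun t : ℝ => (t, q))

/-- The generator of a smooth flow is smooth. -/
lemma contMDiff_generator (hφ : IsFlow F φ) :
    ContMDiff model model.tangent ∞ (fun q => (⟨q, F q⟩ : TangentBundle model _)) := by
  have h1 : ContMDiff (𝓘(ℝ, ℝ).prod model).tangent model.tangent ∞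
      (tangentMap (𝓘(ℝ, ℝ).prod model) model
        (fun z : ℝ × UnitTangentBundle M => φ z.1 z.2)) :=
    hφ.smooth.contMDiff_tangentMap (by simp)
  have hz : ContMDiff model model.tangent ∞
      (fun q => (⟨q, 0⟩ : TangentBundle model (UnitTangentBundle M))) :=
    Bundle.contMDiff_zeroSection ℝ (TangentSpace model (M := UnitTangentBundle M))
  have hc : ContMDiff model 𝓘(ℝ, ℝ).tangent ∞
      (fun _ : UnitTangentBundle M => (⟨0, (1 : ℝ)⟩ : TangentBundle 𝓘(ℝ, ℝ) ℝ)) :=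
    contMDiff_const
  have h2 := (contMDiff_equivTangentBundleProd_symm (I := 𝓘(ℝ, ℝ)) (M := ℝ) (I' := model)
    (M' := UnitTangentBundle M) (n := ∞)).comp (hc.prodMk hz)
  have h3 := h1.comp h2
  refine h3.congr fun q => ?_
  have hd : MDifferentiableAt (𝓘(ℝ, ℝ).prod model) model
      (fun z : ℝ × UnitTangentBundle M => φ z.1 z.2) ((0 : ℝ), q) :=
    hφ.smooth.mdifferentiable (by simp) _
  have hl : HasMFDerivAt 𝓘(ℝ, ℝ) (𝓘(ℝ, ℝ).prod model)
      (fun t : ℝ => (t, q)) (0 : ℝ)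
      ((ContinuousLinearMap.id ℝ ℝ).prod (0 : ℝ →L[ℝ] TangentSpace model q)) :=
    (hasMFDerivAt_id (0 : ℝ)).prodMk (hasMFDerivAt_const q (0 : ℝ))
  have hcomp := HasMFDerivAt.comp (0 : ℝ) hd.hasMFDerivAt hl
  have huniq := DFunLike.congr_fun (hasMFDerivAt_unique hcomp (hφ.integralCurve q 0)) (1 : ℝ)
  have hval : (⟨φ 0 q, F (φ 0 q)⟩ : TangentBundle model (UnitTangentBundle M)) = ⟨q, F q⟩ := by
    rw [hφ.zero q]
  refine hval.symm.trans ?_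
  refine congrArg (fun v => (⟨φ 0 q, v⟩ : TangentBundle model (UnitTangentBundle M))) ?_
  refine Eq.trans ?_ huniq.symm
  exact (one_smul ℝ (F (φ 0 q))).symm

variable [T2Space M]

lemma add (hφ : IsFlow F φ) (s t : ℝ) : φ (s + t) = φ s ∘ φ t := by
  funext q
  have h1 : IsMIntegralCurve (I := model) (fun s => φ (s + t) q) F :=
    (hφ.integralCurve q).comp_add t
  have h2 := hφ.integralCurve (φ t q)
  have h := isMIntegralCurve_Ioo_eq_of_contMDiff_boundaryless (t₀ := 0)
    (hφ.contMDiff_generator.of_le (by simp)) h1 h2 (by simp [hφ.zero])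
  exact congrFun h s

lemma neg_apply (hφ : IsFlow F φ) (t : ℝ) (q : UnitTangentBundle M) : φ (-t) (φ t q) = q := by
  have h := congrFun (hφ.add (-t) t) q
  rw [neg_add_cancel, hφ.zero] at h
  exact h.symm

/-- A flow preserves its generator. -/
lemma mfderiv_generator (hφ : IsFlow F φ) (t : ℝ) (q : UnitTangentBundle M) :
    mfderiv model model (φ t) q (F q) = F (φ t q) := by
  have h0 : φ 0 q = q := hφ.zero q
  have hd : MDifferentiableAt model model (φ t) (φ 0 q) := hφ.mdifferentiable_time t _
  have h1 := HasMFDerivAt.comp (0 : ℝ) hd.hasMFDerivAt (hφ.integralCurve q 0)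
  have h2 : (φ t) ∘ (fun s => φ s q) = fun s => φ s (φ t q) := by
    funext s
    have h3 := congrFun (hφ.add t s) q
    have h4 := congrFun (hφ.add s t) q
    rw [add_comm] at h3
    exact h3.symm.trans h4
  rw [h2] at h1
  have h5 := DFunLike.congr_fun (hasMFDerivAt_unique h1 (hφ.integralCurve (φ t q) 0)) (1 : ℝ)
  have h6 : mfderiv model model (φ t) (φ 0 q) (F (φ 0 q)) = F (φ 0 (φ t q)) := by
    refine Eq.trans ?_ (h5.trans (one_smul ℝ (F (φ 0 (φ t q)))))
    exact congrArg (mfderiv model model (φ t) (φ 0 q)) (one_smul ℝ (F (φ 0 q))).symm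
  have h7 : ∀ q' q'', q' = q → q'' = φ t q →
      (mfderiv model model (φ t) q' (F q') : Plane × ℝ) = (F q'' : Plane × ℝ) →
      (mfderiv model model (φ t) q (F q) : Plane × ℝ) = (F (φ t q) : Plane × ℝ) := by
    rintro _ _ rfl rfl h; exact h
  exact h7 _ _ h0 (hφ.zero (φ t q)) h6

end IsFlow

end Flow

section Cocycle

variable (o : SurfaceOrientation M) (lam p : UnitTangentBundle M → ℝ)

/-- The derivative of a self-map of `SM` in the frame `(X + λV, H + pV, V)`. -/
noncomputable def frameDeriv (f : UnitTangentBundle M → UnitTangentBundle M)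
    (q : UnitTangentBundle M) : (ℝ × ℝ × ℝ) →ₗ[ℝ] (ℝ × ℝ × ℝ) :=
  (frameCoords o lam p (f q)).comp ((mfderiv model model f q).toLinearMap.comp
    (frameEquiv o lam p q).symm.toLinearMap)

variable {o lam p}

lemma frameDeriv_frameCoords (f : UnitTangentBundle M → UnitTangentBundle M)
    (q : UnitTangentBundle M) (ξ : TangentSpace model q) :
    frameDeriv o lam p f q (frameCoords o lam p q ξ) =
      frameCoords o lam p (f q) (mfderiv model model f q ξ) := by
  change frameCoords o lam p (f q) (mfderiv model model f q
    ((frameEquiv o lam p q).symm (frameEquiv o lam p q ξ))) = _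
  rw [LinearEquiv.symm_apply_apply]

lemma frameDeriv_apply (f : UnitTangentBundle M → UnitTangentBundle M)
    (q : UnitTangentBundle M) (w : ℝ × ℝ × ℝ) :
    frameDeriv o lam p f q w = frameCoords o lam p (f q)
      (mfderiv model model f q ((frameEquiv o lam p q).symm w)) := rfl

lemma frameDeriv_comp {f g : UnitTangentBundle M → UnitTangentBundle M}
    (hf : MDifferentiable model model f) (hg : MDifferentiable model model g)
    (q : UnitTangentBundle M) (w : ℝ × ℝ × ℝ) :
    frameDeriv o lam p (f ∘ g) q w = frameDeriv o lam p f (g q) (frameDeriv o lam p g q w) := by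
  rw [frameDeriv_apply g, frameDeriv_frameCoords, frameDeriv_apply]
  have h := DFunLike.congr_fun (mfderiv_comp q (hf (g q)) (hg q)) ((frameEquiv o lam p q).symm w)
  exact congrArg (frameCoords o lam p (f (g q))) h

lemma frameDeriv_id (q : UnitTangentBundle M) (w : ℝ × ℝ × ℝ) :
    frameDeriv o lam p id q w = w := by
  rw [frameDeriv_apply, mfderiv_id]
  exact (frameEquiv o lam p q).apply_symm_apply w

lemma frameCoords_thermostat (q : UnitTangentBundle M) :
    frameCoords o lam p q (thermostat o lam q) = (1, 0, 0) := by
  obtain ⟨h1, h2, h3⟩ := coframe_vfX o q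
  obtain ⟨k1, k2, k3⟩ := coframe_vfV o q
  simp [frameCoords_apply, thermostat, omega1_add, omega1_smul, omega2_add, omega2_smul, psi_add,
    psi_smul, h1, h2, h3, k1, k2, k3]

lemma frameCoords_vfH (q : UnitTangentBundle M) :
    frameCoords o lam p q (vfH o q) = (0, 1, -p q) := by
  obtain ⟨h1, h2, h3⟩ := coframe_vfH o q
  simp [frameCoords_apply, h1, h2, h3]

lemma frameCoords_vfV (q : UnitTangentBundle M) :
    frameCoords o lam p q (vfV o q) = (0, 0, 1) := by
  obtain ⟨h1, h2, h3⟩ := coframe_vfV o q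
  simp [frameCoords_apply, h1, h2, h3]

/-- Every tangent vector is a combination of the frame. -/
lemma eq_frame_combination (q : UnitTangentBundle M) (ξ : TangentSpace model q) :
    ξ = (frameCoords o lam p q ξ).1 • thermostat o lam q
      + (frameCoords o lam p q ξ).2.1 • vfH o q
      + ((frameCoords o lam p q ξ).2.2 + p q * (frameCoords o lam p q ξ).2.1) • vfV o q := by
  apply frameCoords_injective o lam p q
  rw [map_add, map_add, map_smul, map_smul, map_smul, frameCoords_thermostat, frameCoords_vfH,
    frameCoords_vfV]
  refine Prod.ext ?_ (Prod.ext ?_ ?_)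
  · simp
  · simp
  · simp; ring

/-- The components of the derivative of a `C¹` map in the frame are continuous. -/
lemma continuous_frameDeriv (hlam : Continuous lam) (hp : Continuous p)
    {f : UnitTangentBundle M → UnitTangentBundle M} (hf : ContMDiff model model ∞ f)
    {w : UnitTangentBundle M → ℝ × ℝ × ℝ} (hw : Continuous w) :
    Continuous (fun q => frameDeriv o lam p f q (w q)) := by
  have h1 := continuous_frame_section o hlam hp hw
  have h2 := (hf.contMDiff_tangentMap (m := 0) (by simp)).continuous
  exact (continuous_frameCoords o hlam hp).comp (h2.comp h1)

end Cocycle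

/-- The derivative of a smooth function along a continuous vector field is continuous. -/
lemma continuous_deriv {Y : ∀ q : UnitTangentBundle M, TangentSpace model q}
    {f : UnitTangentBundle M → ℝ}
    (hY : Continuous (fun q => (⟨q, Y q⟩ : TangentBundle model (UnitTangentBundle M))))
    (hf : ContMDiff model 𝓘(ℝ, ℝ) ∞ f) : Continuous (deriv Y f) := by
  have h2 := (hf.contMDiff_tangentMap (m := 0) (by simp)).continuous
  exact (contMDiff_snd_tangentBundle_modelSpace (𝕜 := ℝ) (n := 0) ℝ 𝓘(ℝ, ℝ)).continuous.comp
    (h2.comp hY)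

/-- A vector field with continuous components in the frame is continuous. -/
lemma continuous_of_frameCoords {Y : ∀ q : UnitTangentBundle M, TangentSpace model q}
    {o : SurfaceOrientation M} {lam p : UnitTangentBundle M → ℝ} (hlam : Continuous lam)
    (hp : Continuous p) (hY : Continuous (fun q => frameCoords o lam p q (Y q))) :
    Continuous (fun q => (⟨q, Y q⟩ : TangentBundle model (UnitTangentBundle M))) := by
  refine (continuous_frame_section o hlam hp hY).congr fun q => ?_
  exact congrArg (fun v => (⟨q, v⟩ : TangentBundle model (UnitTangentBundle M)))
    ((frameEquiv o lam p q).symm_apply_apply (Y q))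

end UnitTangentBundle

/-! ### The Jacobi equations of the thermostat flow -/

namespace UnitTangentBundle
open PlaneMetric SurfaceChart

variable {M : Type*} [TopologicalSpace M] [ChartedSpace Plane M] [IsManifold (𝓡 2) ∞ M]
  [RiemannianBundle (fun x : M => TangentSpace (𝓡 2) x)]
  [IsContMDiffRiemannianBundle (𝓡 2) ∞ Plane (fun x : M => TangentSpace (𝓡 2) x)]
  {o : SurfaceOrientation M} {lam p : UnitTangentBundle M → ℝ}

lemma coframe_thermostat (o : SurfaceOrientation M) (lam : UnitTangentBundle M → ℝ)
    (q : UnitTangentBundle M) : omega1 q (thermostat o lam q) = 1 ∧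
      omega2 o q (thermostat o lam q) = 0 ∧ psi o q (thermostat o lam q) = lam q := by
  obtain ⟨h1, h2, h3⟩ := coframe_vfX o q
  obtain ⟨k1, k2, k3⟩ := coframe_vfV o q
  simp [thermostat, omega1_add, omega1_smul, omega2_add, omega2_smul, psi_add, psi_smul, h1, h2,
    h3, k1, k2, k3]

/-- The thermostat is a second order equation: its footpoint velocity is the unit vector. -/
lemma dcoord_thermostat_fst {x₁ : M} {q : UnitTangentBundle M} (h : q.base ∈ orientDomain o x₁) :
    (dcoord x₁ q (thermostat o lam q)).1 = (coord x₁ q).2 := by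
  have hs := orientDomain_subset o x₁ h
  have hmem : (coord x₁ q).1 ∈ coordDomain o x₁ := chart_mem_coordDomain h
  obtain ⟨h1, h2, -⟩ := coframe_thermostat o lam q
  rw [omega1_eq hs] at h1
  rw [omega2_eq hs] at h2
  refine (isLeviCivita o x₁).ext_of_g hmem fun c => ?_
  rw [(isLeviCivita o x₁).inner_eq_area hmem (metricForm_coord hs), h1, h2,
    (isLeviCivita o x₁).symm _ hmem c]
  ring

variable {φ : ℝ → UnitTangentBundle M → UnitTangentBundle M}

/-- The flow in the chart of `SM` at `q`. -/
noncomputable def flowChart (φ : ℝ → UnitTangentBundle M → UnitTangentBundle M)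
    (q : UnitTangentBundle M) (z : ℝ × (Plane × ℝ)) : UnitTangentBundle M :=
  φ z.1 ((extChartAt model q).symm z.2)

section

variable {F : ∀ q : UnitTangentBundle M, TangentSpace model q}

lemma contMDiffAt_flowChart (hφ : IsFlow F φ) {q : UnitTangentBundle M}
    {z : ℝ × (Plane × ℝ)} (hz : z.2 ∈ (extChartAt model q).target) :
    ContMDiffAt 𝓘(ℝ, ℝ × (Plane × ℝ)) model ∞ (flowChart φ q) z := by
  have h1 : ContMDiffAt 𝓘(ℝ, Plane × ℝ) model ∞ (extChartAt model q).symm z.2 :=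
    (contMDiffOn_extChartAt_symm q).contMDiffAt
      ((isOpen_extChartAt_target q).mem_nhds hz)
  have h2 : ContMDiffAt 𝓘(ℝ, ℝ × (Plane × ℝ)) 𝓘(ℝ, Plane × ℝ) ∞
      (fun z : ℝ × (Plane × ℝ) => z.2) z := contDiffAt_snd.contMDiffAt
  have h3 : ContMDiffAt 𝓘(ℝ, ℝ × (Plane × ℝ)) 𝓘(ℝ, ℝ) ∞
      (fun z : ℝ × (Plane × ℝ) => z.1) z := contDiffAt_fst.contMDiffAt
  exact hφ.smooth.contMDiffAt.comp z (h3.prodMk (h1.comp z h2))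

/-- The spatial derivative of a function along the flow, in the chart at `q`. -/
lemma fderiv_flowChart_snd {E : Type*} [NormedAddCommGroup E] [NormedSpace ℝ E]
    (hφ : IsFlow F φ) (q : UnitTangentBundle M)
    (t : ℝ) {f : UnitTangentBundle M → E} (hf : ContMDiffAt model 𝓘(ℝ, E) ∞ f (φ t q))
    (ξ : TangentSpace model q) :
    fderiv ℝ (f ∘ flowChart φ q) (t, extChartAt model q q) (0, (ξ : Plane × ℝ)) =
      mfderiv model 𝓘(ℝ, E) f (φ t q) (mfderiv model model (φ t) q ξ) := by
  have hfd : MDifferentiableAt model 𝓘(ℝ, E) f (φ t q) := hf.mdifferentiableAt (by simp)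
  have hcomp := HasMFDerivAt.comp q hfd.hasMFDerivAt (hφ.mdifferentiable_time t q).hasMFDerivAt
  have h1 := DFunLike.congr_fun hcomp.mfderiv ξ
  refine Eq.trans ?_ h1
  refine Eq.trans ?_ (DFunLike.congr_fun hcomp.mdifferentiableAt.mfderiv ξ).symm
  have hleft : (extChartAt model q).symm (extChartAt model q q) = q :=
    extChartAt_to_inv q
  have hsm : ContMDiffAt 𝓘(ℝ, ℝ × (Plane × ℝ)) 𝓘(ℝ, E) ∞ (f ∘ flowChart φ q)
      (t, extChartAt model q q) := by
    refine ContMDiffAt.comp _ ?_ (contMDiffAt_flowChart hφ (mem_extChartAt_target q))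
    unfold flowChart
    rwa [hleft]
  have hd := ((contMDiffAt_iff_contDiffAt.1 hsm).differentiableAt (by simp)).hasFDerivAt
  have hcd := hd.comp (extChartAt model q q)
    ((hasFDerivAt_const t (extChartAt model q q)).prodMk (hasFDerivAt_id (extChartAt model q q)))
  rw [ModelWithCorners.Boundaryless.range_eq_univ, fderivWithin_univ]
  refine Eq.trans ?_ (DFunLike.congr_fun hcd.fderiv ξ).symm
  rfl

/-- The time derivative of a function along the flow, in the chart at `q`. -/
lemma fderiv_flowChart_fst {E : Type*} [NormedAddCommGroup E] [NormedSpace ℝ E]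
    (hφ : IsFlow F φ) {q : UnitTangentBundle M} {z : ℝ × (Plane × ℝ)}
    (hz : z.2 ∈ (extChartAt model q).target) {f : UnitTangentBundle M → E}
    (hf : ContMDiffAt model 𝓘(ℝ, E) ∞ f (flowChart φ q z)) :
    fderiv ℝ (f ∘ flowChart φ q) z (1, 0) =
      mfderiv model 𝓘(ℝ, E) f (flowChart φ q z) (F (flowChart φ q z)) := by
  have hfd : MDifferentiableAt model 𝓘(ℝ, E) f (flowChart φ q z) := hf.mdifferentiableAt (by simp)
  have hsm : ContMDiffAt 𝓘(ℝ, ℝ × (Plane × ℝ)) 𝓘(ℝ, E) ∞ (f ∘ flowChart φ q) z :=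
    ContMDiffAt.comp _ hf (contMDiffAt_flowChart hφ hz)
  have hd := ((contMDiffAt_iff_contDiffAt.1 hsm).differentiableAt (by simp)).hasFDerivAt
  have hcd := HasFDerivAt.comp (f := fun s : ℝ => (s, z.2)) z.1 hd
    ((hasFDerivAt_id z.1).prodMk (hasFDerivAt_const z.2 z.1))
  have hcm := HasMFDerivAt.comp z.1 hfd.hasMFDerivAt
    (hφ.integralCurve ((extChartAt model q).symm z.2) z.1)
  have huniq := DFunLike.congr_fun (hasMFDerivAt_unique hcd.hasMFDerivAt hcm) (1 : ℝ)
  refine huniq.trans ?_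
  exact congrArg (mfderiv model 𝓘(ℝ, E) f (flowChart φ q z)) (one_smul ℝ (F (flowChart φ q z)))

end

/-- The differential of a function on `SM`, as a linear form. -/
noncomputable def differential (f : UnitTangentBundle M → ℝ) (q : UnitTangentBundle M) :
    TangentSpace model q →ₗ[ℝ] ℝ :=
  (mfderiv model 𝓘(ℝ, ℝ) f q).toLinearMap

/-- The Jacobi equations: the evolution of `ω₁, ω₂, ψ` along the derivative of the flow. The Gauss
curvature is computed in an arbitrary chart. -/
lemma hasDerivAt_coframe (hlam : ContMDiff model 𝓘(ℝ, ℝ) ∞ lam)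
    (hφ : IsFlow (thermostat o lam) φ) (q : UnitTangentBundle M) (ξ : TangentSpace model q) (t : ℝ)
    {x₁ : M} (hx₁ : (φ t q).base ∈ orientDomain o x₁) :
    HasDerivAt (fun s => omega1 (φ s q) (mfderiv model model (φ s) q ξ))
      (lam (φ t q) * omega2 o (φ t q) (mfderiv model model (φ t) q ξ)) t ∧
    HasDerivAt (fun s => omega2 o (φ s q) (mfderiv model model (φ s) q ξ))
      (psi o (φ t q) (mfderiv model model (φ t) q ξ)
        - lam (φ t q) * omega1 (φ t q) (mfderiv model model (φ t) q ξ)) t ∧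
    HasDerivAt (fun s => psi o (φ s q) (mfderiv model model (φ s) q ξ))
      (differential lam (φ t q) (mfderiv model model (φ t) q ξ)
        - gauss (metricForm x₁) (christoffelForm x₁) (coord x₁ (φ t q)).1
          * omega2 o (φ t q) (mfderiv model model (φ t) q ξ)) t := by
  set z₀ : ℝ × (Plane × ℝ) := (t, extChartAt model q q) with hz₀
  have hbaset : (extChartAt model q).symm (extChartAt model q q) = q :=
    extChartAt_to_inv q
  have hfc : ∀ s, flowChart φ q (s, extChartAt model q q) = φ s q := fun s => by
    rw [flowChart, hbaset]
  have hz₀t : z₀.2 ∈ (extChartAt model q).target := mem_extChartAt_target q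
  have hcont : ContinuousAt (fun z => (flowChart φ q z).base) z₀ :=
    continuous_base.continuousAt.comp (contMDiffAt_flowChart hφ hz₀t).continuousAt
  have hbase₀ : (flowChart φ q z₀).base ∈ orientDomain o x₁ := by
    rw [hfc]; exact hx₁
  have hnear : ∀ᶠ z in 𝓝 z₀, z.2 ∈ (extChartAt model q).target ∧
      (flowChart φ q z).base ∈ orientDomain o x₁ :=
    Filter.Eventually.and
      (continuous_snd.continuousAt ((isOpen_extChartAt_target q).mem_nhds hz₀t))
      (hcont ((isOpen_orientDomain o x₁).mem_nhds hbase₀))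
  set c : ℝ × (Plane × ℝ) → Plane × Plane := coord x₁ ∘ flowChart φ q with hc
  set x : ℝ × (Plane × ℝ) → Plane := fun z => (c z).1 with hx
  set v : ℝ × (Plane × ℝ) → Plane := fun z => (c z).2 with hv
  have hcs : ∀ z, z.2 ∈ (extChartAt model q).target ∧
      (flowChart φ q z).base ∈ orientDomain o x₁ → ContDiffAt ℝ ∞ c z := fun z hz =>
    contMDiffAt_iff_contDiffAt.1 (ContMDiffAt.comp z
      (contMDiffAt_coord (orientDomain_subset o x₁ hz.2)) (contMDiffAt_flowChart hφ hz.1))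
  have hxs : ∀ z, z.2 ∈ (extChartAt model q).target ∧
      (flowChart φ q z).base ∈ orientDomain o x₁ → ∀ d,
        fderiv ℝ x z d = (fderiv ℝ c z d).1 ∧ fderiv ℝ v z d = (fderiv ℝ c z d).2 := by
    intro z hz d
    have hd := ((hcs z hz).differentiableAt (by simp)).hasFDerivAt
    have h1 : HasFDerivAt x _ z := hd.fst
    have h2 : HasFDerivAt v _ z := hd.snd
    rw [h1.fderiv, h2.fderiv]
    exact ⟨rfl, rfl⟩
  have hderT : ∀ z, z.2 ∈ (extChartAt model q).target ∧
      (flowChart φ q z).base ∈ orientDomain o x₁ →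
        fderiv ℝ c z (1, 0) = dcoord x₁ (flowChart φ q z) (thermostat o lam (flowChart φ q z)) :=
    fun z hz => fderiv_flowChart_fst hφ hz.1 (contMDiffAt_coord (orientDomain_subset o x₁ hz.2))
  have hderS : ∀ s, (φ s q).base ∈ orientDomain o x₁ →
      fderiv ℝ c (s, extChartAt model q q) (0, (ξ : Plane × ℝ)) =
        dcoord x₁ (φ s q) (mfderiv model model (φ s) q ξ) := fun s hs =>
    fderiv_flowChart_snd hφ q s (contMDiffAt_coord (orientDomain_subset o x₁ hs)) ξ
  have hvel : ∀ᶠ z in 𝓝 z₀, fderiv ℝ x z (1, 0) = v z := by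
    filter_upwards [hnear] with z hz
    rw [(hxs z hz _).1, hderT z hz]
    exact dcoord_thermostat_fst hz.2
  have hunit : ∀ᶠ z in 𝓝 z₀, metricForm x₁ (x z) (v z) (v z) = 1 := by
    filter_upwards [hnear] with z hz
    exact metricForm_coord (orientDomain_subset o x₁ hz.2)
  have hL : ∀ᶠ z in 𝓝 z₀, areaDensity o x₁ (x z) *
      wedge (v z) (cov (christoffelForm x₁) x v (1, 0) z) = (lam ∘ flowChart φ q) z := by
    filter_upwards [hnear] with z hz
    obtain ⟨-, -, h3⟩ := coframe_thermostat o lam (flowChart φ q z)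
    rw [psi_eq hz.2, ← hderT z hz] at h3
    rw [cov, (hxs z hz _).1, (hxs z hz _).2]
    exact h3
  have hmem : x z₀ ∈ coordDomain o x₁ := by
    exact chart_mem_coordDomain hbase₀
  obtain ⟨⟨L₁, hL₁, hL₁'⟩, ⟨L₂, hL₂, hL₂'⟩, ⟨L₃, hL₃, hL₃'⟩⟩ :=
    (isLeviCivita o x₁).jacobi (d := ((1 : ℝ), (0 : Plane × ℝ))) hmem (hcs z₀ ⟨hz₀t, hbase₀⟩).fst
      (hcs z₀ ⟨hz₀t, hbase₀⟩).snd hvel hunit hL ((0 : ℝ), (ξ : Plane × ℝ))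
  have hline : HasDerivAt (fun s : ℝ => (s, extChartAt model q q)) ((1 : ℝ), (0 : Plane × ℝ)) t :=
    (hasDerivAt_id t).prodMk (hasDerivAt_const t _)
  have hneart : ∀ᶠ s in 𝓝 t, (φ s q).base ∈ orientDomain o x₁ :=
    (continuous_base.comp (hφ.continuous_orbit q)).continuousAt
      ((isOpen_orientDomain o x₁).mem_nhds hx₁)
  have hval : ∀ s, (φ s q).base ∈ orientDomain o x₁ →
      omega1 (φ s q) (mfderiv model model (φ s) q ξ) =
        metricForm x₁ (x (s, extChartAt model q q))
          (fderiv ℝ x (s, extChartAt model q q) ((0 : ℝ), (ξ : Plane × ℝ)))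
          (v (s, extChartAt model q q)) ∧
      omega2 o (φ s q) (mfderiv model model (φ s) q ξ) =
        areaDensity o x₁ (x (s, extChartAt model q q)) * wedge (v (s, extChartAt model q q))
          (fderiv ℝ x (s, extChartAt model q q) ((0 : ℝ), (ξ : Plane × ℝ))) ∧
      psi o (φ s q) (mfderiv model model (φ s) q ξ) =
        areaDensity o x₁ (x (s, extChartAt model q q)) * wedge (v (s, extChartAt model q q))
          (cov (christoffelForm x₁) x v ((0 : ℝ), (ξ : Plane × ℝ)) (s, extChartAt model q q)) := by
    intro s hs
    have hcv : c (s, extChartAt model q q) = coord x₁ (φ s q) := congrArg (coord x₁) (hfc s)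
    have hz : (s, extChartAt model q q).2 ∈ (extChartAt model q).target ∧
      (flowChart φ q (s, extChartAt model q q)).base ∈ orientDomain o x₁ :=
      ⟨hz₀t, by rw [hfc]; exact hs⟩
    have h1 := orientDomain_subset o x₁ hs
    rw [cov, (hxs _ hz _).1, (hxs _ hz _).2, hderS s hs, omega1_eq h1, omega2_eq h1, psi_eq hs]
    simp only [hx, hv, hcv]
    exact ⟨trivial, trivial, trivial⟩
  obtain ⟨hv1, hv2, hv3⟩ := hval t hx₁
  have hlam0 : (lam ∘ flowChart φ q) z₀ = lam (φ t q) := congrArg lam (hfc t)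
  have hdl : fderiv ℝ (lam ∘ flowChart φ q) z₀ ((0 : ℝ), (ξ : Plane × ℝ)) =
      differential lam (φ t q) (mfderiv model model (φ t) q ξ) :=
    fderiv_flowChart_snd hφ q t (hlam (φ t q)) ξ
  have hK : x z₀ = (coord x₁ (φ t q)).1 := congrArg (fun q' => (coord x₁ q').1) (hfc t)
  refine ⟨?_, ?_, ?_⟩
  · have h := (hL₁.comp_hasDerivAt t hline)
    rw [hL₁', hlam0, ← hv2] at h
    refine h.congr_of_eventuallyEq ?_
    filter_upwards [hneart] with s hs
    exact (hval s hs).1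
  · have h := (hL₂.comp_hasDerivAt t hline)
    rw [hL₂', hlam0, ← hv1, ← hv3] at h
    refine h.congr_of_eventuallyEq ?_
    filter_upwards [hneart] with s hs
    exact (hval s hs).2.1
  · have h := (hL₃.comp_hasDerivAt t hline)
    rw [hL₃', hdl, ← hv2, hK] at h
    refine h.congr_of_eventuallyEq ?_
    filter_upwards [hneart] with s hs
    exact (hval s hs).2.2

end UnitTangentBundle

/-! ### The derivative cocycle as a linear differential equation -/

namespace PlaneMetric

lemma IsLeviCivita.continuousAt_gauss {U : Set Plane} {g : Plane → Plane →L[ℝ] Plane →L[ℝ] ℝ}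
    {Γ : Plane → Plane →L[ℝ] Plane →L[ℝ] Plane} {A : Plane → ℝ} (h : IsLeviCivita U g Γ A)
    {u : Plane} (hu : u ∈ U) : ContinuousAt (gauss g Γ) u := by
  have h1 : ContinuousAt g u := (h.contDiffAt_g hu).continuousAt
  have h2 : ContinuousAt Γ u := (h.contDiffAt_Γ hu).continuousAt
  have h3 : ContinuousAt (fderiv ℝ Γ) u :=
    ((h.contDiffAt_Γ hu).fderiv_right (m := ∞) (by simp)).continuousAt
  unfold gauss curv
  refine ContinuousAt.div₀ (by fun_prop) (by fun_prop) ?_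
  rw [← h.area u hu]
  exact pow_ne_zero 2 (h.area_ne_zero hu)

end PlaneMetric

namespace UnitTangentBundle
open PlaneMetric SurfaceChart

variable {M : Type*} [TopologicalSpace M] [ChartedSpace Plane M] [IsManifold (𝓡 2) ∞ M]
  [RiemannianBundle (fun x : M => TangentSpace (𝓡 2) x)]
  [IsContMDiffRiemannianBundle (𝓡 2) ∞ Plane (fun x : M => TangentSpace (𝓡 2) x)]
  {o : SurfaceOrientation M} {lam p : UnitTangentBundle M → ℝ}
  {φ : ℝ → UnitTangentBundle M → UnitTangentBundle M}

/-- The Gauss curvature may be computed in any chart. It is determined by the Jacobi equations,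
which do not depend on the chart. -/
lemma gaussCurvature_eq_gauss (hlam : ContMDiff model 𝓘(ℝ, ℝ) ∞ lam)
    (hφ : IsFlow (thermostat o lam) φ) {q : UnitTangentBundle M} {x₁ : M}
    (hx₁ : q.base ∈ orientDomain o x₁) :
    gaussCurvature q.base = gauss (metricForm x₁) (christoffelForm x₁) (coord x₁ q).1 := by
  have h0 : φ 0 = id := funext hφ.zero
  have h1 := (hasDerivAt_coframe hlam hφ q (vfH o q) 0 (x₁ := x₁)
    (by rw [hφ.zero]; exact hx₁)).2.2
  have h2 := (hasDerivAt_coframe hlam hφ q (vfH o q) 0 (x₁ := q.base)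
    (by rw [hφ.zero]; exact mem_orientDomain o q.base)).2.2
  have h3 := h1.unique h2
  have h4 : omega2 o (φ 0 q) (mfderiv model model (φ 0) q (vfH o q)) = 1 := by
    rw [h0, mfderiv_id]
    exact (coframe_vfH o q).2.1
  rw [h4, mul_one, mul_one, hφ.zero] at h3
  have h5 : (coord q.base q).1 = chartAt Plane q.base q.base := rfl
  rw [gaussCurvature_eq, ← h5]
  linear_combination h3

lemma continuous_gaussCurvature_base (hlam : ContMDiff model 𝓘(ℝ, ℝ) ∞ lam)
    (hφ : IsFlow (thermostat o lam) φ) :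
    Continuous (fun q : UnitTangentBundle M => gaussCurvature q.base) := by
  refine continuous_iff_continuousAt.2 fun q => ?_
  have h1 : ContinuousAt (fun q' : UnitTangentBundle M =>
      gauss (metricForm q.base) (christoffelForm q.base) (coord q.base q').1) q :=
    ContinuousAt.comp (f := fun q' : UnitTangentBundle M => (coord q.base q').1)
      ((isLeviCivita o q.base).continuousAt_gauss
        (chart_mem_coordDomain (mem_orientDomain o q.base)))
      (continuous_fst.continuousAt.comp
        (contMDiffAt_coord (mem_chart_source _ _)).continuousAt)
  refine h1.congr ?_
  filter_upwards [(isOpen_base_preimage (isOpen_orientDomain o q.base)).mem_nhds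
    (mem_orientDomain o q.base)] with q' hq'
  exact (gaussCurvature_eq_gauss hlam hφ hq').symm

/-- The derivative of a function along an orbit of the flow. -/
lemma IsFlow.hasDerivAt {F : ∀ q : UnitTangentBundle M, TangentSpace model q} (hφ : IsFlow F φ)
    {f : UnitTangentBundle M → ℝ} (hf : ContMDiff model 𝓘(ℝ, ℝ) ∞ f) (q : UnitTangentBundle M)
    (t : ℝ) : HasDerivAt (fun s => f (φ s q)) (deriv F f (φ t q)) t := by
  have hfd : MDifferentiableAt model 𝓘(ℝ, ℝ) f (φ t q) := hf.mdifferentiable (by simp) _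
  have hcm := HasMFDerivAt.comp t hfd.hasMFDerivAt (hφ.integralCurve q t)
  have h : HasFDerivAt (fun s => f (φ s q)) (_ : ℝ →L[ℝ] ℝ) t :=
    hasMFDerivAt_iff_hasFDerivAt.1 hcm
  refine (HasFDerivAt.hasDerivAt h).congr_deriv ?_
  exact congrArg (mfderiv model 𝓘(ℝ, ℝ) f (φ t q)) (one_smul ℝ (F (φ t q)))

lemma continuous_vfV (hlam : Continuous lam) (hp : Continuous p) :
    Continuous (fun q => (⟨q, vfV o q⟩ : TangentBundle model (UnitTangentBundle M))) :=
  continuous_of_frameCoords (o := o) hlam hp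
    (by simp only [frameCoords_vfV]; exact continuous_const)

lemma continuous_vfH (hlam : Continuous lam) (hp : Continuous p) :
    Continuous (fun q => (⟨q, vfH o q⟩ : TangentBundle model (UnitTangentBundle M))) :=
  continuous_of_frameCoords (o := o) hlam hp
    (by simp only [frameCoords_vfH]; fun_prop)

lemma continuous_thermostat (hlam : Continuous lam) (hp : Continuous p) :
    Continuous (fun q => (⟨q, thermostat o lam q⟩ : TangentBundle model (UnitTangentBundle M))) :=
  continuous_of_frameCoords (o := o) hlam hp
    (by simp only [frameCoords_thermostat]; exact continuous_const)

lemma continuous_kappaP (hlam : ContMDiff model 𝓘(ℝ, ℝ) ∞ lam)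
    (hp : ContMDiff model 𝓘(ℝ, ℝ) ∞ p) (hφ : IsFlow (thermostat o lam) φ) :
    Continuous (kappaP o lam p) := by
  have h1 := continuous_gaussCurvature_base hlam hφ
  have h2 := continuous_deriv (continuous_vfH (o := o) hlam.continuous hp.continuous) hlam
  have h3 := continuous_deriv (continuous_vfV (o := o) hlam.continuous hp.continuous) hlam
  have h4 := continuous_deriv (continuous_thermostat (o := o) hlam.continuous hp.continuous) hp
  have h5 := hlam.continuous
  have h6 := hp.continuous
  unfold kappaP kappa
  fun_prop

/-- The components `(y, z)` of `dφ_t(ξ)` along `H + pV` and `V` solve a linear differential equation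
in which the curvature enters only through `κ_p`. -/
lemma hasDerivAt_frameDeriv (hlam : ContMDiff model 𝓘(ℝ, ℝ) ∞ lam)
    (hp : ContMDiff model 𝓘(ℝ, ℝ) ∞ p) (hφ : IsFlow (thermostat o lam) φ)
    (q : UnitTangentBundle M) (w : ℝ × ℝ × ℝ) (t : ℝ) :
    HasDerivAt (fun s => (frameDeriv o lam p (φ s) q w).2.1)
      (p (φ t q) * (frameDeriv o lam p (φ t) q w).2.1
        + (frameDeriv o lam p (φ t) q w).2.2) t ∧
    HasDerivAt (fun s => (frameDeriv o lam p (φ s) q w).2.2)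
      (-kappaP o lam p (φ t q) * (frameDeriv o lam p (φ t) q w).2.1
        + (deriv (vfV o) lam (φ t q) - p (φ t q)) * (frameDeriv o lam p (φ t) q w).2.2) t := by
  set ξ := (frameEquiv o lam p q).symm w
  obtain ⟨h1, h2, h3⟩ := hasDerivAt_coframe hlam hφ q ξ t (mem_orientDomain o (φ t q).base)
  rw [← gaussCurvature_eq_gauss hlam hφ (mem_orientDomain o (φ t q).base)] at h3
  have hl := hφ.hasDerivAt hlam q t
  have hpd := hφ.hasDerivAt hp q t
  have hcomb := congrArg (differential lam (φ t q))
    (eq_frame_combination (o := o) (lam := lam) (p := p) (φ t q)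
      (mfderiv model model (φ t) q ξ))
  have hF : differential lam (φ t q) (thermostat o lam (φ t q)) =
    deriv (thermostat o lam) lam (φ t q) := rfl
  have hH : differential lam (φ t q) (vfH o (φ t q)) = deriv (vfH o) lam (φ t q) := rfl
  have hV : differential lam (φ t q) (vfV o (φ t q)) = deriv (vfV o) lam (φ t q) := rfl
  rw [map_add, map_add, map_smul, map_smul, map_smul, hF, hH, hV, frameCoords_apply] at hcomb
  simp only [smul_eq_mul] at hcomb
  simp only [frameDeriv_apply, frameCoords_apply]
  refine ⟨h2.congr_deriv ?_, ((h3.sub (hl.mul h1)).sub (hpd.mul h2)).congr_deriv ?_⟩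
  · ring
  · rw [hcomb, kappaP, kappa]
    ring

end UnitTangentBundle

/-! ### Linear cocycles satisfying a Jacobi equation -/

section ScalarEquations

lemma hasDerivAt_integral_of_continuous {g : ℝ → ℝ} (hg : Continuous g) (t : ℝ) :
    HasDerivAt (fun t => ∫ s in (0 : ℝ)..t, g s) (g t) t :=
  (hg.integral_hasStrictDerivAt 0 t).hasDerivAt

/-- A differential inequality `f' ≥ g f`, integrated. -/
lemma monotone_exp_neg_integral_mul {f f' g : ℝ → ℝ} (hf : ∀ t, HasDerivAt f (f' t) t)
    (hg : Continuous g) (h : ∀ t, g t * f t ≤ f' t) :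
    Monotone fun t => Real.exp (-∫ s in (0 : ℝ)..t, g s) * f t := by
  refine monotone_of_hasDerivAt_nonneg
    (fun t => ((hasDerivAt_integral_of_continuous hg t).neg.exp.mul (hf t))) fun t => ?_
  have h1 := mul_nonneg (Real.exp_pos (-∫ s in (0 : ℝ)..t, g s)).le (sub_nonneg.2 (h t))
  change 0 ≤ Real.exp (-∫ s in (0 : ℝ)..t, g s) * -g t * f t
    + Real.exp (-∫ s in (0 : ℝ)..t, g s) * f' t
  linarith

lemma eq_exp_integral {f g : ℝ → ℝ} (hg : Continuous g)
    (hf : ∀ t, HasDerivAt f (g t * f t) t) (h0 : f 0 = 1) (t : ℝ) :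
    f t = Real.exp (∫ s in (0 : ℝ)..t, g s) := by
  have h1 : ∀ t, HasDerivAt (fun t => Real.exp (-∫ s in (0 : ℝ)..t, g s) * f t) 0 t := fun t =>
    ((hasDerivAt_integral_of_continuous hg t).neg.exp.mul (hf t)).congr_deriv (by ring)
  have h2 := is_const_of_deriv_eq_zero (fun t => (h1 t).differentiableAt)
    (fun t => (h1 t).deriv) t 0
  simp only [intervalIntegral.integral_same, neg_zero, Real.exp_zero, h0, mul_one] at h2
  rw [Real.exp_neg] at h2
  exact (inv_mul_eq_one₀ (Real.exp_pos _).ne').1 h2 |>.symm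

/-- The Riccati vector field `l ↦ e^l - a e^{-l}` is uniformly expanding. -/
lemma mul_sq_le_mul_exp_sub {k a : ℝ} (hk : k ≤ 1) (hk0 : 0 ≤ k) (ha : k ≤ a) (u v : ℝ) :
    k * (u - v) ^ 2 ≤
      (u - v) * ((Real.exp u - a * Real.exp (-u)) - (Real.exp v - a * Real.exp (-v))) := by
  have hd : ∀ x, HasDerivAt (fun x => Real.exp x - a * Real.exp (-x))
      (Real.exp x + a * Real.exp (-x)) x := fun x =>
    ((Real.hasDerivAt_exp x).sub (((hasDerivAt_neg x).exp).const_mul a)).congr_deriv (by ring)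
  have hle : ∀ x, k ≤ _root_.deriv (fun x => Real.exp x - a * Real.exp (-x)) x := by
    intro x
    rw [(hd x).deriv]
    rcases le_total 0 x with hx | hx
    · have h1 := Real.one_le_exp hx
      have h2 := mul_nonneg (hk0.trans ha) (Real.exp_pos (-x)).le
      linarith
    · have h1 := Real.one_le_exp (neg_nonneg.2 hx)
      have h2 := mul_le_mul_of_nonneg_left h1 (hk0.trans ha)
      have h3 := Real.exp_pos x
      linarith
  have hmv := mul_sub_le_image_sub_of_le_deriv (fun x => (hd x).differentiableAt) hle
  rcases le_total u v with h | h
  · have h1 := mul_le_mul_of_nonneg_left (hmv h) (sub_nonneg.2 h)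
    linarith
  · have h1 := mul_le_mul_of_nonneg_left (hmv h) (sub_nonneg.2 h)
    linarith

end ScalarEquations

/-- If one map of a commuting family is a contraction, the family has a common fixed point. -/
lemma ContractingWith.exists_common_fixedPoint {α ι : Type*} [MetricSpace α] [CompleteSpace α]
    [Nonempty α] {K : NNReal} (S : ι → α → α) (i₀ : ι) (hS : ContractingWith K (S i₀))
    (hcomm : ∀ i x, S i (S i₀ x) = S i₀ (S i x)) : ∃ x, ∀ i, S i x = x := by
  refine ⟨ContractingWith.fixedPoint (S i₀) hS, fun i => ?_⟩
  refine hS.fixedPoint_unique ?_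
  have h : S i₀ _ = _ := hS.fixedPoint_isFixedPt
  rw [Function.IsFixedPt, ← hcomm, h]

/-- A cocycle `D` of linear maps of `ℝ³` over a flow `φ`, in components `(x, y, z)`, which fixes
the first basis vector and for which `y' = p₁ y + z` and `z' = a y + p₂ z`. -/
structure JacobiCocycle {X : Type*} [TopologicalSpace X] (φ : ℝ → X → X) (p₁ p₂ a : X → ℝ)
    (D : ℝ → X → (ℝ × ℝ × ℝ) →ₗ[ℝ] (ℝ × ℝ × ℝ)) : Prop where
  flow_zero : ∀ q, φ 0 q = q
  flow_add : ∀ s t q, φ (s + t) q = φ s (φ t q)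
  continuous_flow : ∀ t, Continuous (φ t)
  continuous_orbit : ∀ q, Continuous fun t => φ t q
  continuous_p₁ : Continuous p₁
  continuous_p₂ : Continuous p₂
  continuous_a : Continuous a
  zero : ∀ q w, D 0 q w = w
  add : ∀ s t q w, D (s + t) q w = D s (φ t q) (D t q w)
  generator : ∀ t q, D t q (1, 0, 0) = (1, 0, 0)
  continuous : ∀ t (w : X → ℝ × ℝ × ℝ), Continuous w → Continuous fun q => D t q (w q)
  deriv_y : ∀ q w t, HasDerivAt (fun s => (D s q w).2.1)
    (p₁ (φ t q) * (D t q w).2.1 + (D t q w).2.2) t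
  deriv_z : ∀ q w t, HasDerivAt (fun s => (D s q w).2.2)
    (a (φ t q) * (D t q w).2.1 + p₂ (φ t q) * (D t q w).2.2) t

namespace JacobiCocycle

variable {X : Type*} [TopologicalSpace X] {φ : ℝ → X → X} {p₁ p₂ a : X → ℝ}
  {D : ℝ → X → (ℝ × ℝ × ℝ) →ₗ[ℝ] (ℝ × ℝ × ℝ)}

lemma flow_neg (h : JacobiCocycle φ p₁ p₂ a D) (t : ℝ) (q : X) : φ (-t) (φ t q) = q := by
  rw [← h.flow_add, neg_add_cancel, h.flow_zero]

lemma neg_apply (h : JacobiCocycle φ p₁ p₂ a D) (t : ℝ) (q : X) (w : ℝ × ℝ × ℝ) :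
    D (-t) (φ t q) (D t q w) = w := by
  rw [← h.add, neg_add_cancel, h.zero]

/-- The cocycle acts on the first component by translation. -/
lemma apply_eq (h : JacobiCocycle φ p₁ p₂ a D) (t : ℝ) (q : X) (w : ℝ × ℝ × ℝ) :
    D t q w = (w.1 + (D t q (0, w.2)).1, (D t q (0, w.2)).2) := by
  have h1 : w = w.1 • (1, 0, 0) + (0, w.2) := by ext <;> simp
  conv_lhs => rw [h1]
  rw [map_add, map_smul, h.generator]
  ext <;> simp

/-- Reversing time and the sign of `z` gives another cocycle satisfying a Jacobi equation. -/
lemma reverse (h : JacobiCocycle φ p₁ p₂ a D) :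
    JacobiCocycle (fun t => φ (-t)) (fun q => -p₁ q) (fun q => -p₂ q) a
      (fun t q => (LinearMap.id.prodMap (LinearMap.id.prodMap (-LinearMap.id))).comp
        ((D (-t) q).comp (LinearMap.id.prodMap (LinearMap.id.prodMap (-LinearMap.id))))) where
  flow_zero q := by simp [h.flow_zero]
  flow_add s t q := by rw [neg_add, h.flow_add]
  continuous_flow t := h.continuous_flow (-t)
  continuous_orbit q := (h.continuous_orbit q).comp continuous_neg
  continuous_p₁ := h.continuous_p₁.neg
  continuous_p₂ := h.continuous_p₂.neg
  continuous_a := h.continuous_a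
  zero q w := by simp [h.zero]
  add s t q w := by
    have h1 := h.add (-s) (-t) q (w.1, w.2.1, -w.2.2)
    rw [← neg_add] at h1
    simp [-neg_add_rev, h1]
  generator t q := by simp [h.generator]
  continuous t w hw := by
    have h1 := h.continuous (-t) (fun q => ((w q).1, (w q).2.1, -(w q).2.2)) (by fun_prop)
    simp only [LinearMap.comp_apply, LinearMap.prodMap_apply, LinearMap.id_apply,
      LinearMap.neg_apply]
    exact h1.fst.prodMk (h1.snd.fst.prodMk h1.snd.snd.neg)
  deriv_y q w t := by
    have h1 := (h.deriv_y q (w.1, w.2.1, -w.2.2) (-t)).scomp t (hasDerivAt_neg t)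
    refine h1.congr_deriv ?_
    simp
    ring
  deriv_z q w t := by
    have h1 := ((h.deriv_z q (w.1, w.2.1, -w.2.2) (-t)).scomp t (hasDerivAt_neg t)).neg
    refine h1.congr_deriv ?_
    simp

/-- The cone `yz < 0` is invariant under the cocycle in negative time. -/
lemma mul_neg_of_nonpos (h : JacobiCocycle φ p₁ p₂ a D) (ha : ∀ q, 0 ≤ a q) {q : X}
    {w : ℝ × ℝ × ℝ} (hw : w.2.1 * w.2.2 < 0) {t : ℝ} (ht : t ≤ 0) :
    (D t q w).2.1 * (D t q w).2.2 < 0 := by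
  have hg : Continuous fun s => p₁ (φ s q) + p₂ (φ s q) :=
    (h.continuous_p₁.comp (h.continuous_orbit q)).add (h.continuous_p₂.comp (h.continuous_orbit q))
  have hm := monotone_exp_neg_integral_mul (fun s => (h.deriv_y q w s).mul (h.deriv_z q w s)) hg
    (fun s => by
      have h1 := mul_nonneg (ha (φ s q)) (sq_nonneg (D s q w).2.1)
      have h2 := sq_nonneg (D s q w).2.2
      simp only [Pi.mul_apply]
      linarith) ht
  simp only [intervalIntegral.integral_same, neg_zero, Real.exp_zero, one_mul, Pi.mul_apply,
    h.zero] at hm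
  exact neg_of_mul_neg_right (hm.trans_lt hw) (Real.exp_pos _).le

end JacobiCocycle

/-- The logarithm of the absolute slope `|z / y|` of a vector `(x, y, z)`. -/
noncomputable def logSlope (w : ℝ × ℝ × ℝ) : ℝ := Real.log w.2.2 - Real.log w.2.1

lemma exp_logSlope {w : ℝ × ℝ × ℝ} (hw : w.2.1 * w.2.2 < 0) :
    w.2.2 = -Real.exp (logSlope w) * w.2.1 := by
  have hy : w.2.1 ≠ 0 := left_ne_zero_of_mul hw.ne
  have hz : w.2.2 ≠ 0 := right_ne_zero_of_mul hw.ne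
  rw [logSlope, Real.exp_sub, Real.exp_log_eq_abs hz, Real.exp_log_eq_abs hy]
  rcases mul_neg_iff.1 hw with ⟨h1, h2⟩ | ⟨h1, h2⟩
  · rw [abs_of_neg h2, abs_of_pos h1]; field_simp
  · rw [abs_of_pos h2, abs_of_neg h1]; field_simp

lemma logSlope_exp (x r : ℝ) : logSlope (x, 1, -Real.exp r) = r := by
  simp [logSlope]

/-- The logarithmic slope depends only on the line, modulo the first component. -/
lemma logSlope_smul {w w' : ℝ × ℝ × ℝ} {c : ℝ} (hc : c ≠ 0) (hw : w.2.1 * w.2.2 ≠ 0)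
    (h : w'.2 = c • w.2) : logSlope w' = logSlope w := by
  have hy : w.2.1 ≠ 0 := left_ne_zero_of_mul hw
  have hz : w.2.2 ≠ 0 := right_ne_zero_of_mul hw
  rw [logSlope, logSlope, h, Prod.smul_fst, Prod.smul_snd, smul_eq_mul, smul_eq_mul,
    Real.log_mul hc hy, Real.log_mul hc hz]
  ring

namespace JacobiCocycle

variable {X : Type*} [TopologicalSpace X] {φ : ℝ → X → X} {p₁ p₂ a : X → ℝ}
  {D : ℝ → X → (ℝ × ℝ × ℝ) →ₗ[ℝ] (ℝ × ℝ × ℝ)}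

/-- In negative time the cocycle contracts the projectivized cone `yz < 0` uniformly. -/
lemma abs_logSlope_sub_le (h : JacobiCocycle φ p₁ p₂ a D) {k : ℝ} (hk : k ≤ 1) (hk0 : 0 ≤ k)
    (ha : ∀ q, k ≤ a q) {q : X} {w w' : ℝ × ℝ × ℝ} (hw : w.2.1 * w.2.2 < 0)
    (hw' : w'.2.1 * w'.2.2 < 0) {t : ℝ} (ht : t ≤ 0) :
    |logSlope (D t q w) - logSlope (D t q w')| ≤
      Real.exp (k * t) * |logSlope w - logSlope w'| := by
  have ha0 : ∀ q, 0 ≤ a q := fun q => hk0.trans (ha q)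
  have hder : ∀ w : ℝ × ℝ × ℝ, w.2.1 * w.2.2 < 0 → ∀ s ≤ 0,
      HasDerivAt (fun s => logSlope (D s q w))
        (Real.exp (logSlope (D s q w)) - a (φ s q) * Real.exp (-logSlope (D s q w))
          + (p₂ (φ s q) - p₁ (φ s q))) s := by
    intro w hw s hs
    have h1 := h.mul_neg_of_nonpos ha0 (q := q) hw hs
    have hy : (D s q w).2.1 ≠ 0 := left_ne_zero_of_mul h1.ne
    have hz : (D s q w).2.2 ≠ 0 := right_ne_zero_of_mul h1.ne
    refine (((h.deriv_z q w s).log hz).sub ((h.deriv_y q w s).log hy)).congr_deriv ?_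
    have h2 := exp_logSlope h1
    have h3 : Real.exp (logSlope (D s q w)) = -((D s q w).2.2 / (D s q w).2.1) := by
      rw [eq_neg_iff_add_eq_zero, h2]
      field_simp
      ring
    rw [Real.exp_neg, h3]
    field_simp
    ring
  have hd2 : ∀ s ≤ 0, HasDerivAt (fun s => Real.exp (-(2 * k * s)) *
      (logSlope (D s q w) - logSlope (D s q w')) ^ 2) _ s := fun s hs =>
    ((((hasDerivAt_id s).const_mul (2 * k)).neg).exp).mul
      (((hder w hw s hs).sub (hder w' hw' s hs)).pow 2)
  have hmono : MonotoneOn (fun s => Real.exp (-(2 * k * s)) *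
      (logSlope (D s q w) - logSlope (D s q w')) ^ 2) (Iic 0) := by
    refine monotoneOn_of_deriv_nonneg (convex_Iic 0)
      (fun s hs => (hd2 s hs).continuousAt.continuousWithinAt)
      (fun s hs => (hd2 s (mem_Iic.1 (interior_subset hs))).differentiableAt.differentiableWithinAt)
      (fun s hs => ?_)
    rw [(hd2 s (mem_Iic.1 (interior_subset hs))).deriv]
    have h1 := mul_sq_le_mul_exp_sub hk hk0 (ha (φ s q)) (logSlope (D s q w))
      (logSlope (D s q w'))
    have h2 := mul_nonneg (Real.exp_pos (-(2 * k * s))).le (sub_nonneg.2 h1)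
    simp only [id, Pi.sub_apply]
    norm_num
    linarith
  have hle := hmono (mem_Iic.2 ht) (mem_Iic.2 le_rfl) ht
  simp only [mul_zero, neg_zero, Real.exp_zero, one_mul, h.zero] at hle
  refine abs_le_of_sq_le_sq' ?_ (by positivity) |> abs_le.2
  rw [mul_pow, sq_abs, ← Real.exp_nat_mul]
  have h3 := mul_le_mul_of_nonneg_left hle (Real.exp_pos (2 * k * t)).le
  rw [← mul_assoc, ← Real.exp_add] at h3
  simpa [mul_assoc] using h3

end JacobiCocycle

/-! ### Invariant line fields of Jacobi cocycles -/

namespace JacobiCocycle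

variable {X : Type*} [TopologicalSpace X] {φ : ℝ → X → X} {p₁ p₂ a : X → ℝ}
  {D : ℝ → X → (ℝ × ℝ × ℝ) →ₗ[ℝ] (ℝ × ℝ × ℝ)}

/-- The action of the cocycle on logarithmic slopes is a cocycle in negative time. -/
lemma logSlope_add (h : JacobiCocycle φ p₁ p₂ a D) (ha : ∀ q, 0 ≤ a q) {s t : ℝ} (hs : s ≤ 0)
    (ht : t ≤ 0) (q : X) (r : ℝ) :
    logSlope (D (s + t) q (0, 1, -Real.exp r)) = logSlope (D s (φ t q)
      (0, 1, -Real.exp (logSlope (D t q (0, 1, -Real.exp r))))) := by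
  have hw : ∀ r : ℝ, ((0, 1, -Real.exp r) : ℝ × ℝ × ℝ).2.1 *
      ((0, 1, -Real.exp r) : ℝ × ℝ × ℝ).2.2 < 0 := fun r => by simp [Real.exp_pos]
  set v := D t q (0, 1, -Real.exp r) with hv
  have h1 : v.2.1 * v.2.2 < 0 := h.mul_neg_of_nonpos ha (hw r) ht
  have h2 : v.2 = v.2.1 • ((1, -Real.exp (logSlope v)) : ℝ × ℝ) := by
    refine Prod.ext (by simp) ?_
    change v.2.2 = v.2.1 * -Real.exp (logSlope v)
    rw [mul_comm]
    exact exp_logSlope h1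
  have h3 : ((0, v.2) : ℝ × ℝ × ℝ) = v.2.1 • ((0, 1, -Real.exp (logSlope v)) : ℝ × ℝ × ℝ) := by
    rw [h2]
    ext <;> simp
  rw [h.add, ← hv, h.apply_eq s (φ t q) v, h3, map_smul]
  exact logSlope_smul (left_ne_zero_of_mul h1.ne)
    (h.mul_neg_of_nonpos ha (hw (logSlope v)) hs).ne rfl

/-- The stable direction `ℝ (1, -r)` in the plane of the components `(y, z)`. It is the fixed point
of the backward action of the cocycle on continuous logarithmic slopes, which is a contraction. -/
theorem exists_stable_slope [CompactSpace X] (h : JacobiCocycle φ p₁ p₂ a D) {a₀ : ℝ}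
    (ha₀ : 0 < a₀) (ha : ∀ q, a₀ ≤ a q) :
    ∃ r : X → ℝ, Continuous r ∧ (∀ q, 0 < r q) ∧ ∀ t q,
      (D t q (0, 1, -r q)).2.2 = -r (φ t q) * (D t q (0, 1, -r q)).2.1 := by
  set k := min 1 a₀ with hk
  have hk0 : 0 < k := lt_min one_pos ha₀
  have hk1 : k ≤ 1 := min_le_left _ _
  have hka : ∀ q, k ≤ a q := fun q => (min_le_right _ _).trans (ha q)
  have ha' : ∀ q, 0 ≤ a q := fun q => hk0.le.trans (hka q)
  have hw : ∀ r : ℝ, ((0, 1, -Real.exp r) : ℝ × ℝ × ℝ).2.1 *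
      ((0, 1, -Real.exp r) : ℝ × ℝ × ℝ).2.2 < 0 := fun r => by simp [Real.exp_pos]
  have hcont : ∀ (t : {t : ℝ // 0 ≤ t}) (l : C(X, ℝ)), Continuous fun q =>
      logSlope (D (-t.1) (φ t.1 q) (0, 1, -Real.exp (l (φ t.1 q)))) := by
    rintro ⟨t, ht⟩ l
    have h1 : Continuous fun q => D (-t) q (0, 1, -Real.exp (l q)) :=
      h.continuous (-t) _ (by fun_prop)
    have h2 : ∀ q, (D (-t) q (0, 1, -Real.exp (l q))).2.1 *
        (D (-t) q (0, 1, -Real.exp (l q))).2.2 < 0 := fun q =>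
      h.mul_neg_of_nonpos ha' (hw _) (neg_nonpos.2 ht)
    have h3 : Continuous fun q => logSlope (D (-t) q (0, 1, -Real.exp (l q))) :=
      (h1.snd.snd.log fun q => right_ne_zero_of_mul (h2 q).ne).sub
        (h1.snd.fst.log fun q => left_ne_zero_of_mul (h2 q).ne)
    exact h3.comp (h.continuous_flow t)
  set S : {t : ℝ // 0 ≤ t} → C(X, ℝ) → C(X, ℝ) := fun t l => ⟨_, hcont t l⟩ with hS
  have hadd : ∀ s t l, S s (S t l) = S ⟨s.1 + t.1, add_nonneg s.2 t.2⟩ l := by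
    rintro ⟨s, hs⟩ ⟨t, ht⟩ l
    ext q
    have h1 := h.logSlope_add ha' (neg_nonpos.2 hs) (neg_nonpos.2 ht) (φ (s + t) q)
      (l (φ (s + t) q))
    have h2 : φ (-t) (φ (s + t) q) = φ s q := by
      rw [← h.flow_add]; congr 1; ring
    have h3 : φ t (φ s q) = φ (s + t) q := by
      rw [← h.flow_add, add_comm]
    rw [h2, ← neg_add] at h1
    simp only [hS, ContinuousMap.coe_mk, h3]
    exact h1.symm
  have hcontr : ContractingWith (Real.exp (-k)).toNNReal (S ⟨1, zero_le_one⟩) := by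
    refine ⟨?_, LipschitzWith.of_dist_le_mul fun l l' => ?_⟩
    · rw [← NNReal.coe_lt_coe, Real.coe_toNNReal _ (Real.exp_pos _).le]
      exact Real.exp_lt_one_iff.2 (neg_lt_zero.2 hk0)
    · rw [Real.coe_toNNReal _ (Real.exp_pos _).le]
      refine (ContinuousMap.dist_le (by positivity)).2 fun q => ?_
      have h1 := h.abs_logSlope_sub_le hk1 hk0.le hka (q := φ 1 q) (hw (l (φ 1 q)))
        (hw (l' (φ 1 q))) (neg_nonpos.2 zero_le_one)
      simp only [logSlope_exp, mul_neg, mul_one] at h1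
      have h2 := mul_le_mul_of_nonneg_left (ContinuousMap.dist_apply_le_dist (f := l) (g := l')
        (φ 1 q)) (Real.exp_pos (-k)).le
      exact h1.trans h2
  obtain ⟨l, hl⟩ := ContractingWith.exists_common_fixedPoint S _ hcontr fun t l => by
    rw [hadd, hadd]
    congr 2
    exact add_comm _ _
  -- The fixed point is invariant under the backward flow.
  have hback : ∀ t ≤ 0, ∀ q, (D t q (0, 1, -Real.exp (l q))).2.2 =
      -Real.exp (l (φ t q)) * (D t q (0, 1, -Real.exp (l q))).2.1 := by
    intro t ht q
    have h1 : logSlope (D (-(-t)) (φ (-t) (φ t q)) (0, 1, -Real.exp (l (φ (-t) (φ t q))))) =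
      l (φ t q) := DFunLike.congr_fun (hl ⟨-t, neg_nonneg.2 ht⟩) (φ t q)
    rw [neg_neg, h.flow_neg] at h1
    rw [← h1]
    exact exp_logSlope (h.mul_neg_of_nonpos ha' (hw _) ht)
  refine ⟨fun q => Real.exp (l q), by fun_prop, fun q => Real.exp_pos _, fun t q => ?_⟩
  rcases le_total t 0 with ht | ht
  · exact hback t ht q
  · -- Forward invariance follows by inverting the cocycle.
    have h1 := hback (-t) (neg_nonpos.2 ht) (φ t q)
    set v := D (-t) (φ t q) (0, 1, -Real.exp (l (φ t q))) with hv
    rw [h.flow_neg] at h1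
    have h2 : v.2.1 ≠ 0 := left_ne_zero_of_mul
      (h.mul_neg_of_nonpos ha' (hw (l (φ t q))) (neg_nonpos.2 ht)).ne
    have h3 : v = v.1 • ((1, 0, 0) : ℝ × ℝ × ℝ)
        + v.2.1 • ((0, 1, -Real.exp (l q)) : ℝ × ℝ × ℝ) := by
      refine Prod.ext (by simp) (Prod.ext (by simp) ?_)
      change v.2.2 = v.1 * 0 + v.2.1 * -Real.exp (l q)
      rw [h1]; ring
    have h4 : D t q v = (0, 1, -Real.exp (l (φ t q))) := by
      have h5 := h.add t (-t) (φ t q) (0, 1, -Real.exp (l (φ t q)))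
      rw [add_neg_cancel, h.zero, h.flow_neg] at h5
      exact h5.symm
    rw [h3, map_add, map_smul, map_smul, h.generator] at h4
    have h5 := congrArg (fun w => w.2.1) h4
    have h6 := congrArg (fun w => w.2.2) h4
    simp only [Prod.snd_add, Prod.smul_snd, Prod.fst_add, Prod.smul_fst, smul_eq_mul, mul_zero,
      zero_add] at h5 h6
    apply mul_left_cancel₀ h2
    linear_combination h6 + Real.exp (l (φ t q)) * h5

section Rates

variable {r σ : X → ℝ}

/-- The growth of vectors on an invariant line field `ℝ (1, σ)`. -/
lemma component_eq_exp (h : JacobiCocycle φ p₁ p₂ a D) (hσ : Continuous σ)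
    (hinv : ∀ t q, (D t q (0, 1, σ q)).2.2 = σ (φ t q) * (D t q (0, 1, σ q)).2.1)
    (t : ℝ) (q : X) : (D t q (0, 1, σ q)).2.1 =
      Real.exp (∫ s in (0 : ℝ)..t, (p₁ (φ s q) + σ (φ s q))) := by
  refine eq_exp_integral (f := fun t => (D t q (0, 1, σ q)).2.1)
    ((h.continuous_p₁.comp (h.continuous_orbit q)).add (hσ.comp (h.continuous_orbit q)))
    (fun s => (h.deriv_y q _ s).congr_deriv ?_) ?_ t
  · rw [hinv]
    change _ = (p₁ (φ s q) + σ (φ s q)) * _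
    ring
  · simp [h.zero]

/-- If the derivative of `yz` along the flow is a positive definite form in `(y, z)`, then the
stable direction is uniformly contracted. -/
lemma sq_component_le (h : JacobiCocycle φ p₁ p₂ a D)
    (hinv : ∀ t q, (D t q (0, 1, -r q)).2.2 = -r (φ t q) * (D t q (0, 1, -r q)).2.1)
    {c : ℝ} (hc : ∀ q y z, c * (y ^ 2 + z ^ 2) ≤ a q * y ^ 2 + (p₁ q + p₂ q) * (y * z) + z ^ 2)
    (hc0 : 0 ≤ c) {t : ℝ} (ht : 0 ≤ t) (q : X) :
    (D t q (0, 1, -r q)).2.1 ^ 2 * r (φ t q) ≤ Real.exp (-(2 * c * t)) * r q := by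
  have hm := monotone_exp_neg_integral_mul (g := fun _ => -(2 * c))
    (fun s => (h.deriv_y q (0, 1, -r q) s).mul (h.deriv_z q (0, 1, -r q) s)) continuous_const
    (fun s => by
      have h1 := hc (φ s q) (D s q (0, 1, -r q)).2.1 (D s q (0, 1, -r q)).2.2
      have h2 := mul_nonneg hc0 (sq_nonneg ((D s q (0, 1, -r q)).2.1 + (D s q (0, 1, -r q)).2.2))
      simp only [Pi.mul_apply]
      linarith) ht
  simp only [intervalIntegral.integral_same, neg_zero, Real.exp_zero, one_mul, Pi.mul_apply,
    h.zero, intervalIntegral.integral_const, smul_eq_mul, sub_zero, hinv] at hm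
  rw [h.flow_zero] at hm
  have h3 := mul_le_mul_of_nonneg_left hm (Real.exp_pos (-(2 * c * t))).le
  have h4 : Real.exp (-(2 * c * t)) * Real.exp (-(t * -(2 * c))) = 1 := by
    rw [← Real.exp_add, ← Real.exp_zero]
    congr 1
    ring
  rw [← mul_assoc (Real.exp (-(2 * c * t))) (Real.exp _), h4, one_mul] at h3
  linarith

/-- A contracted invariant direction modulo the first basis vector lifts to an invariant line field:
the first component `χ` is the fixed point of an affine contraction. -/
theorem exists_lift [CompactSpace X] (h : JacobiCocycle φ p₁ p₂ a D) (hσ : Continuous σ)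
    (hinv : ∀ t q, (D t q (0, 1, σ q)).2.2 = σ (φ t q) * (D t q (0, 1, σ q)).2.1)
    {T K : ℝ} (hK0 : 0 ≤ K) (hK : K < 1) (hT : ∀ q, |(D T q (0, 1, σ q)).2.1| ≤ K) :
    ∃ χ : X → ℝ, Continuous χ ∧ ∀ t q, D t q (χ q, 1, σ q) =
      (D t q (0, 1, σ q)).2.1 • ((χ (φ t q), 1, σ (φ t q)) : ℝ × ℝ × ℝ) := by
  have hD : ∀ t q, D t q (0, 1, σ q) = (D t q (0, 1, σ q)).1 • ((1, 0, 0) : ℝ × ℝ × ℝ)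
      + (D t q (0, 1, σ q)).2.1 • ((0, 1, σ (φ t q)) : ℝ × ℝ × ℝ) := by
    intro t q
    refine Prod.ext (by simp) (Prod.ext (by simp) ?_)
    refine (hinv t q).trans ?_
    simp only [Prod.snd_add, Prod.smul_snd, smul_eq_mul]
    ring
  have hcont : ∀ (t : ℝ) (χ : C(X, ℝ)), Continuous fun q =>
      (D t q (0, 1, σ q)).2.1 * χ (φ t q) - (D t q (0, 1, σ q)).1 := by
    intro t χ
    have h1 : Continuous fun q => D t q (0, 1, σ q) := h.continuous t _ (by fun_prop)
    exact (h1.snd.fst.mul (χ.continuous.comp (h.continuous_flow t))).sub h1.fst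
  set S : ℝ → C(X, ℝ) → C(X, ℝ) := fun t χ => ⟨_, hcont t χ⟩ with hS
  have hadd : ∀ s t χ, S s (S t χ) = S (t + s) χ := by
    intro s t χ
    ext q
    have h1 := h.add t s q (0, 1, σ q)
    rw [hD s q, map_add, map_smul, map_smul, h.generator] at h1
    have h2 := congrArg (fun w => w.1) h1
    have h3 := congrArg (fun w => w.2.1) h1
    simp only [Prod.snd_add, Prod.smul_snd, Prod.fst_add, Prod.smul_fst, smul_eq_mul, mul_zero,
      zero_add, mul_one] at h2 h3
    simp only [hS, ContinuousMap.coe_mk, h2, h3, h.flow_add]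
    ring
  have hcontr : ContractingWith K.toNNReal (S T) := by
    refine ⟨Real.toNNReal_lt_one.2 hK, LipschitzWith.of_dist_le_mul fun l l' => ?_⟩
    rw [Real.coe_toNNReal _ hK0]
    refine (ContinuousMap.dist_le (by positivity)).2 fun q => ?_
    have h1 := mul_le_mul (hT q) (ContinuousMap.dist_apply_le_dist (f := l) (g := l') (φ T q))
      dist_nonneg hK0
    refine le_trans (le_of_eq ?_) h1
    simp only [hS, ContinuousMap.coe_mk, Real.dist_eq, ← abs_mul]
    congr 1
    ring
  obtain ⟨χ, hχ⟩ := ContractingWith.exists_common_fixedPoint S T hcontr fun t χ => by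
    rw [hadd, hadd, add_comm]
  refine ⟨χ, χ.continuous, fun t q => ?_⟩
  have h1 : _ = χ q := DFunLike.congr_fun (hχ t) q
  simp only [hS, ContinuousMap.coe_mk] at h1
  rw [h.apply_eq t q (χ q, 1, σ q)]
  refine Prod.ext ?_ (Prod.ext (by simp) ?_)
  · simp only [Prod.smul_fst, smul_eq_mul]
    linear_combination -h1
  · refine (hinv t q).trans ?_
    simp only [Prod.smul_snd, smul_eq_mul]
    ring

/-- A growth rate over a time interval and its inverse along the same piece of orbit. -/
lemma component_mul_component_neg (h : JacobiCocycle φ p₁ p₂ a D)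
    (hinv : ∀ t q, (D t q (0, 1, σ q)).2.2 = σ (φ t q) * (D t q (0, 1, σ q)).2.1)
    (t : ℝ) (q : X) :
    (D t q (0, 1, σ q)).2.1 * (D (-t) (φ t q) (0, 1, σ (φ t q))).2.1 = 1 := by
  have h1 := h.neg_apply t q (0, 1, σ q)
  have h2 : D t q (0, 1, σ q) = (D t q (0, 1, σ q)).1 • ((1, 0, 0) : ℝ × ℝ × ℝ)
      + (D t q (0, 1, σ q)).2.1 • ((0, 1, σ (φ t q)) : ℝ × ℝ × ℝ) := by
    refine Prod.ext (by simp) (Prod.ext (by simp) ?_)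
    refine (hinv t q).trans ?_
    simp only [Prod.snd_add, Prod.smul_snd, smul_eq_mul]
    ring
  rw [h2, map_add, map_smul, map_smul, h.generator] at h1
  simpa using congrArg (fun w => w.2.1) h1

/-- The invariant direction of smaller slope is dominated by the one of larger slope. -/
lemma component_mul_component_le (h : JacobiCocycle φ p₁ p₂ a D) {σ' : X → ℝ} (hσ : Continuous σ)
    (hσ' : Continuous σ')
    (hinv : ∀ t q, (D t q (0, 1, σ q)).2.2 = σ (φ t q) * (D t q (0, 1, σ q)).2.1)
    (hinv' : ∀ t q, (D t q (0, 1, σ' q)).2.2 = σ' (φ t q) * (D t q (0, 1, σ' q)).2.1)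
    {δ : ℝ} (hδ : ∀ q, δ ≤ σ' q - σ q) {t : ℝ} (ht : 0 ≤ t) (q : X) :
    |(D t q (0, 1, σ q)).2.1| * |(D (-t) (φ t q) (0, 1, σ' (φ t q))).2.1| ≤
      Real.exp (-δ * t) := by
  have h1 := h.component_mul_component_neg hinv' t q
  have hc : ∀ {f : X → ℝ}, Continuous f → Continuous fun s => f (φ s q) := fun hf =>
    hf.comp (h.continuous_orbit q)
  have hi : IntervalIntegrable (fun s => p₁ (φ s q) + σ (φ s q)) MeasureTheory.volume 0 t :=
    ((hc h.continuous_p₁).add (hc hσ)).intervalIntegrable _ _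
  have hi' : IntervalIntegrable (fun s => p₁ (φ s q) + σ' (φ s q)) MeasureTheory.volume 0 t :=
    ((hc h.continuous_p₁).add (hc hσ')).intervalIntegrable _ _
  rw [h.component_eq_exp hσ' hinv'] at h1
  rw [eq_inv_of_mul_eq_one_right h1, h.component_eq_exp hσ hinv, ← Real.exp_neg, Real.abs_exp,
    Real.abs_exp, ← Real.exp_add, Real.exp_le_exp, ← sub_eq_add_neg,
    ← intervalIntegral.integral_sub hi hi']
  have h2 := intervalIntegral.integral_mono_on ht (hi.sub hi')
    (intervalIntegrable_const (c := -δ)) (fun s _ => by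
      linarith [hδ (φ s q)])
  rw [intervalIntegral.integral_const, sub_zero, smul_eq_mul, mul_comm] at h2
  exact h2

end Rates

section Compact

variable [CompactSpace X]

/-- The stable and the unstable slope of the cocycle. The latter is the stable slope for the
reversed time. -/
theorem exists_invariant_slopes (h : JacobiCocycle φ p₁ p₂ a D) {a₀ : ℝ}
    (ha₀ : 0 < a₀) (ha : ∀ q, a₀ ≤ a q) :
    ∃ r s : X → ℝ, Continuous r ∧ Continuous s ∧ (∀ q, 0 < r q) ∧ (∀ q, 0 < s q) ∧
      (∀ t q, (D t q (0, 1, -r q)).2.2 = -r (φ t q) * (D t q (0, 1, -r q)).2.1) ∧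
      ∀ t q, (D t q (0, 1, s q)).2.2 = s (φ t q) * (D t q (0, 1, s q)).2.1 := by
  obtain ⟨r, hr, hr0, hr'⟩ := h.exists_stable_slope ha₀ ha
  obtain ⟨s, hs, hs0, hs'⟩ := h.reverse.exists_stable_slope ha₀ ha
  refine ⟨r, s, hr, hs, hr0, hs0, hr', fun t q => ?_⟩
  have h1 := hs' (-t) q
  simp only [LinearMap.comp_apply, LinearMap.prodMap_apply, LinearMap.id_apply,
    LinearMap.neg_apply, neg_neg] at h1
  linarith

lemma exists_abs_le {f : X → ℝ} (hf : Continuous f) : ∃ B : ℝ, 1 ≤ B ∧ ∀ q, |f q| ≤ B := by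
  obtain ⟨B, hB⟩ := isCompact_univ.bddAbove_image (f := fun q => |f q|) (by fun_prop)
  exact ⟨max 1 B, le_max_left _ _, fun q =>
    (hB (mem_image_of_mem _ (mem_univ q))).trans (le_max_right _ _)⟩

lemma exists_pos_le {f : X → ℝ} (hf : Continuous f) (h0 : ∀ q, 0 < f q) :
    ∃ c : ℝ, 0 < c ∧ ∀ q, c ≤ f q := by
  obtain ⟨c, hc, h⟩ := isCompact_univ.exists_forall_le' hf.continuousOn (fun q _ => h0 q)
  exact ⟨c, hc, fun q => h q (mem_univ q)⟩

/-- A pointwise positive definite form on a compact space is uniformly positive definite. -/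
lemma exists_pos_definite {a b : X → ℝ} (ha : Continuous a) (hb : Continuous b)
    (h : ∀ q, 0 < a q - b q ^ 2 / 4) :
    ∃ c : ℝ, 0 < c ∧ ∀ q y z, c * (y ^ 2 + z ^ 2) ≤ a q * y ^ 2 + b q * (y * z) + z ^ 2 := by
  obtain ⟨δ, hδ, hδ'⟩ := exists_pos_le (by fun_prop) h
  obtain ⟨B, hB, hB'⟩ := exists_abs_le hb
  have hpos : 0 < 1 + B ^ 2 / 2 := by positivity
  refine ⟨min (δ / (1 + B ^ 2 / 2)) (1 / 2), by positivity, fun q y z => ?_⟩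
  set c := min (δ / (1 + B ^ 2 / 2)) (1 / 2)
  have hc0 : 0 ≤ c := by positivity
  have hc1 : c * (1 + B ^ 2 / 2) ≤ δ := (le_div_iff₀ hpos).1 (min_le_left _ _)
  have hc2 : c ≤ 1 / 2 := min_le_right _ _
  have hb2 : b q ^ 2 ≤ B ^ 2 := sq_le_sq' (abs_le.1 (hB' q)).1 (abs_le.1 (hB' q)).2
  -- The form is `(a - b ^ 2 / 4) y ^ 2 + (z + b y / 2) ^ 2`, and
  -- `z ^ 2 ≤ 2 (z + b y / 2) ^ 2 + b ^ 2 y ^ 2 / 2`.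
  have h1 := mul_nonneg hc0 (sq_nonneg (z + b q * y))
  have h2 := mul_nonneg (sub_nonneg.2 hc2) (sq_nonneg (z + b q * y / 2))
  have h3 := mul_le_mul_of_nonneg_right (hδ' q) (sq_nonneg y)
  have h4 := mul_le_mul_of_nonneg_right hc1 (sq_nonneg y)
  have h5 := mul_le_mul_of_nonneg_left hb2 (mul_nonneg hc0 (sq_nonneg y))
  nlinarith

/-- Uniform contraction of the stable direction in the future. -/
lemma exists_abs_component_le (h : JacobiCocycle φ p₁ p₂ a D) {r : X → ℝ} (hr : Continuous r)
    (hr0 : ∀ q, 0 < r q)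
    (hinv : ∀ t q, (D t q (0, 1, -r q)).2.2 = -r (φ t q) * (D t q (0, 1, -r q)).2.1)
    {c : ℝ} (hc : ∀ q y z, c * (y ^ 2 + z ^ 2) ≤ a q * y ^ 2 + (p₁ q + p₂ q) * (y * z) + z ^ 2)
    (hc0 : 0 ≤ c) :
    ∃ C : ℝ, 1 ≤ C ∧ ∀ t, 0 ≤ t → ∀ q, |(D t q (0, 1, -r q)).2.1| ≤ C * Real.exp (-c * t) := by
  obtain ⟨ρ, hρ, hρ'⟩ := exists_pos_le hr hr0
  obtain ⟨B, hB, hB'⟩ := exists_abs_le hr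
  refine ⟨max 1 (B / ρ), le_max_left _ _, fun t ht q => ?_⟩
  set C := max 1 (B / ρ)
  have hC1 : 1 ≤ C := le_max_left _ _
  have hCB : B ≤ C * ρ := (div_le_iff₀ hρ).1 (le_max_right _ _)
  refine abs_le_of_sq_le_sq ?_ (by positivity)
  have h1 := h.sq_component_le hinv hc hc0 ht q
  have h2 : Real.exp (-c * t) ^ 2 = Real.exp (-(2 * c * t)) := by
    rw [← Real.exp_nat_mul]; congr 1; push_cast; ring
  rw [mul_pow, h2]
  set E := Real.exp (-(2 * c * t))
  have hE : 0 < E := Real.exp_pos _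
  set m := (D t q (0, 1, -r q)).2.1
  have h3 := mul_le_mul_of_nonneg_left (hρ' (φ t q)) (sq_nonneg m)
  have h4 := mul_le_mul_of_nonneg_left ((le_abs_self _).trans (hB' q)) hE.le
  have h5 : C * ρ ≤ C ^ 2 * ρ := by nlinarith
  have h6 := mul_le_mul_of_nonneg_left (hCB.trans h5) hE.le
  have h7 : m ^ 2 * ρ ≤ (C ^ 2 * E) * ρ := by linarith
  exact le_of_mul_le_mul_right h7 hρ

/-- Uniform contraction of the unstable direction in the past. -/
lemma exists_abs_component_neg_le (h : JacobiCocycle φ p₁ p₂ a D) {s : X → ℝ} (hs : Continuous s)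
    (hs0 : ∀ q, 0 < s q)
    (hinv : ∀ t q, (D t q (0, 1, s q)).2.2 = s (φ t q) * (D t q (0, 1, s q)).2.1)
    {c : ℝ} (hc : ∀ q y z, c * (y ^ 2 + z ^ 2) ≤ a q * y ^ 2 + (p₁ q + p₂ q) * (y * z) + z ^ 2)
    (hc0 : 0 ≤ c) :
    ∃ C : ℝ, 1 ≤ C ∧ ∀ t, 0 ≤ t → ∀ q, |(D (-t) q (0, 1, s q)).2.1| ≤ C * Real.exp (-c * t) := by
  obtain ⟨C, hC, hC'⟩ := h.reverse.exists_abs_component_le hs hs0 (fun t q => by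
    have h1 := hinv (-t) q
    simp only [LinearMap.comp_apply, LinearMap.prodMap_apply, LinearMap.id_apply,
      LinearMap.neg_apply, neg_neg]
    linarith) (c := c) (fun q y z => by
      have h1 := hc q y (-z)
      linarith) hc0
  refine ⟨C, hC, fun t ht q => ?_⟩
  have h1 := hC' t ht q
  simpa only [LinearMap.comp_apply, LinearMap.prodMap_apply, LinearMap.id_apply,
      LinearMap.neg_apply, neg_neg] using h1

lemma exists_exp_le_half {C c : ℝ} (hC : 1 ≤ C) (hc : 0 < c) :
    ∃ T : ℝ, 0 ≤ T ∧ C * Real.exp (-c * T) ≤ 1 / 2 := by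
  have h1 : 0 ≤ Real.log (2 * C) := Real.log_nonneg (by linarith)
  refine ⟨Real.log (2 * C) / c, by positivity, le_of_eq ?_⟩
  have h2 : -c * (Real.log (2 * C) / c) = -Real.log (2 * C) := by field_simp
  rw [h2, Real.exp_neg, Real.exp_log (by linarith)]
  have : C ≠ 0 := by positivity
  field_simp

end Compact

end JacobiCocycle

/-! ### Dominated splittings of thermostats -/

namespace UnitTangentBundle

/-- The vector of slope `s` in the plane of the components along `[H], [V]`. -/
noncomputable def slopeVec (s : ℝ) : Plane := !₂[1, s]

lemma slopeVec_zero (s : ℝ) : slopeVec s 0 = 1 := rfl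

lemma slopeVec_one (s : ℝ) : slopeVec s 1 = s := rfl

lemma slopeVec_ne_zero (s : ℝ) : slopeVec s ≠ 0 := fun h => by
  have h1 := congrArg (fun w : Plane => w 0) h
  simp [slopeVec_zero] at h1

lemma continuous_slopeVec : Continuous slopeVec := by
  unfold slopeVec
  fun_prop

lemma one_le_norm_slopeVec (s : ℝ) : 1 ≤ ‖slopeVec s‖ := by
  have h := PiLp.norm_apply_le (slopeVec s) 0
  rwa [slopeVec_zero, norm_one] at h

lemma isCompl_span_slopeVec {s s' : ℝ} (h : s ≠ s') :
    IsCompl (Submodule.span ℝ {slopeVec s}) (Submodule.span ℝ {slopeVec s'}) := by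
  have hs : s - s' ≠ 0 := sub_ne_zero.2 h
  refine ⟨?_, ?_⟩
  · rw [Submodule.disjoint_def]
    intro w hw hw'
    obtain ⟨c, rfl⟩ := Submodule.mem_span_singleton.1 hw
    obtain ⟨c', hc'⟩ := Submodule.mem_span_singleton.1 hw'
    have h0 := congrArg (fun w : Plane => w 0) hc'
    have h1 := congrArg (fun w : Plane => w 1) hc'
    simp only [PiLp.smul_apply, slopeVec_zero, slopeVec_one, smul_eq_mul, mul_one] at h0 h1
    have h2 : c * (s - s') = 0 := by rw [h0] at h1; linear_combination -h1
    rw [(mul_eq_zero.1 h2).resolve_right hs, zero_smul]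
  · rw [codisjoint_iff, Submodule.eq_top_iff']
    intro w
    refine Submodule.mem_sup.2 ⟨((w 1 - s' * w 0) / (s - s')) • slopeVec s,
      Submodule.smul_mem _ _ (Submodule.mem_span_singleton_self _),
      ((s * w 0 - w 1) / (s - s')) • slopeVec s',
      Submodule.smul_mem _ _ (Submodule.mem_span_singleton_self _), ?_⟩
    ext i
    fin_cases i
    · simp [slopeVec]; field_simp; ring
    · simp [slopeVec]; field_simp; ring

variable {M : Type*} [TopologicalSpace M] [ChartedSpace Plane M] [IsManifold (𝓡 2) ∞ M]
  [RiemannianBundle (fun x : M => TangentSpace (𝓡 2) x)]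
  [IsContMDiffRiemannianBundle (𝓡 2) ∞ Plane (fun x : M => TangentSpace (𝓡 2) x)]
  {o : SurfaceOrientation M} {lam p : UnitTangentBundle M → ℝ}
  {φ : ℝ → UnitTangentBundle M → UnitTangentBundle M}

/-- The derivative of the thermostat flow in the frame `(F, H + pV, V)` is a cocycle satisfying a
Jacobi equation with potential `-κ_p`. -/
lemma jacobiCocycle [T2Space M] (hlam : ContMDiff model 𝓘(ℝ, ℝ) ∞ lam)
    (hp : ContMDiff model 𝓘(ℝ, ℝ) ∞ p) (hφ : IsFlow (thermostat o lam) φ) :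
    JacobiCocycle φ p (fun q => deriv (vfV o) lam q - p q) (fun q => -kappaP o lam p q)
      (fun t q => frameDeriv o lam p (φ t) q) where
  flow_zero := hφ.zero
  flow_add s t q := congrFun (hφ.add s t) q
  continuous_flow := hφ.continuous
  continuous_orbit := hφ.continuous_orbit
  continuous_p₁ := hp.continuous
  continuous_p₂ :=
    (continuous_deriv (continuous_vfV hlam.continuous hp.continuous) hlam).sub hp.continuous
  continuous_a := (continuous_kappaP hlam hp hφ).neg
  zero q w := by
    have h0 : φ 0 = id := funext hφ.zero
    rw [h0]
    exact frameDeriv_id q w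
  add s t q w := by
    rw [hφ.add]
    exact frameDeriv_comp (hφ.mdifferentiable_time s) (hφ.mdifferentiable_time t) q w
  generator t q := by
    rw [← frameCoords_thermostat (o := o) (lam := lam) (p := p) q, frameDeriv_frameCoords,
      hφ.mfderiv_generator, frameCoords_thermostat, frameCoords_thermostat]
  continuous t w hw := continuous_frameDeriv hlam.continuous hp.continuous (hφ.contMDiff_time t) hw
  deriv_y q w t := (hasDerivAt_frameDeriv hlam hp hφ q w t).1
  deriv_z q w t := (hasDerivAt_frameDeriv hlam hp hφ q w t).2

/-- The quotient cocycle in the basis `[H], [V]`, in terms of the derivative in the frame: the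
coordinates `(y, u)` of the quotient are `(y, z + p y)`. -/
lemma cocycle_eq (t : ℝ) (q : UnitTangentBundle M) (w : Plane) :
    cocycle o lam φ t q w =
      !₂[(frameDeriv o lam p (φ t) q (0, w 0, w 1 - p q * w 0)).2.1,
        (frameDeriv o lam p (φ t) q (0, w 0, w 1 - p q * w 0)).2.2
          + p (φ t q) * (frameDeriv o lam p (φ t) q (0, w 0, w 1 - p q * w 0)).2.1] := by
  have h1 : frameCoords o lam p q (w 0 • vfH o q + w 1 • vfV o q) =
      (0, w 0, w 1 - p q * w 0) := by
    rw [map_add, map_smul, map_smul, frameCoords_vfH, frameCoords_vfV]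
    refine Prod.ext (by simp) (Prod.ext (by simp) ?_)
    simp
    ring
  rw [← h1, frameDeriv_frameCoords, frameCoords_apply, cocycle, quotientCoords]
  simp

/-- The quotient cocycle on an invariant line field. -/
lemma cocycle_smul_slopeVec {σ : UnitTangentBundle M → ℝ} {t : ℝ} {q : UnitTangentBundle M}
    (hσ : (frameDeriv o lam p (φ t) q (0, 1, σ q)).2.2 =
      σ (φ t q) * (frameDeriv o lam p (φ t) q (0, 1, σ q)).2.1) (c : ℝ) :
    cocycle o lam φ t q (c • slopeVec (p q + σ q)) =
      (c * (frameDeriv o lam p (φ t) q (0, 1, σ q)).2.1) • slopeVec (p (φ t q) + σ (φ t q)) := by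
  have h1 : ((0, (c • slopeVec (p q + σ q)) 0, (c • slopeVec (p q + σ q)) 1
      - p q * (c • slopeVec (p q + σ q)) 0) : ℝ × ℝ × ℝ) = c • (0, 1, σ q) := by
    refine Prod.ext (by simp) (Prod.ext ?_ ?_)
    · simp [slopeVec_zero]
    · simp [slopeVec_zero, slopeVec_one]; ring
  rw [cocycle_eq (p := p), h1, map_smul]
  ext i
  fin_cases i
  · simp [slopeVec]
  · simp [slopeVec, hσ]; ring

section Invariant

variable {σ : UnitTangentBundle M → ℝ}

lemma isContinuousLineField_slopeVec (hp : Continuous p) (hσ : Continuous σ) :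
    IsContinuousLineField fun q => Submodule.span ℝ {slopeVec (p q + σ q)} := fun _ =>
  ⟨univ, univ_mem, fun q => slopeVec (p q + σ q),
    (continuous_slopeVec.comp (hp.add hσ)).continuousOn, fun _ _ => ⟨slopeVec_ne_zero _, rfl⟩⟩

lemma cocycle_image_span {t : ℝ} {q : UnitTangentBundle M}
    (hσ : (frameDeriv o lam p (φ t) q (0, 1, σ q)).2.2 =
      σ (φ t q) * (frameDeriv o lam p (φ t) q (0, 1, σ q)).2.1)
    (h0 : (frameDeriv o lam p (φ t) q (0, 1, σ q)).2.1 ≠ 0) :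
    cocycle o lam φ t q '' (Submodule.span ℝ {slopeVec (p q + σ q)}) =
      Submodule.span ℝ {slopeVec (p (φ t q) + σ (φ t q))} := by
  ext w
  simp only [mem_image, SetLike.mem_coe, Submodule.mem_span_singleton]
  constructor
  · rintro ⟨_, ⟨c, rfl⟩, rfl⟩
    exact ⟨_, (cocycle_smul_slopeVec hσ c).symm⟩
  · rintro ⟨c, rfl⟩
    refine ⟨_, ⟨c / (frameDeriv o lam p (φ t) q (0, 1, σ q)).2.1, rfl⟩, ?_⟩
    rw [cocycle_smul_slopeVec hσ, div_mul_cancel₀ _ h0]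

end Invariant

/-- Negative `κ_p` implies domination. -/
theorem hasDominatedSplitting [T2Space M] [CompactSpace M]
    (hlam : ContMDiff model 𝓘(ℝ, ℝ) ∞ lam) (hp : ContMDiff model 𝓘(ℝ, ℝ) ∞ p)
    (hφ : IsFlow (thermostat o lam) φ) (hκ : ∀ q, kappaP o lam p q < 0) :
    HasDominatedSplitting o lam φ := by
  have h := jacobiCocycle hlam hp hφ
  obtain ⟨a₀, ha₀, ha⟩ := JacobiCocycle.exists_pos_le h.continuous_a fun q => neg_pos.2 (hκ q)
  obtain ⟨r, s, hr, hs, hr0, hs0, hr', hs'⟩ := h.exists_invariant_slopes ha₀ ha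
  obtain ⟨δ, hδ, hδ'⟩ := JacobiCocycle.exists_pos_le (hs.add hr) fun q => add_pos (hs0 q) (hr0 q)
  have hrc : Continuous fun q => -r q := hr.neg
  have hne : ∀ {σ : UnitTangentBundle M → ℝ},
      (∀ t q, (frameDeriv o lam p (φ t) q (0, 1, σ q)).2.2 =
        σ (φ t q) * (frameDeriv o lam p (φ t) q (0, 1, σ q)).2.1) → ∀ t q,
      (frameDeriv o lam p (φ t) q (0, 1, σ q)).2.1 ≠ 0 := fun hinv t q =>
    left_ne_zero_of_mul_eq_one (h.component_mul_component_neg hinv t q)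
  obtain ⟨B, hB, hBs⟩ := JacobiCocycle.exists_abs_le
    (continuous_slopeVec.comp (hp.continuous.add hs)).norm
  obtain ⟨B', hB', hBr⟩ := JacobiCocycle.exists_abs_le
    (continuous_slopeVec.comp (hp.continuous.add hrc)).norm
  refine ⟨fun q => Submodule.span ℝ {slopeVec (p q + s q)},
    fun q => Submodule.span ℝ {slopeVec (p q + -r q)},
    isContinuousLineField_slopeVec hp.continuous hs,
    isContinuousLineField_slopeVec hp.continuous hrc, fun q => isCompl_span_slopeVec ?_,
    fun t q => cocycle_image_span (hs' t q) (hne hs' t q),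
    fun t q => cocycle_image_span (σ := fun q => -r q) (hr' t q) (hne hr' t q),
    B' * B, by positivity, Real.exp (-δ), Real.exp_pos _,
    Real.exp_lt_one_iff.2 (neg_lt_zero.2 hδ), ?_⟩
  · have h1 := hs0 q
    have h2 := hr0 q
    intro h3
    linarith
  · intro t ht q w hw w' hw'
    obtain ⟨c, rfl⟩ := Submodule.mem_span_singleton.1 hw
    obtain ⟨c', rfl⟩ := Submodule.mem_span_singleton.1 hw'
    have h1 := h.component_mul_component_le hrc hs hr' hs' (δ := δ)
      (fun q => by have h2 : δ ≤ s q + r q := hδ' q; linarith) ht.le q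
    have hq : φ (-t) (φ t q) = q := hφ.neg_apply t q
    rw [cocycle_smul_slopeVec (σ := fun q => -r q) (hr' t q),
      cocycle_smul_slopeVec (hs' (-t) (φ t q)),
      norm_smul, norm_smul, norm_smul, norm_smul, hq, norm_mul, norm_mul, ← Real.exp_mul]
    have h2 : ‖slopeVec (p (φ t q) + -r (φ t q))‖ ≤ B' := (le_abs_self _).trans (hBr (φ t q))
    have h3 : ‖slopeVec (p q + s q)‖ ≤ B := (le_abs_self _).trans (hBs q)
    have h4 := one_le_norm_slopeVec (p q + -r q)
    have h5 := one_le_norm_slopeVec (p (φ t q) + s (φ t q))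
    simp only [Real.norm_eq_abs] at h1 ⊢
    set m := |(frameDeriv o lam p (φ t) q (0, 1, -r q)).2.1|
    set m' := |(frameDeriv o lam p (φ (-t)) (φ t q) (0, 1, s (φ t q))).2.1|
    set N₁ := ‖slopeVec (p (φ t q) + -r (φ t q))‖
    set N₂ := ‖slopeVec (p q + s q)‖
    set N₃ := ‖slopeVec (p q + -r q)‖
    set N₄ := ‖slopeVec (p (φ t q) + s (φ t q))‖
    have hm : 0 ≤ m * m' := mul_nonneg (abs_nonneg _) (abs_nonneg _)
    calc |c| * m * N₁ * (|c'| * m' * N₂) = (|c| * |c'|) * (N₁ * N₂ * (m * m')) := by ring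
      _ ≤ (|c| * |c'|) * (B' * B * Real.exp (-δ * t)) := by
          gcongr
      _ = B' * B * Real.exp (-δ * t) * (|c| * 1 * (|c'| * 1)) := by ring
      _ ≤ B' * B * Real.exp (-δ * t) * (|c| * N₃ * (|c'| * N₄)) := by
          gcongr

end UnitTangentBundle

/-! ### Anosov thermostats -/

namespace UnitTangentBundle

variable {M : Type*} [TopologicalSpace M] [ChartedSpace Plane M] [IsManifold (𝓡 2) ∞ M]
  [RiemannianBundle (fun x : M => TangentSpace (𝓡 2) x)]
  [IsContMDiffRiemannianBundle (𝓡 2) ∞ Plane (fun x : M => TangentSpace (𝓡 2) x)]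
  {o : SurfaceOrientation M} {lam p : UnitTangentBundle M → ℝ}
  {φ : ℝ → UnitTangentBundle M → UnitTangentBundle M}

lemma sasakiNorm_smul (q : UnitTangentBundle M) (c : ℝ) (ξ : TangentSpace model q) :
    sasakiNorm o q (c • ξ) = |c| * sasakiNorm o q ξ := by
  rw [sasakiNorm, sasakiNorm, omega1_smul, omega2_smul, psi_smul, ← Real.sqrt_sq_eq_abs,
    ← Real.sqrt_mul (sq_nonneg c)]
  congr 1
  ring

lemma sasakiNorm_frameEquiv_symm (q : UnitTangentBundle M) (w : ℝ × ℝ × ℝ) :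
    sasakiNorm o q ((frameEquiv o lam p q).symm w) =
      Real.sqrt (w.1 ^ 2 + w.2.1 ^ 2 + (w.2.2 + lam q * w.1 + p q * w.2.1) ^ 2) := by
  have h1 : frameCoords o lam p q ((frameEquiv o lam p q).symm w) = w :=
    (frameEquiv o lam p q).apply_symm_apply w
  rw [sasakiNorm]
  conv_rhs => rw [← h1]
  simp only [frameCoords_apply]
  congr 3
  ring

lemma frameEquiv_symm_ne_zero (q : UnitTangentBundle M) (x z : ℝ) :
    (frameEquiv o lam p q).symm (x, 1, z) ≠ 0 := by
  rw [Ne, LinearEquiv.map_eq_zero_iff]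
  simp

lemma one_le_sasakiNorm (q : UnitTangentBundle M) (x z : ℝ) :
    1 ≤ sasakiNorm o q ((frameEquiv o lam p q).symm (x, 1, z)) := by
  rw [sasakiNorm_frameEquiv_symm, Real.one_le_sqrt]
  have h1 := sq_nonneg x
  have h2 := sq_nonneg (z + lam q * x + p q * 1)
  simp only
  linarith

lemma mfderiv_frameEquiv_symm {t : ℝ} {q : UnitTangentBundle M} {w w' : ℝ × ℝ × ℝ} {m : ℝ}
    (h : frameDeriv o lam p (φ t) q w = m • w') :
    mfderiv model model (φ t) q ((frameEquiv o lam p q).symm w) =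
      m • (frameEquiv o lam p (φ t q)).symm w' := by
  apply frameCoords_injective o lam p (φ t q)
  rw [map_smul, ← frameDeriv_apply, h]
  congr 1
  exact ((frameEquiv o lam p (φ t q)).apply_symm_apply w').symm

/-- Three lines transverse in the frame `(F, H + pV, V)` form a splitting. -/
lemma isInternal_frame (q : UnitTangentBundle M) {x x' z z' : ℝ} (h : z ≠ z') :
    DirectSum.IsInternal ![Submodule.span ℝ {thermostat o lam q},
      Submodule.span ℝ {(frameEquiv o lam p q).symm (x, 1, z)},
      Submodule.span ℝ {(frameEquiv o lam p q).symm (x', 1, z')}] := by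
  set v : Fin 3 → TangentSpace model q := ![thermostat o lam q,
    (frameEquiv o lam p q).symm (x, 1, z), (frameEquiv o lam p q).symm (x', 1, z')] with hv
  have hfam : ![Submodule.span ℝ {thermostat o lam q},
      Submodule.span ℝ {(frameEquiv o lam p q).symm (x, 1, z)},
      Submodule.span ℝ {(frameEquiv o lam p q).symm (x', 1, z')}] =
      fun i => Submodule.span ℝ {v i} := by
    funext i
    fin_cases i <;> rfl
  have hli : LinearIndependent ℝ v := by
    rw [Fintype.linearIndependent_iff]
    intro g hg
    have h1 := congrArg (frameCoords o lam p q) hg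
    have hw : ∀ w, frameCoords o lam p q ((frameEquiv o lam p q).symm w) = w := fun w =>
      (frameEquiv o lam p q).apply_symm_apply w
    rw [Fin.sum_univ_three, map_add, map_add, map_smul, map_smul, map_smul, map_zero] at h1
    simp only [hv, Matrix.cons_val, frameCoords_thermostat, hw, Prod.smul_mk, Prod.mk_add_mk,
      smul_eq_mul, mul_one, mul_zero, zero_add, Prod.mk_eq_zero] at h1
    obtain ⟨h2, h3, h4⟩ := h1
    have h5 : g 1 * (z - z') = 0 := by linear_combination h4 - z' * h3
    have h6 : g 1 = 0 := (mul_eq_zero.1 h5).resolve_right (sub_ne_zero.2 h)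
    have h7 : g 2 = 0 := by linear_combination h3 - h6
    have h8 : g 0 = 0 := by rw [h6, h7] at h2; linear_combination h2
    intro i
    fin_cases i
    · exact h8
    · exact h6
    · exact h7
  rw [hfam, DirectSum.isInternal_submodule_iff_iSupIndep_and_iSup_eq_top]
  refine ⟨hli.iSupIndep_span_singleton, ?_⟩
  rw [← Submodule.span_range_eq_iSup]
  refine hli.span_eq_top_of_card_eq_finrank' ?_
  change _ = Module.finrank ℝ (Plane × ℝ)
  simp

section Invariant

variable {χ σ : UnitTangentBundle M → ℝ}

lemma isContinuousTangentLineField_frame (hlam : Continuous lam) (hp : Continuous p)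
    (hχ : Continuous χ) (hσ : Continuous σ) :
    IsContinuousTangentLineField fun q : UnitTangentBundle M =>
      Submodule.span ℝ {(frameEquiv o lam p q).symm (χ q, 1, σ q)} := fun _ =>
  ⟨univ, univ_mem, fun q => (frameEquiv o lam p q).symm (χ q, 1, σ q),
    (continuous_frame_section o hlam hp (by fun_prop)).continuousOn,
    fun _ _ => ⟨frameEquiv_symm_ne_zero _ _ _, rfl⟩⟩

lemma map_span_frame {t : ℝ} {q : UnitTangentBundle M} {m : ℝ} (hm : m ≠ 0)
    (h : frameDeriv o lam p (φ t) q (χ q, 1, σ q) = m • (χ (φ t q), 1, σ (φ t q))) :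
    (Submodule.span ℝ {(frameEquiv o lam p q).symm (χ q, 1, σ q)}).map
        (mfderiv model model (φ t) q).toLinearMap =
      Submodule.span ℝ {(frameEquiv o lam p (φ t q)).symm (χ (φ t q), 1, σ (φ t q))} := by
  rw [Submodule.map_span, image_singleton]
  have h1 := mfderiv_frameEquiv_symm h
  refine Eq.trans ?_ (Submodule.span_singleton_smul_eq (IsUnit.mk0 m hm) _)
  exact congrArg (fun v => Submodule.span ℝ {v}) h1

/-- The norm of `dφ_t` on an invariant line field of bounded inclination. -/
lemma sasakiNorm_mfderiv_le {t : ℝ} {q : UnitTangentBundle M} {m B : ℝ}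
    (h : frameDeriv o lam p (φ t) q (χ q, 1, σ q) = m • (χ (φ t q), 1, σ (φ t q)))
    (hB : sasakiNorm o (φ t q)
      ((frameEquiv o lam p (φ t q)).symm (χ (φ t q), 1, σ (φ t q))) ≤ B)
    {ξ : TangentSpace model q}
    (hξ : ξ ∈ Submodule.span ℝ {(frameEquiv o lam p q).symm (χ q, 1, σ q)}) :
    sasakiNorm o (φ t q) (mfderiv model model (φ t) q ξ) ≤ |m| * B * sasakiNorm o q ξ := by
  obtain ⟨c, rfl⟩ := Submodule.mem_span_singleton.1 hξ
  rw [map_smul, mfderiv_frameEquiv_symm h, sasakiNorm_smul, sasakiNorm_smul, sasakiNorm_smul]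
  have h1 := one_le_sasakiNorm (o := o) (lam := lam) (p := p) q (χ q) (σ q)
  have hB0 : 0 ≤ B := (Real.sqrt_nonneg _).trans hB
  calc |c| * (|m| * sasakiNorm o (φ t q)
        ((frameEquiv o lam p (φ t q)).symm (χ (φ t q), 1, σ (φ t q)))) ≤ |c| * (|m| * B) := by
        gcongr
    _ = |m| * B * (|c| * 1) := by ring
    _ ≤ _ := by gcongr

lemma continuous_sasakiNorm_frame (hlam : Continuous lam) (hp : Continuous p)
    (hχ : Continuous χ) (hσ : Continuous σ) :
    Continuous fun q => sasakiNorm o q ((frameEquiv o lam p q).symm (χ q, 1, σ q)) := by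
  simp only [sasakiNorm_frameEquiv_symm]
  fun_prop

end Invariant

/-- If the quadratic form `-κ_p y² + (Vλ) y z + z²` is positive definite, the directions of the
dominated splitting are uniformly contracted, and lift from the quotient to `T SM`. -/
theorem isAnosov [T2Space M] [CompactSpace M]
    (hlam : ContMDiff model 𝓘(ℝ, ℝ) ∞ lam) (hp : ContMDiff model 𝓘(ℝ, ℝ) ∞ p)
    (hφ : IsFlow (thermostat o lam) φ) (hκ : ∀ q, kappaP o lam p q < 0)
    (hV : ∀ q, kappaP o lam p q + (deriv (vfV o) lam q) ^ 2 / 4 < 0) :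
    IsAnosov o (thermostat o lam) φ := by
  have h := jacobiCocycle hlam hp hφ
  have hl := hlam.continuous
  have hpc := hp.continuous
  obtain ⟨a₀, ha₀, ha⟩ := JacobiCocycle.exists_pos_le h.continuous_a fun q => neg_pos.2 (hκ q)
  obtain ⟨r, s, hr, hs, hr0, hs0, hr', hs'⟩ := h.exists_invariant_slopes ha₀ ha
  obtain ⟨c, hc, hform⟩ := JacobiCocycle.exists_pos_definite h.continuous_a
    (continuous_deriv (continuous_vfV (o := o) hl hpc) hlam)
    (fun q => by have := hV q; linarith)
  have hform' : ∀ q y z, c * (y ^ 2 + z ^ 2) ≤ -kappaP o lam p q * y ^ 2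
      + (p q + (deriv (vfV o) lam q - p q)) * (y * z) + z ^ 2 := fun q y z => by
    rw [add_sub_cancel]
    exact hform q y z
  obtain ⟨C, hC, hC'⟩ := h.exists_abs_component_le hr hr0 hr' hform' hc.le
  obtain ⟨C₁, hC₁, hC₁'⟩ := h.exists_abs_component_neg_le hs hs0 hs' hform' hc.le
  have hrc : Continuous fun q => -r q := hr.neg
  obtain ⟨T, hT0, hT⟩ := JacobiCocycle.exists_exp_le_half hC hc
  obtain ⟨T₁, hT₁0, hT₁⟩ := JacobiCocycle.exists_exp_le_half hC₁ hc
  obtain ⟨χ, hχ, hχ'⟩ := h.exists_lift hrc hr' (T := T) (by norm_num) one_half_lt_one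
    fun q => (hC' T hT0 q).trans hT
  obtain ⟨χ₁, hχ₁, hχ₁'⟩ := h.exists_lift hs hs' (T := -T₁) (by norm_num) one_half_lt_one
    fun q => (hC₁' T₁ hT₁0 q).trans hT₁
  have hne : ∀ {σ : UnitTangentBundle M → ℝ},
      (∀ t q, (frameDeriv o lam p (φ t) q (0, 1, σ q)).2.2 =
        σ (φ t q) * (frameDeriv o lam p (φ t) q (0, 1, σ q)).2.1) → ∀ t q,
      (frameDeriv o lam p (φ t) q (0, 1, σ q)).2.1 ≠ 0 := fun hinv t q =>
    left_ne_zero_of_mul_eq_one (h.component_mul_component_neg hinv t q)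
  obtain ⟨B, hB, hBs⟩ := JacobiCocycle.exists_abs_le
    (continuous_sasakiNorm_frame (o := o) hl hpc hχ hrc)
  obtain ⟨B₁, hB₁, hBs₁⟩ := JacobiCocycle.exists_abs_le
    (continuous_sasakiNorm_frame (o := o) hl hpc hχ₁ hs)
  refine ⟨fun q => Submodule.span ℝ {(frameEquiv o lam p q).symm (χ₁ q, 1, s q)},
    fun q => Submodule.span ℝ {(frameEquiv o lam p q).symm (χ q, 1, -r q)},
    isContinuousTangentLineField_frame hl hpc hχ₁ hs,
    isContinuousTangentLineField_frame hl hpc hχ hrc,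
    fun q => ⟨fun h0 => ?_, isInternal_frame q ?_⟩,
    fun t q => map_span_frame (hne hs' t q) (hχ₁' t q),
    fun t q => map_span_frame (σ := fun q => -r q) (hne hr' t q) (hχ' t q),
    max (C * B) (C₁ * B₁), lt_max_of_lt_left (by positivity), Real.exp (-c), Real.exp c,
    Real.exp_pos _, Real.exp_lt_one_iff.2 (neg_lt_zero.2 hc), Real.one_lt_exp_iff.2 hc,
    fun t ht q => ⟨fun ξ hξ => ?_, fun ξ hξ => ?_⟩⟩
  · have h1 := frameCoords_thermostat (o := o) (lam := lam) (p := p) q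
    rw [h0, map_zero] at h1
    exact zero_ne_one (congrArg Prod.fst h1)
  · have h1 := hs0 q
    have h2 := hr0 q
    intro h3
    linarith
  · refine (sasakiNorm_mfderiv_le (hχ₁' (-t) q)
      ((le_abs_self _).trans (hBs₁ (φ (-t) q))) hξ).trans ?_
    have h1 := hC₁' t ht.le q
    rw [← Real.exp_mul, mul_neg, ← neg_mul]
    refine mul_le_mul_of_nonneg_right ?_ (Real.sqrt_nonneg _)
    calc _ ≤ C₁ * Real.exp (-c * t) * B₁ := by gcongr
      _ = C₁ * B₁ * Real.exp (-c * t) := by ring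
      _ ≤ _ := by
        gcongr
        exact le_max_right _ _
  · refine (sasakiNorm_mfderiv_le (σ := fun q => -r q) (hχ' t q)
      ((le_abs_self _).trans (hBs (φ t q))) hξ).trans ?_
    have h1 := hC' t ht.le q
    rw [← Real.exp_mul]
    refine mul_le_mul_of_nonneg_right ?_ (Real.sqrt_nonneg _)
    calc _ ≤ C * Real.exp (-c * t) * B := by gcongr
      _ = C * B * Real.exp (-c * t) := by ring
      _ ≤ _ := by
        gcongr
        exact le_max_left _ _

end UnitTangentBundle

end SplittingOfThermostats

theorem mainTheorem7 {M : Type*} [TopologicalSpace M] [ChartedSpace Plane M]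
    [IsManifold (𝓡 2) ∞ M] [T2Space M] [CompactSpace M]
    [RiemannianBundle (fun x : M => TangentSpace (𝓡 2) x)]
    [IsContMDiffRiemannianBundle (𝓡 2) ∞ Plane (fun x : M => TangentSpace (𝓡 2) x)]
    (o : SurfaceOrientation M)
    (lam : UnitTangentBundle M → ℝ) (hlam : ContMDiff 𝓘(ℝ, Plane × ℝ) 𝓘(ℝ, ℝ) ∞ lam)
    (p : UnitTangentBundle M → ℝ) (hp : ContMDiff 𝓘(ℝ, Plane × ℝ) 𝓘(ℝ, ℝ) ∞ p)
    (φ : ℝ → UnitTangentBundle M → UnitTangentBundle M)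
    (hφ : UnitTangentBundle.IsFlow (UnitTangentBundle.thermostat o lam) φ)
    (hκ : ∀ q, UnitTangentBundle.kappaP o lam p q < 0) :
    UnitTangentBundle.HasDominatedSplitting o lam φ ∧
      ((∀ q, UnitTangentBundle.kappaP o lam p q
          + (UnitTangentBundle.deriv (UnitTangentBundle.vfV o) lam q) ^ 2 / 4 < 0) →
        UnitTangentBundle.IsAnosov o (UnitTangentBundle.thermostat o lam) φ) :=
  ⟨UnitTangentBundle.hasDominatedSplitting hlam hp hφ hκ,
    UnitTangentBundle.isAnosov hlam hp hφ hκ⟩
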